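/- **Setting.** Work in the Euclidean plane $\mathbb{C}$. Let $\Delta$ be a bounded polygon: a bounded connected open set, equal to the interior of its closure, whose boundary $\partial\Delta$ is contained in a finite union of straight line segments ($\Delta$ need not be convex). A *piecewise rotation* $f$ of $\Delta$ is an injective map $f:\mathrm{dom}(f)\to\Delta$, with $\mathrm{dom}(f)\subset\Delta$, such that $\mathrm{dom}(f)$ and $f(\mathrm{dom}(f))$ are dense in $\Delta$, every connected component of $\mathrm{dom}(f)$ is an open convex polygon, and the restriction of $f$ to every component is an orientation preserving Euclidean isometry. It is *periodic* if for some integer $n>0$ one has $f^n=\mathrm{id}$ on $\mathrm{dom}(f^n)$. A *symmetric Nous pair* for $f$ consists of an orientation reversing Euclidean isometry $u$ with $u(\Delta)=\Delta$ and $u\circ u=\mathrm{id}_\Delta$, and a map $v:\mathrm{dom}(f)\to\mathrm{dom}(f)$ which is an orientation reversing Euclidean isometry on each component of $\mathrm{dom}(f)$, with $v\circ v=\mathrm{id}_{\mathrm{dom}(f)}$, such that $f=u\circ v$ on $\mathrm{dom}(f)$. Suppose that $\mathrm{dom}(f)$ has finitely many components $\Delta_0,\dots,\Delta_l$. Let $\overline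 u$ and $\overline v_i$ be the continuous extensions of $u$ to $\overline\Delta$ and of $v|_{\Delta_i}$ to $\overline{\Delta_i}$. The *double jump condition* says: for every $z\in\Delta\setminus\mathrm{dom}(f)$ and every $i$ with $z\in\partial\Delta_i$ one has $\overline v_i(z)\in\partial\Delta$. Let $\Gamma_f=\bigcup_i\partial\Delta_i\times\{i\}$, with Euclidean length and with each $\partial\Delta_i$ oriented counterclockwise, and let $\partial^*\Delta$ be the set of all $(z,i)\in\Gamma_f$ with $z\in\partial\Delta$; up to finitely many points, $\partial^*\Delta$ is $\partial\Delta$. Put $v^*(z,i)=(\overline v_i(z),j)$, where $v(\Delta_i)=\Delta_j$. For $(z,i)\in\Gamma_f$ with $z\in\Delta$ put $w^*(z,i)=(z,j)$, where $\Delta_i,\Delta_j$ ($j\neq i$) are the two components adjacent to $z$; for $z\in\partial\Delta$ put $w^*(z,i)=(\overline u(z),j)$, where $\Delta_j$ is the component adjacent to $\overline u(z)$. The map $w^*$ is undefined at the finitely many points where these components are not uniquely determined. Let $\mathcal R_{w^*\circ v^*}$ be the first return map of $w^*\circ v^*$ to $\partial^*\Delta$ (the *$wv$-return map*). For an interval exchange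 transformation $g$ of an interval that is divided into subintervals of lengths $\lambda_1,\dots,\lambda_n$, translated by $g$ by $t_1,\dots,t_n$ respectively, the *Sah–Arnoux–Fathi invariant* is $\mathrm{Inv}(g)=\sum_k\lambda_k\otimes t_k\in\mathbb{R}\otimes_{\mathbb{Q}}\mathbb{R}$. On an oriented metric graph such as $\partial^*\Delta$, interval exchanges and their invariants are defined by identifying the graph with an interval, up to finitely many points, by a piecewise isometry that preserves orientation; finite sets of points are ignored throughout. **Theorem.** Let $f$ be a piecewise rotation of a bounded polygon $\Delta$, given by a symmetric Nous pair $(u,v)$, such that $\mathrm{dom}(f)$ has finitely many components. If $f$ satisfies the double jump condition and is periodic, then the $wv$-return map $\mathcal R_{w^*\circ v^*}$ is an interval exchange transformation of $\partial^*\Delta$ (that is, of $\partial\Delta$) and has zero Sah–Arnoux–Fathi invariant: such identifications of $\partial^*\Delta$ with an interval exist and, for each of them, $\mathcal R_{w^*\circ v^*}$ becomes an interval exchange transformation $g$, with $\mathrm{Inv}(g)=\sum_k\lambda_k\otimes t_k=0$ for every subdivision as above. -/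

import Mathlib

open Set
open scoped TensorProduct ComplexConjugate

/-- The plane is `ℂ`. An open convex polygon (not necessarily bounded): a nonempty intersection of
finitely many open half-planes. -/
def IsOpenConvexPolygon (P : Set ℂ) : Prop :=
  P.Nonempty ∧ ∃ H : Finset (ℂ × ℝ), (∀ h ∈ H, h.1 ≠ 0) ∧ P = {z | ∀ h ∈ H, inner ℝ h.1 z < h.2}

/-- A bounded (open) polygon, not necessarily convex: a bounded, connected, open set without slits
or punctures whose boundary consists of finitely many straight line segments. -/
structure IsBoundedPolygon (Δ : Set ℂ) : Prop where
  bounded : Bornology.IsBounded Δ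
  isOpen : IsOpen Δ
  connected : IsConnected Δ
  interior_closure : interior (closure Δ) = Δ
  frontier_subset : ∃ E : Finset (ℂ × ℂ), frontier Δ ⊆ ⋃ e ∈ E, segment ℝ e.1 e.2

/-- The connected components of a set. -/
def components (D : Set ℂ) : Set (Set ℂ) :=
  {Q | ∃ x ∈ D, Q = connectedComponentIn D x}

/-- On `A`, the map `g` is an orientation preserving Euclidean isometry. -/
def IsRotationOn (g : ℂ → ℂ) (A : Set ℂ) : Prop :=
  ∃ a b : ℂ, ‖a‖ = 1 ∧ ∀ z ∈ A, g z = a * z + b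

/-- On `A`, the map `g` is an orientation reversing Euclidean isometry. -/
def IsReversingOn (g : ℂ → ℂ) (A : Set ℂ) : Prop :=
  ∃ a b : ℂ, ‖a‖ = 1 ∧ ∀ z ∈ A, g z = a * conj z + b

/-- A piecewise rotation of `Δ`: a partially defined injective map with domain `dom`
(the values of `toFun` outside `dom` are irrelevant). -/
structure PiecewiseRotation (Δ : Set ℂ) where
  toFun : ℂ → ℂ
  dom : Set ℂ
  dom_subset : dom ⊆ Δ
  dom_dense : Δ ⊆ closure dom
  image_subset : toFun '' dom ⊆ Δ
  image_dense : Δ ⊆ closure (toFun '' dom)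
  polygon : ∀ Q ∈ components dom, IsOpenConvexPolygon Q
  rotation : ∀ Q ∈ components dom, IsRotationOn toFun Q
  injOn : InjOn toFun dom

namespace PiecewiseRotation

variable {Δ : Set ℂ}

/-- `f ^ n = id` on `dom (f ^ n)` for some `n > 0`. -/
def IsPeriodic (f : PiecewiseRotation Δ) : Prop :=
  ∃ n : ℕ, 0 < n ∧ ∀ z, (∀ k < n, f.toFun^[k] z ∈ f.dom) → f.toFun^[n] z = z

/-- `(u, v)` is a symmetric Nous pair for `f`; here `u` is regarded as a map with domain `Δ`, and
`v` as a map with domain `dom f`. -/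
structure IsSymmetricNousPair (f : PiecewiseRotation Δ) (u v : ℂ → ℂ) : Prop where
  u_reversing : IsReversingOn u Δ
  u_image : u '' Δ = Δ
  u_invol : ∀ z ∈ Δ, u (u z) = z
  v_reversing : ∀ Q ∈ components f.dom, IsReversingOn v Q
  v_mapsTo : MapsTo v f.dom f.dom
  v_invol : ∀ z ∈ f.dom, v (v z) = z
  eq_comp : ∀ z ∈ f.dom, f.toFun z = u (v z)

/-- The double jump condition. For a component `Q` of `dom f`, `extendFrom Q v` is the continuous
extension of `v|_Q` to the closure of `Q`. -/
def DoubleJump (f : PiecewiseRotation Δ) (v : ℂ → ℂ) : Prop :=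
  ∀ z ∈ Δ \ f.dom, ∀ Q ∈ components f.dom, z ∈ frontier Q → extendFrom Q v z ∈ frontier Δ

/-- The components of `dom f` adjacent to the point `z`. -/
def adjacent (f : PiecewiseRotation Δ) (z : ℂ) : Set (Set ℂ) :=
  {Q | Q ∈ components f.dom ∧ z ∈ frontier Q}

/-- The graph `Γ_f`: the disjoint union of the boundaries of the components of `dom f`. A point is
a pair `(z, Q)` with `z ∈ ∂Q`. -/
def graph (f : PiecewiseRotation Δ) : Set (ℂ × Set ℂ) :=
  {p | p.2 ∈ f.adjacent p.1}

/-- The part `∂*Δ` of `Γ_f` that lies over the boundary of `Δ`. -/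
def boundaryStar (f : PiecewiseRotation Δ) : Set (ℂ × Set ℂ) :=
  {p | p ∈ f.graph ∧ p.1 ∈ frontier Δ}

/-- The map `v*` of `Γ_f`: the point `(z, Q)` goes to the image of `z` under the continuous
extension of `v|_Q`, on the boundary of the component `v(Q)`. -/
noncomputable def vStar (v : ℂ → ℂ) (p : ℂ × Set ℂ) : ℂ × Set ℂ :=
  (extendFrom p.2 v p.1, v '' p.2)

/-- The (graph of the) partial map `w*` of `Γ_f`: over `Δ` it switches between the two components
adjacent to `z`; over `∂Δ` it acts as the continuous extension of `u`. It is undefined where the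
number of components adjacent to the image point is not two, respectively not one. -/
def WStar (f : PiecewiseRotation Δ) (u : ℂ → ℂ) (p q : ℂ × Set ℂ) : Prop :=
  p ∈ f.graph ∧
    ((p.1 ∈ Δ ∧ q.1 = p.1 ∧ q.2 ≠ p.2 ∧ f.adjacent p.1 = {p.2, q.2}) ∨
      (p.1 ∈ frontier Δ ∧ q.1 = extendFrom Δ u p.1 ∧ f.adjacent q.1 = {q.2}))

/-- The (graph of the) partial map `w* ∘ v*` of `Γ_f`. -/
def WV (f : PiecewiseRotation Δ) (u v : ℂ → ℂ) (p q : ℂ × Set ℂ) : Prop :=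
  p ∈ f.graph ∧ f.WStar u (vStar v p) q

end PiecewiseRotation

/-- `y` is the image of `x ∈ A` under the first return map to `A` of the partial map with
graph `T`. -/
def IsFirstReturn {X : Type*} (T : X → X → Prop) (A : Set X) (x y : X) : Prop :=
  x ∈ A ∧ y ∈ A ∧ ∃ n : ℕ, 0 < n ∧ ∃ s : ℕ → X, s 0 = x ∧ s n = y ∧
    (∀ k < n, T (s k) (s (k + 1))) ∧ ∀ k, 0 < k → k < n → s k ∉ A

/-- The (graph of the) `wv`-return map: the first return map of `w* ∘ v*` to `∂*Δ`. -/
def PiecewiseRotation.WVReturn {Δ : Set ℂ} (f : PiecewiseRotation Δ) (u v : ℂ → ℂ) :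
    ℂ × Set ℂ → ℂ × Set ℂ → Prop :=
  IsFirstReturn (f.WV u v) f.boundaryStar

/-- `γ` identifies the interval of length `L` with the subset `X` of `Γ_f`, up to finitely many
points, preserving lengths and orientation: outside a finite set, `γ` is injective, locally moves
along a straight line on the boundary of one component `Q` with unit velocity `e`, and has `Q` on
its left (so that the boundary of each `Q` is oriented counterclockwise). -/
def IsArcParam (X : Set (ℂ × Set ℂ)) (L : ℝ) (γ : ℝ → ℂ × Set ℂ) : Prop :=
  0 < L ∧ ∃ S : Set ℝ, S.Finite ∧ InjOn γ (Ioo 0 L \ S) ∧ γ '' (Ioo 0 L \ S) ⊆ X ∧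
    (X \ γ '' (Ioo 0 L \ S)).Finite ∧
    ∀ x ∈ Ioo 0 L \ S, ∃ e : ℂ, ‖e‖ = 1 ∧ ∃ ε : ℝ, 0 < ε ∧
      (∀ t : ℝ, |t| < ε → γ (x + t) = ((γ x).1 + t * e, (γ x).2)) ∧
      ∀ r : ℝ, 0 < r → r < ε → (γ x).1 + r * (Complex.I * e) ∈ (γ x).2

/-- An interval exchange transformation of an interval of length `L`, with a partition
`0 = x 0 < x 1 < ... < x n = L` into subintervals, the `k`-th of which is translated by `t k`.
Division points are ignored. -/
structure IntervalExchange (L : ℝ) where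
  n : ℕ
  x : Fin (n + 1) → ℝ
  t : Fin n → ℝ
  strictMono : StrictMono x
  x_zero : x 0 = 0
  x_last : x (Fin.last n) = L
  image_subset : ∀ k, ∀ y ∈ Ioo (x k.castSucc) (x k.succ), y + t k ∈ Icc 0 L
  inj : ∀ k l, ∀ y ∈ Ioo (x k.castSucc) (x k.succ), ∀ z ∈ Ioo (x l.castSucc) (x l.succ),
    y + t k = z + t l → y = z

/-- The Sah--Arnoux--Fathi invariant: the sum of `λ_k ⊗ t_k`, where `λ_k` is the length of the
`k`-th subinterval. -/
noncomputable def IntervalExchange.saf {L : ℝ} (E : IntervalExchange L) : ℝ ⊗[ℚ] ℝ :=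
  ∑ k : Fin E.n, (E.x k.succ - E.x k.castSucc) ⊗ₜ[ℚ] E.t k

/-- In the coordinate `γ`, the partial map with graph `R` is the interval exchange `E` (up to
finitely many points). -/
def IntervalExchange.Represents {L : ℝ} (E : IntervalExchange L) (γ : ℝ → ℂ × Set ℂ)
    (R : ℂ × Set ℂ → ℂ × Set ℂ → Prop) : Prop :=
  ∀ k, ∀ y ∈ Ioo (E.x k.castSucc) (E.x k.succ), R (γ y) (γ (y + E.t k))

/-! A boundary point of a component is replaced by a germ `(z, n)`: the base point and the inner
unit normal. The maps `u` and `v` act on germs as involutions `uHat`, `vHat` that are (piecewise)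
isometries, `flipGerm` crosses the line, and `f` acts as `fHat = uHat ∘ vHat`. A germ lies on a
directed line with a coordinate `coord`, and all three involutions reverse it: `coord (uHat p) =
uDefect p - coord p`, `coord (vHat p) = vDefect p - coord p` on germs of the domain, and `coord
(flipGerm p) = -coord p`. A defect depends only on the normal and the isometry applied, and it is
odd under `flipGerm` wherever both sides of the line use the same isometry.

Fix an additive `ψ : ℝ → ℝ`. Along a periodic orbit of `fHat` the increments `ψ (coord (fHat p)) - ψ
(coord p) = ψ (uDefect (vHat p)) - ψ (vDefect p)` telescope to zero, so their integral for
one-dimensional Hausdorff measure over an invariant set vanishes. This is applied to `tower`, the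
(tame) germs whose orbit meets a side of a component. It is invariant under `uHat` and `vHat`, and
under `flipGerm` over `Δ`; hence `uDefect` and `vDefect` have the same `ψ`-integral over it.
Flipping cancels `vDefect` off the sides, and `uDefect` off the sides on `∂Δ`. What remains is
`setIntegral_uDefect_eq`: `∫ ψ (uDefect)` over `outerSides` equals `∫ ψ (vDefect)` over `sides`.

By the double jump condition `v` sends a side interior to `Δ` to `∂Δ`. The `wv`-return map therefore
takes one or two steps and is `u v` or `u v flip v` on germs (`rHat`). Its displacement is a
combination of defects, and changes of variables turn its `ψ`-integral into the difference of the
two integrals above, which is zero (`setIntegral_coord_rHat`).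

In an interval coordinate the displacement of the interval exchange differs from that of `rHat` by a
coboundary, whose integral vanishes because interval exchanges preserve Lebesgue measure. Thus `∑
λ_k * ψ (t_k) = 0` for every additive `ψ`; the coordinate functionals of a `ℚ`-basis of `ℝ` then
give the vanishing of the tensor. An additive `ψ` need not be measurable, but the integrands only
involve its values on functions with essentially finitely many values. -/

/-! ### One-sided germs of directed lines -/

/-- The half-disc of radius `ε` at the germ `p = (z, n)`, where `n` is the inner normal. -/
def halfDisc (p : ℂ × ℂ) (ε : ℝ) : Set ℂ :=
  {w | ‖w - p.1‖ < ε ∧ 0 < inner ℝ p.2 (w - p.1)}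

/-- The set `A` contains a half-disc at the germ `p`. -/
def Inward (A : Set ℂ) (p : ℂ × ℂ) : Prop :=
  ‖p.2‖ = 1 ∧ ∃ ε : ℝ, 0 < ε ∧ halfDisc p ε ⊆ A

/-- The action of the orientation reversing isometry `z ↦ a * conj z + b` on germs. -/
def rev (a b : ℂ) (p : ℂ × ℂ) : ℂ × ℂ := (a * conj p.1 + b, a * conj p.2)

/-- The germ on the opposite side of the same line. -/
def flipGerm (p : ℂ × ℂ) : ℂ × ℂ := (p.1, -p.2)

/-- Move a germ along its directed line. -/
def shift (t : ℝ) (p : ℂ × ℂ) : ℂ × ℂ := (p.1 - t * (Complex.I * p.2), p.2)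

/-- The position of a germ along its directed line. -/
def coord (p : ℂ × ℂ) : ℝ := p.1.re * p.2.im - p.1.im * p.2.re

/-- The constant value of `coord (rev a b p) + coord p`. -/
def defect (a b : ℂ) (p : ℂ × ℂ) : ℝ := b.re * (a * conj p.2).im - b.im * (a * conj p.2).re

theorem inner_eq (a b : ℂ) : inner ℝ a b = a.re * b.re + a.im * b.im := by
  rw [Complex.inner]; simp; ring

theorem sq_add_sq_of_norm {a : ℂ} (ha : ‖a‖ = 1) : a.re * a.re + a.im * a.im = 1 := by
  have := Complex.sq_norm a
  rw [ha, Complex.normSq_apply] at this; linarith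

theorem mul_conj_of_norm {a : ℂ} (ha : ‖a‖ = 1) : a * conj a = 1 := by
  rw [Complex.mul_conj, Complex.normSq_eq_norm_sq, ha]; simp

theorem coord_rev {a : ℂ} (ha : ‖a‖ = 1) (b : ℂ) (p : ℂ × ℂ) :
    coord (rev a b p) = defect a b p - coord p := by
  have h := sq_add_sq_of_norm ha
  simp only [coord, rev, defect, Complex.add_re, Complex.add_im, Complex.mul_re, Complex.mul_im,
    Complex.conj_re, Complex.conj_im]
  linear_combination (-(p.1.re * p.2.im) + p.1.im * p.2.re) * h

theorem coord_flip (p : ℂ × ℂ) : coord (flipGerm p) = -coord p := by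
  simp [coord, flipGerm]; ring

theorem coord_shift {p : ℂ × ℂ} (hp : ‖p.2‖ = 1) (t : ℝ) : coord (shift t p) = coord p + t := by
  have h := sq_add_sq_of_norm hp
  simp [coord, shift]
  linear_combination t * h

/-- This sign is what makes the two germs over an interior point cancel in the integrals of defects.
-/
theorem defect_flip (a b : ℂ) (p : ℂ × ℂ) : defect a b (flipGerm p) = -defect a b p := by
  simp [defect, flipGerm]; ring

theorem flipGerm_flipGerm (p : ℂ × ℂ) : flipGerm (flipGerm p) = p := by simp [flipGerm]

theorem rev_flip (a b : ℂ) (p : ℂ × ℂ) : rev a b (flipGerm p) = flipGerm (rev a b p) := by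
  simp [rev, flipGerm]

/-- Inner normals go to inner normals while orientation is reversed, so motion with the inner side
on the left turns around. -/
theorem rev_shift (a b : ℂ) (t : ℝ) (p : ℂ × ℂ) :
    rev a b (shift t p) = shift (-t) (rev a b p) := by
  simp [rev, shift]; ring

theorem flip_shift (t : ℝ) (p : ℂ × ℂ) : flipGerm (shift t p) = shift (-t) (flipGerm p) := by
  simp [flipGerm, shift]

theorem shift_shift (s t : ℝ) (p : ℂ × ℂ) : shift s (shift t p) = shift (t + s) p := by
  simp [shift]; ring

theorem shift_zero (p : ℂ × ℂ) : shift 0 p = p := by simp [shift]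

theorem norm_rev_snd {a : ℂ} (ha : ‖a‖ = 1) (b : ℂ) (p : ℂ × ℂ) : ‖(rev a b p).2‖ = ‖p.2‖ := by
  simp [rev, ha]

theorem rev_rev_of_inverse {a b a' b' : ℂ} (h1 : a' * conj a = 1) (h2 : a' * conj b + b' = 0)
    (p : ℂ × ℂ) : rev a' b' (rev a b p) = p := by
  ext1
  · simp only [rev, map_add, map_mul, Complex.conj_conj]
    linear_combination p.1 * h1 + h2
  · simp only [rev, map_mul, Complex.conj_conj]
    linear_combination p.2 * h1

theorem isometry_rev {a : ℂ} (ha : ‖a‖ = 1) (b : ℂ) : Isometry (rev a b) := by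
  have h1 : Isometry fun z : ℂ => a * conj z + b := by
    refine Isometry.of_dist_eq fun z w => ?_
    rw [dist_add_right, dist_eq_norm, dist_eq_norm, ← mul_sub, norm_mul, ha, one_mul, ← map_sub,
      Complex.norm_conj]
  have h2 : Isometry fun z : ℂ => a * conj z := by
    refine Isometry.of_dist_eq fun z w => ?_
    rw [dist_eq_norm, dist_eq_norm, ← mul_sub, norm_mul, ha, one_mul, ← map_sub,
      Complex.norm_conj]
  exact h1.prodMap h2

theorem isometry_flip : Isometry flipGerm := by
  have h2 : Isometry fun z : ℂ => -z := Isometry.of_dist_eq fun z w => by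
    rw [dist_neg_neg]
  exact isometry_id.prodMap h2

/-- The normal is constant along the line and `ℂ × ℂ` carries the maximum metric, so Hausdorff
measure on a line of germs is ordinary length. -/
theorem isometry_shift {p : ℂ × ℂ} (hp : ‖p.2‖ = 1) : Isometry fun t : ℝ => shift t p := by
  refine Isometry.of_dist_eq fun s t => ?_
  rw [Prod.dist_eq, Real.dist_eq]
  have : dist (shift s p).1 (shift t p).1 = |s - t| := by
    rw [dist_eq_norm, ← Real.norm_eq_abs, ← Complex.norm_real, ← norm_neg (_ - _ : ℂ)]
    have : -((shift s p).1 - (shift t p).1) = ((s - t : ℝ) : ℂ) * (Complex.I * p.2) := by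
      simp [shift]; ring
    rw [this]; simp [hp]
  rw [this]; simp [shift]

theorem inner_rev {a : ℂ} (ha : ‖a‖ = 1) (x y : ℂ) :
    inner ℝ (a * conj x) (a * conj y) = inner ℝ x y := by
  have h := sq_add_sq_of_norm ha
  simp only [inner_eq, Complex.mul_re, Complex.mul_im, Complex.conj_re, Complex.conj_im]
  linear_combination (x.re * y.re + x.im * y.im) * h

theorem mem_halfDisc_rev {a : ℂ} (ha : ‖a‖ = 1) (b : ℂ) (p : ℂ × ℂ) (ε : ℝ) (w : ℂ) :
    a * conj w + b ∈ halfDisc (rev a b p) ε ↔ w ∈ halfDisc p ε := by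
  have : a * conj w + b - (a * conj p.1 + b) = a * conj (w - p.1) := by rw [map_sub]; ring
  simp only [halfDisc, rev, mem_ofPred_eq, this, inner_rev ha, norm_mul, ha, one_mul,
    Complex.norm_conj]

theorem isOpen_halfDisc (p : ℂ × ℂ) (ε : ℝ) : IsOpen (halfDisc p ε) := by
  have h1 : IsOpen {w : ℂ | ‖w - p.1‖ < ε} := isOpen_lt (by fun_prop) continuous_const
  have h2 : IsOpen {w : ℂ | 0 < inner ℝ p.2 (w - p.1)} :=
    isOpen_lt continuous_const (Continuous.inner continuous_const (by fun_prop))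
  exact h1.inter h2

theorem mem_halfDisc_add {p : ℂ × ℂ} (hp : ‖p.2‖ = 1) {ε r : ℝ} (hr : 0 < r) (hrε : r < ε) :
    p.1 + r * p.2 ∈ halfDisc p ε := by
  have h := sq_add_sq_of_norm hp
  constructor
  · simp [hp, abs_of_pos hr, hrε]
  · have : inner ℝ p.2 (p.1 + r * p.2 - p.1) = r := by
      simp; linear_combination r * h
    rw [this]; exact hr

theorem halfDisc_nonempty {p : ℂ × ℂ} (hp : ‖p.2‖ = 1) {ε : ℝ} (hε : 0 < ε) :
    (halfDisc p ε).Nonempty :=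
  ⟨_, mem_halfDisc_add hp (half_pos hε) (half_lt_self hε)⟩

theorem halfDisc_mono (p : ℂ × ℂ) {ε δ : ℝ} (h : ε ≤ δ) : halfDisc p ε ⊆ halfDisc p δ :=
  fun _ hw => ⟨hw.1.trans_le h, hw.2⟩

theorem mem_closure_halfDisc {p : ℂ × ℂ} (hp : ‖p.2‖ = 1) {ε : ℝ} (hε : 0 < ε) :
    p.1 ∈ closure (halfDisc p ε) := by
  rw [Metric.mem_closure_iff]
  intro δ hδ
  have hm : 0 < min ε δ := lt_min hε hδ
  refine ⟨_, mem_halfDisc_add hp (half_pos hm) ((half_lt_self hm).trans_le (min_le_left _ _)), ?_⟩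
  have : min ε δ / 2 < δ := (half_lt_self hm).trans_le (min_le_right _ _)
  rw [dist_eq_norm]
  simpa [hp, abs_of_pos hε, abs_of_pos hm] using this

theorem Inward.mono {A B : Set ℂ} (h : A ⊆ B) {p : ℂ × ℂ} (hp : Inward A p) : Inward B p :=
  ⟨hp.1, hp.2.imp fun _ h' => ⟨h'.1, h'.2.trans h⟩⟩

theorem Inward.mem_closure {A : Set ℂ} {p : ℂ × ℂ} (hp : Inward A p) : p.1 ∈ closure A := by
  obtain ⟨h1, ε, hε, h⟩ := hp
  exact closure_mono h (mem_closure_halfDisc h1 hε)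

theorem Inward.rev {A A' : Set ℂ} {a b : ℂ} (ha : ‖a‖ = 1) (hA : ∀ z ∈ A, a * conj z + b ∈ A')
    {p : ℂ × ℂ} (hp : Inward A p) : Inward A' (rev a b p) := by
  obtain ⟨h1, ε, hε, h⟩ := hp
  refine ⟨by rwa [norm_rev_snd ha], ε, hε, fun w hw => ?_⟩
  have hw' : a * conj (conj (conj a * (w - b))) + b = w := by
    have := mul_conj_of_norm ha
    simp only [Complex.conj_conj]
    linear_combination (w - b) * this
  rw [← hw'] at hw ⊢
  exact hA _ (h ((mem_halfDisc_rev ha b p ε _).1 hw))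

theorem norm_shift_sub {p : ℂ × ℂ} (hp : ‖p.2‖ = 1) (t : ℝ) : ‖(shift t p).1 - p.1‖ = |t| := by
  simp [shift, hp]

theorem inner_shift (t : ℝ) (p : ℂ × ℂ) (w : ℂ) :
    inner ℝ p.2 (w - (shift t p).1) = inner ℝ p.2 (w - p.1) := by
  simp [shift]; ring

theorem halfDisc_shift_subset {p : ℂ × ℂ} (hp : ‖p.2‖ = 1) (t ε : ℝ) :
    halfDisc (shift t p) (ε - |t|) ⊆ halfDisc p ε := by
  intro w hw
  refine ⟨?_, by rw [← inner_shift t]; exact hw.2⟩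
  have h1 : ‖w - p.1‖ ≤ ‖w - (shift t p).1‖ + ‖(shift t p).1 - p.1‖ := by
    simpa using norm_add_le (w - (shift t p).1) ((shift t p).1 - p.1)
  rw [norm_shift_sub hp] at h1
  linarith [hw.1]

theorem inward_shift {A : Set ℂ} {p : ℂ × ℂ} (hp : ‖p.2‖ = 1) {ε : ℝ}
    (h : halfDisc p ε ⊆ A) {t : ℝ} (ht : |t| < ε) : Inward A (shift t p) :=
  ⟨hp, ε - |t|, by linarith, (halfDisc_shift_subset hp t ε).trans h⟩

/-- The union of the directed lines through the germs in `K`. -/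
def leaves (K : Set (ℂ × ℂ)) : Set (ℂ × ℂ) := {p | ∃ k ∈ K, ‖k.2‖ = 1 ∧ ∃ t : ℝ, p = shift t k}

theorem leaves_mono {K K' : Set (ℂ × ℂ)} (h : K ⊆ K') : leaves K ⊆ leaves K' :=
  fun _ ⟨k, hk, h'⟩ => ⟨k, h hk, h'⟩

theorem rev_mem_leaves {a : ℂ} (ha : ‖a‖ = 1) (b : ℂ) {K : Set (ℂ × ℂ)} {p : ℂ × ℂ}
    (hp : p ∈ leaves K) : rev a b p ∈ leaves (rev a b '' K) := by
  obtain ⟨k, hk, hn, t, rfl⟩ := hp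
  exact ⟨_, mem_image_of_mem _ hk, by rwa [norm_rev_snd ha], -t, rev_shift ..⟩

theorem flip_mem_leaves {K : Set (ℂ × ℂ)} {p : ℂ × ℂ} (hp : p ∈ leaves K) :
    flipGerm p ∈ leaves (flipGerm '' K) := by
  obtain ⟨k, hk, hn, t, rfl⟩ := hp
  exact ⟨_, mem_image_of_mem _ hk, by simpa [flipGerm], -t, flip_shift ..⟩

theorem exists_affine_eq {a b a' b' : ℂ} {U : Set ℂ} (hU : IsOpen U) (hne : U.Nonempty)
    (h : ∀ w ∈ U, a * w + b = a' * w + b') : a = a' ∧ b = b' := by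
  obtain ⟨w, hw⟩ := hne
  obtain ⟨ε, hε, hb⟩ := Metric.isOpen_iff.1 hU w hw
  have h2 : w + (ε / 2 : ℝ) ∈ U := hb (by
    rw [Metric.mem_ball, dist_eq_norm]
    simp only [add_sub_cancel_left, Complex.norm_real, Real.norm_eq_abs]
    rw [abs_of_pos (half_pos hε)]; exact half_lt_self hε)
  have e1 := h _ hw
  have e2 := h _ h2
  have hne : ((ε / 2 : ℝ) : ℂ) ≠ 0 := by
    exact_mod_cast (half_pos hε).ne'
  have : a = a' := by
    apply mul_right_cancel₀ hne
    linear_combination e2 - e1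
  subst this
  exact ⟨rfl, by linear_combination e1⟩

/-! ### The actions of `u`, `v` and `f` on germs. -/

/-- A piecewise rotation with finitely many components, given by a symmetric Nous pair and
subject to the double jump condition, together with coefficients of all the maps and half-planes
that define the components. -/
structure NousData {Δ : Set ℂ} (f : PiecewiseRotation Δ) (u v : ℂ → ℂ) where
  isOpen : IsOpen Δ
  bounded : Bornology.IsBounded Δ
  nonempty : Δ.Nonempty
  interior_closure : interior (closure Δ) = Δ
  finite : (components f.dom).Finite
  planes : Set ℂ → Finset (ℂ × ℝ)
  planes_ne : ∀ Q ∈ components f.dom, ∀ h ∈ planes Q, h.1 ≠ 0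
  eq_planes : ∀ Q ∈ components f.dom, Q = {z | ∀ h ∈ planes Q, inner ℝ h.1 z < h.2}
  va : Set ℂ → ℂ
  vb : Set ℂ → ℂ
  norm_va : ∀ Q ∈ components f.dom, ‖va Q‖ = 1
  v_eq : ∀ Q ∈ components f.dom, ∀ z ∈ Q, v z = va Q * conj z + vb Q
  ua : ℂ
  ub : ℂ
  norm_ua : ‖ua‖ = 1
  u_eq : ∀ z ∈ Δ, u z = ua * conj z + ub
  nous : f.IsSymmetricNousPair u v
  jump : f.DoubleJump v
  period : ℕ
  period_pos : 0 < period
  periodic : ∀ z, (∀ k < period, f.toFun^[k] z ∈ f.dom) → f.toFun^[period] z = z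

theorem mem_components_of_mem {D : Set ℂ} {x : ℂ} (hx : x ∈ D) :
    connectedComponentIn D x ∈ components D := ⟨x, hx, rfl⟩

theorem subset_of_mem_components {D Q : Set ℂ} (hQ : Q ∈ components D) : Q ⊆ D := by
  obtain ⟨x, _, rfl⟩ := hQ
  exact connectedComponentIn_subset _ _

theorem nonempty_of_mem_components {D Q : Set ℂ} (hQ : Q ∈ components D) : Q.Nonempty := by
  obtain ⟨x, hx, rfl⟩ := hQ
  exact ⟨x, mem_connectedComponentIn hx⟩

theorem eq_connectedComponentIn_of_mem {D Q : Set ℂ} (hQ : Q ∈ components D) {z : ℂ}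
    (hz : z ∈ Q) : Q = connectedComponentIn D z := by
  obtain ⟨x, hx, rfl⟩ := hQ
  exact connectedComponentIn_eq hz

theorem eq_of_mem_components {D Q Q' : Set ℂ} (hQ : Q ∈ components D) (hQ' : Q' ∈ components D)
    {z : ℂ} (hz : z ∈ Q) (hz' : z ∈ Q') : Q = Q' :=
  (eq_connectedComponentIn_of_mem hQ hz).trans (eq_connectedComponentIn_of_mem hQ' hz').symm

theorem isPreconnected_of_mem_components {D Q : Set ℂ} (hQ : Q ∈ components D) :
    IsPreconnected Q := by
  obtain ⟨x, hx, rfl⟩ := hQ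
  exact isPreconnected_connectedComponentIn

namespace NousData

variable {Δ : Set ℂ} {f : PiecewiseRotation Δ} {u v : ℂ → ℂ} (D : NousData f u v)
include D

theorem isOpen_component {Q : Set ℂ} (hQ : Q ∈ components f.dom) : IsOpen Q := by
  rw [D.eq_planes Q hQ]
  have : {z : ℂ | ∀ h ∈ D.planes Q, inner ℝ h.1 z < h.2} =
      ⋂ h ∈ D.planes Q, {z : ℂ | inner ℝ h.1 z < h.2} := by ext; simp
  rw [this]
  exact isOpen_biInter_finset fun h _ =>
    isOpen_lt (Continuous.inner continuous_const continuous_id) continuous_const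

theorem convex_component {Q : Set ℂ} (hQ : Q ∈ components f.dom) : Convex ℝ Q := by
  rw [D.eq_planes Q hQ]
  have : {z : ℂ | ∀ h ∈ D.planes Q, inner ℝ h.1 z < h.2} =
      ⋂ h ∈ D.planes Q, {z : ℂ | innerₗ ℂ h.1 z < h.2} := by ext; simp
  rw [this]
  exact convex_iInter fun h => convex_iInter fun _ =>
    convex_halfSpace_lt (innerₗ ℂ h.1).isLinear _

theorem isOpen_dom : IsOpen f.dom := by
  have : f.dom = ⋃ Q ∈ components f.dom, Q := by
    ext z
    simp only [mem_iUnion]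
    exact ⟨fun hz => ⟨_, mem_components_of_mem hz, mem_connectedComponentIn hz⟩,
      fun ⟨Q, hQ, hz⟩ => subset_of_mem_components hQ hz⟩
  rw [this]
  exact isOpen_biUnion fun Q hQ => D.isOpen_component hQ

omit D in
theorem component_subset {Q : Set ℂ} (hQ : Q ∈ components f.dom) : Q ⊆ Δ :=
  (subset_of_mem_components hQ).trans f.dom_subset

theorem image_v_subset {Q : Set ℂ} (hQ : Q ∈ components f.dom) :
    ∃ Q' ∈ components f.dom, v '' Q ⊆ Q' := by
  obtain ⟨x, hx⟩ := nonempty_of_mem_components hQ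
  have hvx : v x ∈ f.dom := D.nous.v_mapsTo (subset_of_mem_components hQ hx)
  refine ⟨_, mem_components_of_mem hvx, ?_⟩
  refine IsPreconnected.subset_connectedComponentIn ?_ (mem_image_of_mem _ hx) ?_
  · refine (isPreconnected_of_mem_components hQ).image _ ?_
    have : ContinuousOn (fun z => D.va Q * conj z + D.vb Q) Q := by fun_prop
    exact this.congr fun z hz => D.v_eq Q hQ z hz
  · rintro _ ⟨z, hz, rfl⟩
    exact D.nous.v_mapsTo (subset_of_mem_components hQ hz)

theorem image_v_image_v {Q : Set ℂ} (hQ : Q ∈ components f.dom) : v '' (v '' Q) = Q := by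
  rw [image_image]
  have : EqOn (fun z => v (v z)) id Q := fun z hz =>
    D.nous.v_invol z (subset_of_mem_components hQ hz)
  rw [this.image_eq, image_id]

/-- Connectedness gives only inclusions `v(Q) ⊆ Q'` and `v(Q') ⊆ Q''`; since `v` is an involution,
`Q` meets `Q''`, so they coincide and the inclusions become equalities. -/
theorem image_v_mem {Q : Set ℂ} (hQ : Q ∈ components f.dom) : v '' Q ∈ components f.dom := by
  obtain ⟨Q', hQ', h⟩ := D.image_v_subset hQ
  obtain ⟨Q'', hQ'', h'⟩ := D.image_v_subset hQ'
  have h1 : Q ⊆ Q'' := by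
    rw [← D.image_v_image_v hQ]
    exact (image_mono h).trans h'
  obtain ⟨x, hx⟩ := nonempty_of_mem_components hQ
  have h2 : Q = Q'' := eq_of_mem_components hQ hQ'' hx (h1 hx)
  have h3 : v '' Q = Q' := by
    refine h.antisymm ?_
    rw [← D.image_v_image_v hQ']
    rw [← h2] at h'
    exact image_mono h'
  rwa [h3]

theorem va_inverse {Q : Set ℂ} (hQ : Q ∈ components f.dom) :
    D.va (v '' Q) * conj (D.va Q) = 1 ∧
      D.va (v '' Q) * conj (D.vb Q) + D.vb (v '' Q) = 0 := by
  refine exists_affine_eq (D.isOpen_component hQ) (nonempty_of_mem_components hQ) fun w hw => ?_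
  have h1 := D.nous.v_invol w (subset_of_mem_components hQ hw)
  rw [D.v_eq _ (D.image_v_mem hQ) _ (mem_image_of_mem _ hw), D.v_eq _ hQ _ hw] at h1
  simp only [map_add, map_mul, Complex.conj_conj] at h1
  linear_combination h1

theorem u_mem {z : ℂ} (hz : z ∈ Δ) : D.ua * conj z + D.ub ∈ Δ := by
  rw [← D.u_eq z hz, ← D.nous.u_image]
  exact mem_image_of_mem _ hz

theorem ua_inverse : D.ua * conj D.ua = 1 ∧ D.ua * conj D.ub + D.ub = 0 := by
  refine exists_affine_eq D.isOpen D.nonempty fun w hw => ?_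
  have h1 := D.nous.u_invol w hw
  rw [D.u_eq w hw, D.u_eq _ (D.u_mem hw)] at h1
  simp only [map_add, map_mul, Complex.conj_conj] at h1
  linear_combination h1

/-- The action of `u` on germs. -/
def uHat : ℂ × ℂ → ℂ × ℂ := rev D.ua D.ub

omit D in
/-- The germs at which a component of the domain contains a half-disc. -/
def germs (_ : NousData f u v) : Set (ℂ × ℂ) := {p | ∃ Q ∈ components f.dom, Inward Q p}

open Classical in
/-- The component of the domain on the inner side of a germ. -/
noncomputable def cell (p : ℂ × ℂ) : Set ℂ := if h : p ∈ D.germs then h.choose else ∅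

open Classical in
/-- The action of `v` on germs; by convention it fixes the germs outside of the domain. -/
noncomputable def vHat (p : ℂ × ℂ) : ℂ × ℂ :=
  if p ∈ D.germs then rev (D.va (D.cell p)) (D.vb (D.cell p)) p else p

theorem cell_mem {p : ℂ × ℂ} (hp : p ∈ D.germs) : D.cell p ∈ components f.dom := by
  rw [cell, dif_pos hp]; exact hp.choose_spec.1

theorem inward_cell {p : ℂ × ℂ} (hp : p ∈ D.germs) : Inward (D.cell p) p := by
  rw [cell, dif_pos hp]; exact hp.choose_spec.2

omit D in
theorem _root_.Inward.inter_nonempty {A A' : Set ℂ} {p : ℂ × ℂ} (h : Inward A p)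
    (h' : Inward A' p) : (A ∩ A').Nonempty := by
  obtain ⟨h1, ε, hε, hA⟩ := h
  obtain ⟨-, δ, hδ, hA'⟩ := h'
  obtain ⟨w, hw⟩ := halfDisc_nonempty h1 (lt_min hε hδ)
  exact ⟨w, hA (halfDisc_mono _ (min_le_left _ _) hw), hA' (halfDisc_mono _ (min_le_right _ _) hw)⟩

theorem cell_eq {Q : Set ℂ} (hQ : Q ∈ components f.dom) {p : ℂ × ℂ} (hp : Inward Q p) :
    p ∈ D.germs ∧ D.cell p = Q := by
  have h : p ∈ D.germs := ⟨Q, hQ, hp⟩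
  obtain ⟨w, hw, hw'⟩ := (D.inward_cell h).inter_nonempty hp
  exact ⟨h, eq_of_mem_components (D.cell_mem h) hQ hw hw'⟩

theorem vHat_of_mem {p : ℂ × ℂ} (hp : p ∈ D.germs) :
    D.vHat p = rev (D.va (D.cell p)) (D.vb (D.cell p)) p := if_pos hp

theorem vHat_eq {Q : Set ℂ} (hQ : Q ∈ components f.dom) {p : ℂ × ℂ} (hp : Inward Q p) :
    D.vHat p = rev (D.va Q) (D.vb Q) p := by
  obtain ⟨h, h'⟩ := D.cell_eq hQ hp
  rw [D.vHat_of_mem h, h']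

theorem inward_vHat {Q : Set ℂ} (hQ : Q ∈ components f.dom) {p : ℂ × ℂ} (hp : Inward Q p) :
    Inward (v '' Q) (D.vHat p) := by
  rw [D.vHat_eq hQ hp]
  refine hp.rev (D.norm_va Q hQ) fun z hz => ?_
  rw [← D.v_eq Q hQ z hz]
  exact mem_image_of_mem _ hz

theorem vHat_mem {p : ℂ × ℂ} (hp : p ∈ D.germs) : D.vHat p ∈ D.germs :=
  ⟨_, D.image_v_mem (D.cell_mem hp), D.inward_vHat (D.cell_mem hp) (D.inward_cell hp)⟩

theorem cell_vHat {p : ℂ × ℂ} (hp : p ∈ D.germs) : D.cell (D.vHat p) = v '' D.cell p :=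
  (D.cell_eq (D.image_v_mem (D.cell_mem hp))
    (D.inward_vHat (D.cell_mem hp) (D.inward_cell hp))).2

theorem vHat_vHat (p : ℂ × ℂ) : D.vHat (D.vHat p) = p := by
  by_cases hp : p ∈ D.germs
  · rw [D.vHat_of_mem (D.vHat_mem hp), D.cell_vHat hp, D.vHat_of_mem hp]
    obtain ⟨h1, h2⟩ := D.va_inverse (D.cell_mem hp)
    exact rev_rev_of_inverse h1 h2 p
  · have : D.vHat p = p := if_neg hp
    rw [this, this]

theorem uHat_uHat (p : ℂ × ℂ) : D.uHat (D.uHat p) = p :=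
  rev_rev_of_inverse D.ua_inverse.1 D.ua_inverse.2 p

theorem inward_uHat {p : ℂ × ℂ} (hp : Inward Δ p) : Inward Δ (D.uHat p) :=
  hp.rev D.norm_ua fun _ hz => D.u_mem hz

theorem norm_of_mem {p : ℂ × ℂ} (hp : p ∈ D.germs) : ‖p.2‖ = 1 := (D.inward_cell hp).1

theorem inward_of_mem {p : ℂ × ℂ} (hp : p ∈ D.germs) : Inward Δ p :=
  (D.inward_cell hp).mono (component_subset (D.cell_mem hp))

theorem mem_cell_of_mem_dom {p : ℂ × ℂ} (hp : p ∈ D.germs) (h : p.1 ∈ f.dom) :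
    p.1 ∈ D.cell p := by
  have hQ := mem_components_of_mem h
  have h1 := mem_connectedComponentIn h
  obtain ⟨w, hw, hw'⟩ := mem_closure_iff.1 (D.inward_cell hp).mem_closure _
    (D.isOpen_component hQ) h1
  rwa [← eq_of_mem_components hQ (D.cell_mem hp) hw hw']

theorem flip_mem_of_mem_dom {p : ℂ × ℂ} (hp : ‖p.2‖ = 1) (h : p.1 ∈ f.dom) :
    p ∈ D.germs := by
  have hQ := mem_components_of_mem h
  refine ⟨_, hQ, hp, ?_⟩
  obtain ⟨ε, hε, hb⟩ := Metric.isOpen_iff.1 (D.isOpen_component hQ) _ (mem_connectedComponentIn h)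
  refine ⟨ε, hε, fun w hw => hb ?_⟩
  rw [Metric.mem_ball, dist_eq_norm]; exact hw.1

theorem cell_of_mem_dom {p : ℂ × ℂ} (hp : ‖p.2‖ = 1) (h : p.1 ∈ f.dom) :
    D.cell p = connectedComponentIn f.dom p.1 :=
  eq_connectedComponentIn_of_mem (D.cell_mem (D.flip_mem_of_mem_dom hp h))
    (D.mem_cell_of_mem_dom (D.flip_mem_of_mem_dom hp h) h)

/-- Over a point of the domain both sides of the line lie in one component, so the same isometry
moves both germs. -/
theorem vHat_flip {p : ℂ × ℂ} (hp : ‖p.2‖ = 1) (h : p.1 ∈ f.dom) :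
    D.vHat (flipGerm p) = flipGerm (D.vHat p) := by
  have hp' : ‖(flipGerm p).2‖ = 1 := by simpa [flipGerm]
  rw [D.vHat_of_mem (D.flip_mem_of_mem_dom hp h), D.vHat_of_mem (D.flip_mem_of_mem_dom hp' h),
    D.cell_of_mem_dom hp h, D.cell_of_mem_dom hp' h, rev_flip]; rfl

theorem uHat_flip (p : ℂ × ℂ) : D.uHat (flipGerm p) = flipGerm (D.uHat p) := rev_flip _ _ _

theorem vHat_fst_mem_dom_iff {p : ℂ × ℂ} (hp : p ∈ D.germs) :
    (D.vHat p).1 ∈ f.dom ↔ p.1 ∈ f.dom := by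
  have key : ∀ p ∈ D.germs, p.1 ∈ f.dom → (D.vHat p).1 ∈ f.dom := by
    intro p hp h
    have h1 := D.mem_cell_of_mem_dom hp h
    rw [D.vHat_of_mem hp]
    change D.va (D.cell p) * conj p.1 + D.vb (D.cell p) ∈ f.dom
    rw [← D.v_eq _ (D.cell_mem hp) _ h1]
    exact D.nous.v_mapsTo h
  refine ⟨fun h => ?_, key p hp⟩
  have := key _ (D.vHat_mem hp) h
  rwa [D.vHat_vHat] at this

/-- The action of `f` on germs. -/
noncomputable def fHat (p : ℂ × ℂ) : ℂ × ℂ := D.uHat (D.vHat p)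

/-- A small half-disc follows the germ through the same components, so on it `f^k` is a single
rotation, the one that moves the germ. This transfers statements about points of `dom (f^k)` to
germs. -/
theorem fHat_iterate_eq (p : ℂ × ℂ) (k : ℕ)
    (hp : ∀ j < k, D.fHat^[j] p ∈ D.germs) :
    ∃ a b : ℂ, ‖a‖ = 1 ∧ D.fHat^[k] p = (a * p.1 + b, a * p.2) ∧ ∃ ε : ℝ, 0 < ε ∧
      ∀ w ∈ halfDisc p ε, (∀ j < k, f.toFun^[j] w ∈ f.dom) ∧ f.toFun^[k] w = a * w + b := by
  induction k with
  | zero => exact ⟨1, 0, by simp, by simp, 1, one_pos, fun w _ => by simp⟩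
  | succ k ih =>
    obtain ⟨a, b, ha, hab, ε, hε, hw⟩ := ih fun j hj => hp j (hj.trans (Nat.lt_succ_self k))
    have hk := hp k (Nat.lt_succ_self k)
    set q := D.fHat^[k] p with hq
    have hQ := D.cell_mem hk
    obtain ⟨-, δ, hδ, hδQ⟩ := D.inward_cell hk
    have hv := D.vHat_of_mem hk
    generalize D.cell q = Q at hQ hδQ hv
    refine ⟨D.ua * conj (D.va Q) * a, D.ua * (conj (D.va Q) * b + conj (D.vb Q)) + D.ub, ?_, ?_,
      min ε δ, lt_min hε hδ, fun w hw' => ?_⟩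
    · rw [norm_mul, norm_mul, D.norm_ua, Complex.norm_conj, D.norm_va Q hQ, ha]; norm_num
    · rw [Function.iterate_succ_apply', ← hq, fHat, hv, hab]
      simp only [uHat, rev, map_add, map_mul, Complex.conj_conj, Prod.mk.injEq]
      constructor <;> ring
    · obtain ⟨h1, h2⟩ := hw w (halfDisc_mono _ (min_le_left _ _) hw')
      have h3 : a * w + b ∈ Q := by
        refine hδQ ⟨?_, ?_⟩
        · rw [hab]
          have : a * w + b - (a * p.1 + b) = a * (w - p.1) := by ring
          rw [this, norm_mul, ha, one_mul]
          exact hw'.1.trans_le (min_le_right _ _)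
        · rw [hab]
          have e1 : a * w + b - (a * p.1 + b) = a * conj (conj (w - p.1)) := by
            rw [Complex.conj_conj]; ring
          have e2 : a * p.2 = a * conj (conj p.2) := by rw [Complex.conj_conj]
          rw [e1, e2, inner_rev ha]
          have := hw'.2
          simp only [inner_eq, Complex.conj_re, Complex.conj_im] at this ⊢
          linarith
      have h4 := subset_of_mem_components hQ h3
      refine ⟨fun j hj => ?_, ?_⟩
      · rcases Nat.lt_succ_iff_lt_or_eq.1 hj with hj | rfl
        · exact h1 j hj
        · rwa [h2]
      · rw [Function.iterate_succ_apply', h2, D.nous.eq_comp _ h4,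
          D.u_eq _ (f.dom_subset (D.nous.v_mapsTo h4)), D.v_eq Q hQ _ h3]
        simp only [map_add, map_mul, Complex.conj_conj]
        ring

/-- A rotation that is the identity on a half-disc has the coefficients of the identity, so it fixes
the germ too, even when the base point lies outside the domain. -/
theorem fHat_iterate_period {p : ℂ × ℂ} (hp : ∀ j < D.period, D.fHat^[j] p ∈ D.germs) :
    D.fHat^[D.period] p = p := by
  have hn : ‖p.2‖ = 1 := D.norm_of_mem (hp 0 D.period_pos)
  obtain ⟨a, b, -, hab, ε, hε, hw⟩ := D.fHat_iterate_eq p _ hp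
  obtain ⟨h1, h2⟩ := exists_affine_eq (isOpen_halfDisc p ε) (halfDisc_nonempty hn hε)
    (a := a) (b := b) (a' := 1) (b' := 0) fun w hw' => by
      obtain ⟨h1, h2⟩ := hw w hw'
      rw [← h2, D.periodic w h1]; ring
  rw [hab, h1, h2]; simp

end NousData

/-! ### Half-discs and half-planes; outward germs. -/

theorem inner_decomp {n : ℂ} (hn : ‖n‖ = 1) (h w : ℂ) :
    inner ℝ h w = inner ℝ h n * inner ℝ n w +
      inner ℝ h (Complex.I * n) * inner ℝ (Complex.I * n) w := by
  have h1 := sq_add_sq_of_norm hn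
  simp only [inner_eq, Complex.mul_re, Complex.mul_im, Complex.I_re, Complex.I_im]
  linear_combination (-(h.re * w.re) - h.im * w.im) * h1

theorem eq_shift_of_inner_eq {z z' n : ℂ} (hn : ‖n‖ = 1) (h : inner ℝ n z = inner ℝ n z') :
    (z, n) = shift (coord (z, n) - coord (z', n)) (z', n) := by
  have h1 := sq_add_sq_of_norm hn
  simp only [inner_eq] at h
  simp only [shift, coord, Prod.mk.injEq, and_true]
  apply Complex.ext
  · simp
    linear_combination n.re * h + (z'.re - z.re) * h1
  · simp
    linear_combination n.im * h + (z'.im - z.im) * h1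

/-- Half-discs on both sides of a line fill a neighbourhood up to the line. -/
theorem exists_mem_halfDisc_or {p : ℂ × ℂ} (hp : ‖p.2‖ = 1) {U : Set ℂ} (hU : IsOpen U)
    {ε : ℝ} {w : ℂ} (hw : w ∈ U) (hwε : ‖w - p.1‖ < ε) :
    ∃ w' ∈ U, w' ∈ halfDisc p ε ∨ w' ∈ halfDisc (flipGerm p) ε := by
  obtain ⟨δ, hδ, hb⟩ := Metric.isOpen_iff.1 hU w hw
  rcases lt_trichotomy (inner ℝ p.2 (w - p.1)) 0 with h | h | h
  · refine ⟨w, hw, Or.inr ⟨hwε, ?_⟩⟩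
    simp only [flipGerm, inner_neg_left]; linarith
  · have hm : 0 < min δ (ε - ‖w - p.1‖) := lt_min hδ (by linarith)
    set r := min δ (ε - ‖w - p.1‖) / 2 with hr
    have hr0 : 0 < r := half_pos hm
    have hr1 : r < δ := (half_lt_self hm).trans_le (min_le_left _ _)
    have hr2 : r < ε - ‖w - p.1‖ := (half_lt_self hm).trans_le (min_le_right _ _)
    have hnr : ‖(r : ℂ) * p.2‖ = r := by simp [hp, abs_of_pos hr0]
    refine ⟨w + r * p.2, hb ?_, Or.inl ⟨?_, ?_⟩⟩
    · rw [Metric.mem_ball, dist_eq_norm, add_sub_cancel_left, hnr]; exact hr1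
    · have e : w + r * p.2 - p.1 = (w - p.1) + r * p.2 := by ring
      rw [e]
      have := norm_add_le (w - p.1) (r * p.2)
      rw [hnr] at this; linarith
    · have e : w + r * p.2 - p.1 = (w - p.1) + r * p.2 := by ring
      have e2 : inner ℝ p.2 ((r : ℂ) * p.2) = r := by
        have h1 := sq_add_sq_of_norm hp
        simp; linear_combination r * h1
      rw [e, inner_add_right, h, e2]; linarith
  · exact ⟨w, hw, Or.inl ⟨hwε, h⟩⟩

/-- Only a bounding line that passes through the base point transversally to the germ can cut
arbitrarily small half-discs, and `hh` excludes it. -/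
theorem exists_halfDisc_inner_sign {p : ℂ × ℂ} (hp : ‖p.2‖ = 1) (h : ℂ × ℝ)
    (hh : inner ℝ h.1 p.1 = h.2 → inner ℝ h.1 (Complex.I * p.2) = 0) :
    ∃ ε : ℝ, 0 < ε ∧ ((∀ w ∈ halfDisc p ε, inner ℝ h.1 w < h.2) ∨
      ∀ w ∈ halfDisc p ε, h.2 ≤ inner ℝ h.1 w) := by
  have hop : ∀ w : ℂ, inner ℝ h.1 w = inner ℝ h.1 p.1 + inner ℝ h.1 (w - p.1) := fun w => by
    rw [inner_sub_right]; ring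
  rcases lt_trichotomy (inner ℝ h.1 p.1) h.2 with hlt | heq | hgt
  · have hU : IsOpen {w : ℂ | inner ℝ h.1 w < h.2} :=
      isOpen_lt (Continuous.inner continuous_const continuous_id) continuous_const
    obtain ⟨ε, hε, hb⟩ := Metric.isOpen_iff.1 hU p.1 hlt
    exact ⟨ε, hε, Or.inl fun w hw => hb (by rw [Metric.mem_ball, dist_eq_norm]; exact hw.1)⟩
  · have hd : ∀ w : ℂ, inner ℝ h.1 w = h.2 + inner ℝ h.1 p.2 * inner ℝ p.2 (w - p.1) := fun w => by
      rw [hop, heq, inner_decomp hp, hh heq]; ring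
    refine ⟨1, one_pos, ?_⟩
    rcases lt_or_ge (inner ℝ h.1 p.2) 0 with hc | hc
    · left; intro w hw
      rw [hd]
      have := mul_neg_of_neg_of_pos hc hw.2
      linarith
    · right; intro w hw
      rw [hd]
      have := mul_nonneg hc hw.2.le
      linarith
  · have hU : IsOpen {w : ℂ | h.2 < inner ℝ h.1 w} :=
      isOpen_lt continuous_const (Continuous.inner continuous_const continuous_id)
    obtain ⟨ε, hε, hb⟩ := Metric.isOpen_iff.1 hU p.1 hgt
    refine ⟨ε, hε, Or.inr fun w hw => le_of_lt (hb ?_)⟩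
    rw [Metric.mem_ball, dist_eq_norm]; exact hw.1

/-- Some half-disc at the germ `p` lies outside of the closure of `Δ`. -/
def Outward (Δ : Set ℂ) (p : ℂ × ℂ) : Prop :=
  ∃ ε : ℝ, 0 < ε ∧ Disjoint (halfDisc p ε) (closure Δ)

theorem Outward.not_inward {Δ : Set ℂ} {p : ℂ × ℂ} (h : Outward Δ p) : ¬ Inward Δ p := by
  rintro ⟨h1, ε, hε, h2⟩
  obtain ⟨δ, hδ, h3⟩ := h
  obtain ⟨w, hw⟩ := halfDisc_nonempty h1 (lt_min hε hδ)
  exact disjoint_left.1 h3 (halfDisc_mono _ (min_le_right _ _) hw)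
    (subset_closure (h2 (halfDisc_mono _ (min_le_left _ _) hw)))

theorem Outward.eventually_shift {Δ : Set ℂ} {p : ℂ × ℂ} (hp : ‖p.2‖ = 1) (h : Outward Δ p) :
    ∀ᶠ t in nhds (0 : ℝ), Outward Δ (shift t p) := by
  obtain ⟨ε, hε, h⟩ := h
  filter_upwards [Metric.ball_mem_nhds 0 hε] with t ht
  rw [Metric.mem_ball, dist_zero_right, Real.norm_eq_abs] at ht
  exact ⟨ε - |t|, by linarith, h.mono_left (halfDisc_shift_subset hp t ε)⟩

theorem Inward.eventually_shift {A : Set ℂ} {p : ℂ × ℂ} (h : Inward A p) :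
    ∀ᶠ t in nhds (0 : ℝ), Inward A (shift t p) := by
  obtain ⟨hp, ε, hε, h⟩ := h
  filter_upwards [Metric.ball_mem_nhds 0 hε] with t ht
  rw [Metric.mem_ball, dist_zero_right, Real.norm_eq_abs] at ht
  exact inward_shift hp h ht

theorem Outward.fst_notMem {Δ : Set ℂ} (hΔ : IsOpen Δ) {p : ℂ × ℂ} (hp : ‖p.2‖ = 1)
    (h : Outward Δ p) : p.1 ∉ Δ := by
  intro hz
  obtain ⟨ε, hε, h⟩ := h
  obtain ⟨w, hw, hw'⟩ := mem_closure_iff.1 (mem_closure_halfDisc hp hε) _ hΔ hz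
  exact disjoint_left.1 h hw' (subset_closure hw)

/-! ### Neat germs, sides of components, and adjacency. -/

namespace NousData

variable {Δ : Set ℂ} {f : PiecewiseRotation Δ} {u v : ℂ → ℂ} (D : NousData f u v)
include D

/-- Two opposite half-discs fill a disc up to its diameter, so a disc lies in `closure Δ`. As `Δ`
has no slits, the centre is in `Δ`. -/
theorem mem_of_inward_of_inward_flip {p : ℂ × ℂ} (h : Inward Δ p) (h' : Inward Δ (flipGerm p)) :
    p.1 ∈ Δ := by
  obtain ⟨h1, ε, hε, h2⟩ := h
  obtain ⟨-, δ, hδ, h3⟩ := h'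
  rw [← D.interior_closure, mem_interior_iff_mem_nhds]
  refine Filter.mem_of_superset (Metric.ball_mem_nhds _ (lt_min hε hδ)) fun w hw => ?_
  rw [mem_closure_iff]
  intro U hU hwU
  rw [Metric.mem_ball, dist_eq_norm] at hw
  obtain ⟨w', hw', h4⟩ := exists_mem_halfDisc_or h1 hU hwU hw
  refine ⟨w', hw', ?_⟩
  rcases h4 with h4 | h4
  · exact h2 (halfDisc_mono _ (min_le_left _ _) h4)
  · exact h3 (halfDisc_mono _ (min_le_right _ _) h4)

/-- Germs that are parallel to all sides of components through their base point. -/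
def neatAux : Set (ℂ × ℂ) :=
  {p | ‖p.2‖ = 1 ∧ ∀ Q ∈ components f.dom, ∀ h ∈ D.planes Q, inner ℝ h.1 p.1 = h.2 →
    inner ℝ h.1 (Complex.I * p.2) = 0}

/-- Germs that are parallel, together with their images under `u`, to all sides of components
through their base points. -/
def neat : Set (ℂ × ℂ) := {p | p ∈ D.neatAux ∧ D.uHat p ∈ D.neatAux}

theorem flip_mem_neatAux {p : ℂ × ℂ} (hp : p ∈ D.neatAux) : flipGerm p ∈ D.neatAux := by
  refine ⟨by simpa [flipGerm] using hp.1, fun Q hQ h hh heq => ?_⟩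
  have := hp.2 Q hQ h hh heq
  simp only [flipGerm, mul_neg, inner_neg_right, this, neg_zero]

theorem uHat_mem_neat {p : ℂ × ℂ} (hp : p ∈ D.neat) : D.uHat p ∈ D.neat :=
  ⟨hp.2, by rw [D.uHat_uHat]; exact hp.1⟩

/-- Finitely many half-planes define all the components, so one radius is small enough for all of
them; a defining inequality that fails somewhere on this half-disc fails throughout. -/
theorem exists_halfDisc_dichotomy {p : ℂ × ℂ} (hp : p ∈ D.neatAux) :
    ∃ ε : ℝ, 0 < ε ∧ ∀ Q ∈ components f.dom, halfDisc p ε ⊆ Q ∨ Disjoint (halfDisc p ε) Q := by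
  have key : ∀ᶠ ε in nhdsWithin (0 : ℝ) (Ioi 0), ∀ Q ∈ components f.dom, ∀ h ∈ D.planes Q,
      (∀ w ∈ halfDisc p ε, inner ℝ h.1 w < h.2) ∨ ∀ w ∈ halfDisc p ε, h.2 ≤ inner ℝ h.1 w := by
    rw [Filter.eventually_all_finite D.finite]
    intro Q hQ
    rw [Filter.eventually_all_finset]
    intro h hh
    obtain ⟨ε, hε, h'⟩ := exists_halfDisc_inner_sign hp.1 h (hp.2 Q hQ h hh)
    filter_upwards [Ioo_mem_nhdsGT hε] with δ hδ
    exact h'.imp (fun h' w hw => h' w (halfDisc_mono _ hδ.2.le hw))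
      fun h' w hw => h' w (halfDisc_mono _ hδ.2.le hw)
  obtain ⟨ε, h, hε⟩ := (key.and self_mem_nhdsWithin).exists
  refine ⟨ε, hε, fun Q hQ => ?_⟩
  by_cases hall : ∀ g ∈ D.planes Q, ∀ w ∈ halfDisc p ε, inner ℝ g.1 w < g.2
  · left
    intro w hw
    rw [D.eq_planes Q hQ]
    exact fun g hg => hall g hg w hw
  · right
    push Not at hall
    obtain ⟨g, hg, w, hw, hgw⟩ := hall
    rw [disjoint_left]
    intro w' hw' hw'Q
    rw [D.eq_planes Q hQ] at hw'Q
    have h1 := hw'Q g hg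
    rcases h Q hQ g hg with h2 | h2
    · exact absurd (h2 w hw) (not_lt.2 hgw)
    · exact absurd (h2 w' hw') (not_le.2 h1)

omit D in
theorem closure_subset : closure Δ ⊆ closure f.dom :=
  closure_minimal f.dom_dense isClosed_closure

/-- A half-disc that meets no component avoids `dom f`, hence, being open, also its closure, which
contains `closure Δ`. -/
theorem mem_germs_or_outward {p : ℂ × ℂ} (hp : p ∈ D.neatAux) : p ∈ D.germs ∨ Outward Δ p := by
  obtain ⟨ε, hε, h⟩ := D.exists_halfDisc_dichotomy hp
  by_cases hQ : ∃ Q ∈ components f.dom, halfDisc p ε ⊆ Q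
  · obtain ⟨Q, hQ, hs⟩ := hQ
    exact Or.inl ⟨Q, hQ, hp.1, ε, hε, hs⟩
  · push Not at hQ
    refine Or.inr ⟨ε, hε, ?_⟩
    have : Disjoint (halfDisc p ε) (closure f.dom) := by
      refine Disjoint.closure_right ?_ (isOpen_halfDisc p ε)
      rw [disjoint_left]
      intro w hw hwd
      have hc := mem_components_of_mem hwd
      rcases h _ hc with h1 | h1
      · exact hQ _ hc h1
      · exact disjoint_left.1 h1 hw (mem_connectedComponentIn hwd)
    exact this.mono_right (closure_subset (f := f))

theorem mem_germs_of_inward {p : ℂ × ℂ} (hp : p ∈ D.neatAux) (h : Inward Δ p) : p ∈ D.germs :=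
  (D.mem_germs_or_outward hp).resolve_right fun h' => h'.not_inward h

theorem inward_of_fst_mem {p : ℂ × ℂ} (hp : ‖p.2‖ = 1) (h : p.1 ∈ Δ) : Inward Δ p := by
  obtain ⟨ε, hε, hb⟩ := Metric.isOpen_iff.1 D.isOpen _ h
  refine ⟨hp, ε, hε, fun w hw => hb ?_⟩
  rw [Metric.mem_ball, dist_eq_norm]; exact hw.1

theorem mem_germs_of_fst_mem {p : ℂ × ℂ} (hp : p ∈ D.neatAux) (h : p.1 ∈ Δ) : p ∈ D.germs :=
  D.mem_germs_of_inward hp (D.inward_of_fst_mem hp.1 h)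

/-- The germs of the sides of the components. -/
def sides : Set (ℂ × ℂ) := {p | p ∈ D.germs ∧ p.1 ∉ f.dom}

/-- The germs of the sides that lie on the boundary of `Δ`. -/
def outerSides : Set (ℂ × ℂ) := {p | p ∈ D.sides ∧ p.1 ∈ frontier Δ}

/-- The point of the graph defined by a germ. -/
noncomputable def toGraph (p : ℂ × ℂ) : ℂ × Set ℂ := (p.1, D.cell p)

theorem mem_or_mem_frontier {p : ℂ × ℂ} (hp : p ∈ D.germs) : p.1 ∈ Δ ∨ p.1 ∈ frontier Δ := by
  have := (D.inward_of_mem hp).mem_closure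
  rw [D.isOpen.frontier_eq]
  by_cases h : p.1 ∈ Δ
  · exact Or.inl h
  · exact Or.inr ⟨this, h⟩

theorem notMem_frontier {z : ℂ} (hz : z ∈ Δ) : z ∉ frontier Δ := by
  rw [D.isOpen.frontier_eq]; exact fun h => h.2 hz

theorem notMem_of_mem_frontier {z : ℂ} (hz : z ∈ frontier Δ) : z ∉ Δ :=
  fun h => D.notMem_frontier h hz

theorem fst_mem_frontier_cell {p : ℂ × ℂ} (hp : p ∈ D.sides) : p.1 ∈ frontier (D.cell p) := by
  rw [(D.isOpen_component (D.cell_mem hp.1)).frontier_eq]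
  exact ⟨(D.inward_cell hp.1).mem_closure,
    fun h => hp.2 (subset_of_mem_components (D.cell_mem hp.1) h)⟩

theorem toGraph_mem {p : ℂ × ℂ} (hp : p ∈ D.sides) : D.toGraph p ∈ f.graph :=
  ⟨D.cell_mem hp.1, D.fst_mem_frontier_cell hp⟩

theorem vHat_mem_sides {p : ℂ × ℂ} (hp : p ∈ D.sides) : D.vHat p ∈ D.sides :=
  ⟨D.vHat_mem hp.1, fun h => hp.2 ((D.vHat_fst_mem_dom_iff hp.1).1 h)⟩

theorem inward_of_mem_frontier {p : ℂ × ℂ} (hp : p ∈ D.neatAux) {Q : Set ℂ}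
    (hQ : Q ∈ components f.dom) (hz : p.1 ∈ closure Q) : Inward Q p ∨ Inward Q (flipGerm p) := by
  obtain ⟨ε, hε, h⟩ := D.exists_halfDisc_dichotomy hp
  obtain ⟨δ, hδ, h'⟩ := D.exists_halfDisc_dichotomy (D.flip_mem_neatAux hp)
  obtain ⟨w, hw, hwQ⟩ := mem_closure_iff.1 hz _ Metric.isOpen_ball
    (Metric.mem_ball_self (lt_min hε hδ))
  rw [Metric.mem_ball, dist_eq_norm] at hw
  obtain ⟨w', hw', h1⟩ := exists_mem_halfDisc_or hp.1 (D.isOpen_component hQ) hwQ hw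
  rcases h1 with h1 | h1
  · have h1 := halfDisc_mono _ (min_le_left _ _) h1
    exact Or.inl ⟨hp.1, ε, hε, (h Q hQ).resolve_right fun h2 => disjoint_left.1 h2 h1 hw'⟩
  · have h1 := halfDisc_mono _ (min_le_right _ _) h1
    exact Or.inr ⟨(D.flip_mem_neatAux hp).1, δ, hδ,
      (h' Q hQ).resolve_right fun h2 => disjoint_left.1 h2 h1 hw'⟩

theorem flip_mem_sides {p : ℂ × ℂ} (hp : p ∈ D.sides) (hn : p ∈ D.neatAux) (hz : p.1 ∈ Δ) :
    flipGerm p ∈ D.sides :=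
  ⟨D.mem_germs_of_fst_mem (D.flip_mem_neatAux hn) hz, hp.2⟩

/-- If one convex component lay on both sides, it would contain the base point, as the midpoint of
two points placed symmetrically along the normal. -/
theorem cell_flip_ne {p : ℂ × ℂ} (hp : p ∈ D.sides) (hp' : flipGerm p ∈ D.sides) :
    D.cell (flipGerm p) ≠ D.cell p := by
  intro h
  obtain ⟨h1, ε, hε, h2⟩ := D.inward_cell hp.1
  obtain ⟨h1', δ, hδ, h3⟩ := D.inward_cell hp'.1
  rw [h] at h3
  have hm : 0 < min ε δ := lt_min hε hδ
  have e1 := h2 (mem_halfDisc_add h1 (half_pos hm)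
    ((half_lt_self hm).trans_le (min_le_left _ _)))
  have e2 := h3 (mem_halfDisc_add h1' (half_pos hm)
    ((half_lt_self hm).trans_le (min_le_right _ _)))
  have e3 := D.convex_component (D.cell_mem hp.1) e1 e2 (a := 1 / 2) (b := 1 / 2) (by norm_num)
    (by norm_num) (by norm_num)
  refine hp.2 (subset_of_mem_components (D.cell_mem hp.1) ?_)
  convert e3 using 1
  simp [flipGerm]; ring

/-- Near a neat base point a component whose closure contains the point must fill one of the two
half-discs. So `w*` is defined there and amounts to `flipGerm`. -/
theorem adjacent_of_mem {p : ℂ × ℂ} (hp : p ∈ D.sides) (hn : p ∈ D.neatAux) (hz : p.1 ∈ Δ) :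
    f.adjacent p.1 = {D.cell p, D.cell (flipGerm p)} := by
  have hp' := D.flip_mem_sides hp hn hz
  ext Q
  simp only [mem_insert_iff, mem_singleton_iff]
  constructor
  · rintro ⟨hQ, hzQ⟩
    rcases D.inward_of_mem_frontier hn hQ (frontier_subset_closure hzQ) with h | h
    · exact Or.inl (D.cell_eq hQ h).2.symm
    · exact Or.inr (D.cell_eq hQ h).2.symm
  · rintro (rfl | rfl)
    · exact D.toGraph_mem hp
    · exact D.toGraph_mem hp'

theorem flip_outward {p : ℂ × ℂ} (hp : p ∈ D.outerSides) (hn : p ∈ D.neatAux) :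
    Outward Δ (flipGerm p) :=
  (D.mem_germs_or_outward (D.flip_mem_neatAux hn)).resolve_left fun h =>
    D.notMem_of_mem_frontier hp.2
      (D.mem_of_inward_of_inward_flip (D.inward_of_mem hp.1.1) (D.inward_of_mem h))

theorem adjacent_of_mem_frontier {p : ℂ × ℂ} (hp : p ∈ D.outerSides) (hn : p ∈ D.neatAux) :
    f.adjacent p.1 = {D.cell p} := by
  ext Q
  simp only [mem_singleton_iff]
  constructor
  · rintro ⟨hQ, hzQ⟩
    rcases D.inward_of_mem_frontier hn hQ (frontier_subset_closure hzQ) with h | h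
    · exact (D.cell_eq hQ h).2.symm
    · exact absurd (h.mono (component_subset hQ)) (D.flip_outward hp hn).not_inward
  · rintro rfl
    exact D.toGraph_mem hp.1

theorem outerSides_of_outward {p : ℂ × ℂ} (hp : p ∈ D.germs) (h : Outward Δ (flipGerm p)) :
    p ∈ D.outerSides := by
  have h1 : p.1 ∉ Δ := Outward.fst_notMem (p := flipGerm p) D.isOpen
    (by simpa [flipGerm] using D.norm_of_mem hp) h
  exact ⟨⟨hp, fun h2 => h1 (f.dom_subset h2)⟩, (D.mem_or_mem_frontier hp).resolve_left h1⟩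

theorem eventually_cell_shift {p : ℂ × ℂ} (hp : p ∈ D.germs) :
    ∀ᶠ t in nhds (0 : ℝ), shift t p ∈ D.germs ∧ D.cell (shift t p) = D.cell p := by
  filter_upwards [(D.inward_cell hp).eventually_shift] with t ht
  exact D.cell_eq (D.cell_mem hp) ht

theorem eventually_vHat_shift {p : ℂ × ℂ} (hp : p ∈ D.germs) :
    ∀ᶠ t in nhds (0 : ℝ), D.vHat (shift t p) = shift (-t) (D.vHat p) := by
  filter_upwards [D.eventually_cell_shift hp] with t ht
  rw [D.vHat_of_mem ht.1, ht.2, D.vHat_of_mem hp, rev_shift]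

theorem uHat_shift (t : ℝ) (p : ℂ × ℂ) : D.uHat (shift t p) = shift (-t) (D.uHat p) :=
  rev_shift _ _ _ _

/-- If `shift t p` were inside the component, then `p.1` would be the midpoint of a point slightly
outward of `shift t p` and a point slightly inward of `shift (-t) p`, both in the convex component.
-/
theorem eventually_shift_mem_sides {p : ℂ × ℂ} (hp : p ∈ D.sides) :
    ∀ᶠ t in nhds (0 : ℝ), shift t p ∈ D.sides := by
  have h1 := D.eventually_cell_shift hp.1
  have h2 : ∀ᶠ t in nhds (0 : ℝ), shift (-t) p ∈ D.germs ∧ D.cell (shift (-t) p) = D.cell p := by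
    have : Filter.Tendsto (fun t : ℝ => -t) (nhds 0) (nhds 0) := by
      simpa using (continuous_neg (G := ℝ)).tendsto 0
    exact this.eventually h1
  have hQ := D.cell_mem hp.1
  filter_upwards [h1, h2] with t ⟨ht, ht'⟩ ⟨hs, hs'⟩
  refine ⟨ht, fun hd => hp.2 (subset_of_mem_components hQ ?_)⟩
  have h3 := D.mem_cell_of_mem_dom ht hd
  rw [ht'] at h3
  obtain ⟨δ, hδ, hb⟩ := Metric.isOpen_iff.1 (D.isOpen_component hQ) _ h3
  obtain ⟨hn, ε, hε, hs2⟩ := D.inward_cell hs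
  rw [hs'] at hs2
  have hm : 0 < min ε δ := lt_min hε hδ
  have e1 := hs2 (mem_halfDisc_add hn (half_pos hm)
    ((half_lt_self hm).trans_le (min_le_left _ _)))
  have hn' : ‖p.2‖ = 1 := hn
  have e2 : (shift t p).1 - (min ε δ / 2 : ℝ) * p.2 ∈ D.cell p := hb (by
    rw [Metric.mem_ball, dist_eq_norm, sub_sub_cancel_left, norm_neg, norm_mul, hn', mul_one,
      Complex.norm_real, Real.norm_eq_abs, abs_of_pos (half_pos hm)]
    exact (half_lt_self hm).trans_le (min_le_right _ _))
  have e3 := D.convex_component hQ e1 e2 (a := 1 / 2) (b := 1 / 2) (by norm_num)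
    (by norm_num) (by norm_num)
  convert e3 using 1
  simp [shift]; ring

theorem eventually_shift_mem_outerSides {p : ℂ × ℂ} (hp : p ∈ D.outerSides)
    (hn : p ∈ D.neatAux) : ∀ᶠ t in nhds (0 : ℝ), shift t p ∈ D.outerSides := by
  have h1 := (D.flip_outward hp hn).eventually_shift (by simpa [flipGerm] using hn.1)
  have h2 : ∀ᶠ t in nhds (0 : ℝ), Outward Δ (shift (-t) (flipGerm p)) := by
    have : Filter.Tendsto (fun t : ℝ => -t) (nhds 0) (nhds 0) := by
      simpa using (continuous_neg (G := ℝ)).tendsto 0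
    exact this.eventually h1
  filter_upwards [h2, D.eventually_cell_shift hp.1.1] with t ht ht'
  rw [← flip_shift] at ht
  exact D.outerSides_of_outward ht'.1 ht

theorem eventually_shift_notMem_outerSides {p : ℂ × ℂ} (hp : p ∉ D.outerSides)
    (hn : p ∈ D.neatAux) : ∀ᶠ t in nhds (0 : ℝ), shift t p ∉ D.outerSides := by
  rcases D.mem_germs_or_outward hn with h | h
  · rcases D.mem_germs_or_outward (D.flip_mem_neatAux hn) with h' | h'
    · have h1 := (D.inward_of_mem h').eventually_shift
      have h2 : ∀ᶠ t in nhds (0 : ℝ), Inward Δ (shift (-t) (flipGerm p)) := by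
        have : Filter.Tendsto (fun t : ℝ => -t) (nhds 0) (nhds 0) := by
          simpa using (continuous_neg (G := ℝ)).tendsto 0
        exact this.eventually h1
      filter_upwards [h2, (D.inward_of_mem h).eventually_shift] with t ht ht' hs
      rw [← flip_shift] at ht
      exact D.notMem_of_mem_frontier hs.2 (D.mem_of_inward_of_inward_flip ht' ht)
    · exact absurd (D.outerSides_of_outward h h') hp
  · filter_upwards [h.eventually_shift hn.1] with t ht hs
    exact ht.not_inward (D.inward_of_mem hs.1.1)

end NousData

/-! ### The finitely many lines that carry the sides; finiteness of the bad germs. -/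

/-- The functional `inner h.1` is at most `h.2` on `closure A`, which contains a segment of the
germ's line around `p.1`. It attains the bound at `p.1`, so it is constant along the line, and the
normal can only be the inner normal of the half-plane. -/
theorem Inward.normal_eq {A : Set ℂ} {p : ℂ × ℂ} (hp : Inward A p) {h : ℂ × ℝ}
    (hA : ∀ w ∈ A, inner ℝ h.1 w < h.2) (hz : h.2 ≤ inner ℝ h.1 p.1) :
    inner ℝ h.1 p.1 = h.2 ∧ p.2 = -((‖h.1‖⁻¹ : ℝ) : ℂ) * h.1 := by
  have hcl : ∀ q, Inward A q → inner ℝ h.1 q.1 ≤ h.2 := by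
    intro q hq
    have hc : IsClosed {w : ℂ | inner ℝ h.1 w ≤ h.2} :=
      isClosed_le (Continuous.inner continuous_const continuous_id) continuous_const
    exact closure_minimal (fun w hw => (hA w hw).le) hc hq.mem_closure
  have heq := le_antisymm (hcl p hp) hz
  obtain ⟨hn, ε, hε, hs⟩ := hp
  have hd : inner ℝ h.1 (Complex.I * p.2) = 0 := by
    have e1 := hcl _ (inward_shift hn hs (t := ε / 2) (by rw [abs_of_pos] <;> linarith))
    have e2 := hcl _ (inward_shift hn hs (t := -(ε / 2)) (by rw [abs_neg, abs_of_pos] <;> linarith))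
    have e3 : ∀ t : ℝ, inner ℝ h.1 (shift t p).1 =
        inner ℝ h.1 p.1 - t * inner ℝ h.1 (Complex.I * p.2) := fun t => by
      simp [shift]; ring
    rw [e3, heq] at e1 e2
    have e1' : 0 ≤ ε / 2 * inner ℝ h.1 (Complex.I * p.2) := by linarith
    have e2' : ε / 2 * inner ℝ h.1 (Complex.I * p.2) ≤ 0 := by linarith
    have := le_antisymm e2' e1'
    rcases mul_eq_zero.1 this with h' | h'
    · linarith
    · exact h'
  refine ⟨heq, ?_⟩
  set c := inner ℝ h.1 p.2 with hc
  have hc0 : c < 0 := by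
    obtain ⟨w, hw⟩ := halfDisc_nonempty hn hε
    have h1 := hA w (hs hw)
    have h2 : inner ℝ h.1 w = inner ℝ h.1 p.1 + inner ℝ h.1 (w - p.1) := by
      rw [inner_sub_right]; ring
    rw [h2, heq, inner_decomp hn h.1 (w - p.1), hd] at h1
    have h3 : c * inner ℝ p.2 (w - p.1) < 0 := by linarith
    by_contra hcon
    exact absurd (mul_nonneg (not_lt.1 hcon) hw.2.le) (not_le.2 h3)
  have hsq := sq_add_sq_of_norm hn
  have h1 : h.1 = (c : ℂ) * p.2 := by
    rw [hc]
    simp only [inner_eq, Complex.mul_re, Complex.mul_im, Complex.I_re, Complex.I_im] at hd ⊢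
    apply Complex.ext
    · simp
      linear_combination -h.1.re * hsq - p.2.im * hd
    · simp
      linear_combination -h.1.im * hsq + p.2.re * hd
  have h2 : ‖h.1‖ = -c := by
    rw [h1]; simp [hn, abs_of_neg hc0]
  rw [h2]
  have hcC : (c : ℂ) ≠ 0 := by exact_mod_cast hc0.ne
  rw [h1]
  push_cast
  field_simp

/-- The germ with base point on the boundary of the half-plane `h`, inside of it. -/
noncomputable def leafRep (h : ℂ × ℝ) : ℂ × ℂ :=
  (((h.2 / ‖h.1‖ ^ 2 : ℝ) : ℂ) * h.1, -((‖h.1‖⁻¹ : ℝ) : ℂ) * h.1)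

theorem norm_leafRep {h : ℂ × ℝ} (hh : h.1 ≠ 0) : ‖(leafRep h).2‖ = 1 := by
  have : ‖h.1‖ ≠ 0 := norm_ne_zero_iff.2 hh
  simp [leafRep, this]

theorem eq_shift_leafRep {h : ℂ × ℝ} (hh : h.1 ≠ 0) {z : ℂ} (hz : inner ℝ h.1 z = h.2) :
    (z, (leafRep h).2) =
      shift (coord (z, (leafRep h).2) - coord (leafRep h)) (leafRep h) := by
  refine eq_shift_of_inner_eq (norm_leafRep hh) ?_
  have h0 : ‖h.1‖ ≠ 0 := norm_ne_zero_iff.2 hh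
  have h1 : ‖h.1‖ ^ 2 = h.1.re * h.1.re + h.1.im * h.1.im := by
    rw [Complex.sq_norm, Complex.normSq_apply]
  have e : ∀ w, inner ℝ (leafRep h).2 w = -(‖h.1‖⁻¹) * inner ℝ h.1 w := by
    intro w
    simp [leafRep]; ring
  have e2 : inner ℝ h.1 (leafRep h).1 = h.2 / ‖h.1‖ ^ 2 * ‖h.1‖ ^ 2 := by
    generalize hr : h.2 / ‖h.1‖ ^ 2 = r
    rw [h1]
    simp only [leafRep, hr, inner_eq, Complex.re_ofReal_mul, Complex.im_ofReal_mul]; ring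
  change inner ℝ (leafRep h).2 z = inner ℝ (leafRep h).2 (leafRep h).1
  rw [e, e, hz, e2, div_mul_cancel₀ _ (pow_ne_zero 2 h0)]

theorem isFirstReturn_unique {X : Type*} {T : X → X → Prop}
    (hT : ∀ x y z, T x y → T x z → y = z) {A : Set X} {x y z : X}
    (h1 : IsFirstReturn T A x y) (h2 : IsFirstReturn T A x z) : y = z := by
  obtain ⟨-, hy, n, hn, s, s0, sn, sT, sA⟩ := h1
  obtain ⟨-, hz, m, hm, r, r0, rm, rT, rA⟩ := h2
  have key : ∀ k, k ≤ n → k ≤ m → s k = r k := by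
    intro k
    induction k with
    | zero => intro _ _; rw [s0, r0]
    | succ k ih =>
      intro h h'
      have h1 := sT k h
      have h2 := rT k h'
      rw [ih (by omega) (by omega)] at h1
      exact hT _ _ _ h1 h2
  rcases lt_trichotomy n m with h | h | h
  · exact absurd (by rw [← key n le_rfl h.le, sn]; exact hy) (rA n hn h)
  · subst h
    rw [← sn, ← rm, key n le_rfl le_rfl]
  · exact absurd (by rw [key m h.le le_rfl, rm]; exact hz) (sA m hm h)

namespace NousData

variable {Δ : Set ℂ} {f : PiecewiseRotation Δ} {u v : ℂ → ℂ} (D : NousData f u v)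
include D

/-- Germs that represent the sides of the components. -/
def reps : Set (ℂ × ℂ) := ⋃ Q ∈ components f.dom, ⋃ h ∈ D.planes Q, {leafRep h}

theorem finite_reps : D.reps.Finite :=
  D.finite.biUnion fun _ _ => (Finset.finite_toSet _).biUnion fun _ _ => finite_singleton _

theorem mem_reps {Q : Set ℂ} (hQ : Q ∈ components f.dom) {h : ℂ × ℝ} (hh : h ∈ D.planes Q) :
    leafRep h ∈ D.reps := by
  simp only [reps, mem_iUnion]
  exact ⟨Q, hQ, h, hh, rfl⟩

theorem exists_plane {p : ℂ × ℂ} (hp : p ∈ D.sides) :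
    ∃ h ∈ D.planes (D.cell p), h.2 ≤ inner ℝ h.1 p.1 := by
  by_contra hcon
  push Not at hcon
  refine hp.2 (subset_of_mem_components (D.cell_mem hp.1) ?_)
  rw [D.eq_planes _ (D.cell_mem hp.1)]
  exact hcon

theorem lt_of_mem_plane {Q : Set ℂ} (hQ : Q ∈ components f.dom) {h : ℂ × ℝ}
    (hh : h ∈ D.planes Q) : ∀ w ∈ Q, inner ℝ h.1 w < h.2 := by
  intro w hw
  rw [D.eq_planes Q hQ] at hw
  exact hw h hh

theorem sides_subset_leaves : D.sides ⊆ leaves D.reps := by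
  intro p hp
  obtain ⟨h, hh, hle⟩ := D.exists_plane hp
  have hQ := D.cell_mem hp.1
  obtain ⟨h1, h2⟩ := (D.inward_cell hp.1).normal_eq (D.lt_of_mem_plane hQ hh) hle
  have h0 := D.planes_ne _ hQ h hh
  have := eq_shift_leafRep h0 h1
  have hp2 : p = (p.1, (leafRep h).2) := by rw [leafRep, ← h2]
  exact ⟨leafRep h, D.mem_reps hQ hh, norm_leafRep h0, _, by rw [hp2]; exact this⟩

/-- A defining inequality of the component that is violated at the base point dictates the normal,
so nothing is lost in passing from a side germ to a point of `Γ_f`. -/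
theorem toGraph_injOn : InjOn D.toGraph D.sides := by
  intro p hp q hq heq
  simp only [toGraph, Prod.mk.injEq] at heq
  obtain ⟨h, hh, hle⟩ := D.exists_plane hp
  obtain ⟨-, h2⟩ := (D.inward_cell hp.1).normal_eq (D.lt_of_mem_plane (D.cell_mem hp.1) hh) hle
  rw [heq.2] at hh
  rw [heq.1] at hle
  obtain ⟨-, h3⟩ := (D.inward_cell hq.1).normal_eq (D.lt_of_mem_plane (D.cell_mem hq.1) hh) hle
  exact Prod.ext heq.1 (h2.trans h3.symm)

/-- A directed line meets each bounding line transversal to it at most once. -/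
theorem finite_leaf_diff {k : ℂ × ℂ} (hk : ‖k.2‖ = 1) :
    {t : ℝ | shift t k ∉ D.neatAux}.Finite := by
  have : {t : ℝ | shift t k ∉ D.neatAux} ⊆ ⋃ Q ∈ components f.dom, ⋃ h ∈ D.planes Q,
      {t : ℝ | inner ℝ h.1 (shift t k).1 = h.2 ∧ inner ℝ h.1 (Complex.I * k.2) ≠ 0} := by
    intro t ht
    simp only [neatAux, mem_ofPred_eq, not_and, not_forall] at ht
    obtain ⟨Q, hQ, h, hh, h1, h2⟩ := ht hk
    simp only [mem_iUnion]
    exact ⟨Q, hQ, h, hh, h1, h2⟩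
  refine Finite.subset (D.finite.biUnion fun Q _ => (Finset.finite_toSet _).biUnion fun h _ => ?_)
    this
  refine Set.Subsingleton.finite ?_
  rintro s ⟨h1, h2⟩ t ⟨h3, -⟩
  have e3 : ∀ t : ℝ, inner ℝ h.1 (shift t k).1 =
      inner ℝ h.1 k.1 - t * inner ℝ h.1 (Complex.I * k.2) := fun t => by
    simp [shift]; ring
  rw [e3] at h1 h3
  exact mul_right_cancel₀ h2 (by linarith)

theorem leaves_diff_eq (K : Set (ℂ × ℂ)) : leaves K \ D.neatAux ⊆
    ⋃ k ∈ K, (fun t => shift t k) '' {t : ℝ | ‖k.2‖ = 1 ∧ shift t k ∉ D.neatAux} := by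
  rintro p ⟨⟨k, hk, hn, t, rfl⟩, hp⟩
  simp only [mem_iUnion]
  exact ⟨k, hk, t, ⟨hn, hp⟩, rfl⟩

theorem finite_leaf_diff' (k : ℂ × ℂ) :
    {t : ℝ | ‖k.2‖ = 1 ∧ shift t k ∉ D.neatAux}.Finite := by
  by_cases hk : ‖k.2‖ = 1
  · exact (D.finite_leaf_diff hk).subset fun t ht => ht.2
  · simp [hk]

theorem finite_leaves_diff_neatAux {K : Set (ℂ × ℂ)} (hK : K.Finite) :
    (leaves K \ D.neatAux).Finite :=
  (hK.biUnion fun k _ => (D.finite_leaf_diff' k).image _).subset (D.leaves_diff_eq K)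

theorem uHat_mem_leaves {K : Set (ℂ × ℂ)} {p : ℂ × ℂ} (hp : p ∈ leaves K) :
    D.uHat p ∈ leaves (D.uHat '' K) := rev_mem_leaves D.norm_ua _ hp

theorem leaves_diff_neat_subset (K : Set (ℂ × ℂ)) : leaves K \ D.neat ⊆
    (leaves K \ D.neatAux) ∪ D.uHat '' (leaves (D.uHat '' K) \ D.neatAux) := by
  rintro p ⟨hp, hn⟩
  by_cases h : p ∈ D.neatAux
  · right
    exact ⟨D.uHat p, ⟨D.uHat_mem_leaves hp, fun h' => hn ⟨h, h'⟩⟩, D.uHat_uHat p⟩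
  · exact Or.inl ⟨hp, h⟩

theorem finite_leaves_diff_neat {K : Set (ℂ × ℂ)} (hK : K.Finite) :
    (leaves K \ D.neat).Finite :=
  ((D.finite_leaves_diff_neatAux hK).union
    ((D.finite_leaves_diff_neatAux (hK.image _)).image _)).subset (D.leaves_diff_neat_subset K)

theorem countable_leaves_diff_neat {K : Set (ℂ × ℂ)} (hK : K.Countable) :
    (leaves K \ D.neat).Countable := by
  have : leaves K \ D.neat ⊆ ⋃ k ∈ K, leaves {k} \ D.neat := by
    rintro p ⟨⟨k, hk, h⟩, hp⟩
    simp only [mem_iUnion]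
    exact ⟨k, hk, ⟨k, rfl, h⟩, hp⟩
  exact (hK.biUnion fun k _ => (D.finite_leaves_diff_neat (finite_singleton k)).countable).mono this

theorem finite_sides_diff_neat : (D.sides \ D.neat).Finite :=
  (D.finite_leaves_diff_neat D.finite_reps).subset fun _ h => ⟨D.sides_subset_leaves h.1, h.2⟩

/-- A boundary point of `Q` lies on one of the finitely many bounding lines. Unless the germ of that
line at the point is not neat, which happens finitely often, `Q` fills a half-disc there and the
germ represents the pair. -/
theorem finite_graph_diff : (f.graph \ D.toGraph '' D.sides).Finite := by
  have hfin := D.finite_leaves_diff_neatAux D.finite_reps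
  refine ((hfin.image Prod.fst).prod D.finite).subset ?_
  rintro ⟨z, Q⟩ ⟨⟨hQ, hz⟩, hn⟩
  refine ⟨?_, hQ⟩
  simp only at hQ hz
  rw [(D.isOpen_component hQ).frontier_eq] at hz
  have hz2 : ∃ h ∈ D.planes Q, h.2 ≤ inner ℝ h.1 z := by
    by_contra hcon
    push Not at hcon
    apply hz.2
    rw [D.eq_planes Q hQ]
    exact hcon
  obtain ⟨h, hh, hle⟩ := hz2
  have h0 := D.planes_ne Q hQ h hh
  have heq : inner ℝ h.1 z = h.2 := by
    refine le_antisymm ?_ hle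
    have hc : IsClosed {w : ℂ | inner ℝ h.1 w ≤ h.2} :=
      isClosed_le (Continuous.inner continuous_const continuous_id) continuous_const
    exact closure_minimal (fun w hw => (D.lt_of_mem_plane hQ hh w hw).le) hc hz.1
  set p : ℂ × ℂ := (z, (leafRep h).2) with hp
  refine ⟨p, ⟨⟨leafRep h, D.mem_reps hQ hh, norm_leafRep h0, _, eq_shift_leafRep h0 heq⟩, ?_⟩, rfl⟩
  intro hneat
  have hi : Inward Q p := by
    rcases D.inward_of_mem_frontier hneat hQ hz.1 with h1 | h1
    · exact h1
    -- On the wrong side, the half-plane would force a unit normal to equal its own negative.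
    · exfalso
      obtain ⟨-, h3⟩ := h1.normal_eq (D.lt_of_mem_plane hQ hh) hle
      have h4 : (flipGerm p).2 = (leafRep h).2 := h3
      have h5 : -(leafRep h).2 = (leafRep h).2 := h4
      have h6 : (leafRep h).2 = 0 := self_eq_neg.1 h5.symm
      have := norm_leafRep h0
      rw [h6] at this
      simp at this
  obtain ⟨h1, h2⟩ := D.cell_eq hQ hi
  refine hn ⟨p, ⟨h1, fun hd => ?_⟩, by rw [toGraph, h2]⟩
  have := D.mem_cell_of_mem_dom h1 hd
  rw [h2] at this
  exact hz.2 this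

/-! ### The maps `v*`, `w*` and the `wv`-return map in terms of germs. -/

theorem extendFrom_v {Q : Set ℂ} (hQ : Q ∈ components f.dom) {z : ℂ} (hz : z ∈ closure Q) :
    extendFrom Q v z = D.va Q * conj z + D.vb Q := by
  refine extendFrom_eq hz ?_
  have hc : Continuous fun z => D.va Q * conj z + D.vb Q := by fun_prop
  refine (hc.tendsto z).mono_left nhdsWithin_le_nhds |>.congr' ?_
  filter_upwards [self_mem_nhdsWithin] with w hw
  exact (D.v_eq Q hQ w hw).symm

theorem extendFrom_u {z : ℂ} (hz : z ∈ closure Δ) :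
    extendFrom Δ u z = D.ua * conj z + D.ub := by
  refine extendFrom_eq hz ?_
  have hc : Continuous fun z => D.ua * conj z + D.ub := by fun_prop
  refine (hc.tendsto z).mono_left nhdsWithin_le_nhds |>.congr' ?_
  filter_upwards [self_mem_nhdsWithin] with w hw
  exact (D.u_eq w hw).symm

theorem vStar_toGraph {p : ℂ × ℂ} (hp : p ∈ D.germs) :
    PiecewiseRotation.vStar v (D.toGraph p) = D.toGraph (D.vHat p) := by
  refine Prod.ext ?_ (D.cell_vHat hp).symm
  simp only [PiecewiseRotation.vStar, toGraph,
    D.extendFrom_v (D.cell_mem hp) (D.inward_cell hp).mem_closure, D.vHat_of_mem hp, rev]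

/-- The double jump condition enters the proof here; it bounds the return time by two. -/
theorem vHat_mem_outerSides {p : ℂ × ℂ} (hp : p ∈ D.sides) (hz : p.1 ∈ Δ) :
    D.vHat p ∈ D.outerSides := by
  refine ⟨D.vHat_mem_sides hp, ?_⟩
  have := D.jump p.1 ⟨hz, hp.2⟩ _ (D.cell_mem hp.1) (D.fst_mem_frontier_cell hp)
  rw [D.extendFrom_v (D.cell_mem hp.1) (D.inward_cell hp.1).mem_closure] at this
  rwa [D.vHat_of_mem hp.1]

theorem uHat_fst_mem {p : ℂ × ℂ} : (D.uHat p).1 ∈ Δ ↔ p.1 ∈ Δ := by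
  refine ⟨fun h => ?_, fun h => D.u_mem h⟩
  have h2 : (D.uHat (D.uHat p)).1 ∈ Δ := D.u_mem h
  rwa [D.uHat_uHat] at h2

theorem uHat_mem_outerSides {p : ℂ × ℂ} (hp : p ∈ D.outerSides) (hn : p ∈ D.neat) :
    D.uHat p ∈ D.outerSides := by
  have h1 := D.mem_germs_of_inward hn.2 (D.inward_uHat (D.inward_of_mem hp.1.1))
  have h2 : (D.uHat p).1 ∉ Δ := fun h => D.notMem_of_mem_frontier hp.2 (D.uHat_fst_mem.1 h)
  exact ⟨⟨h1, fun h => h2 (f.dom_subset h)⟩, (D.mem_or_mem_frontier h1).resolve_left h2⟩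

theorem wStar_flip {p : ℂ × ℂ} (hp : p ∈ D.sides) (hn : p ∈ D.neat) (hz : p.1 ∈ Δ) :
    f.WStar u (D.toGraph p) (D.toGraph (flipGerm p)) :=
  ⟨D.toGraph_mem hp, Or.inl ⟨hz, rfl, D.cell_flip_ne hp (D.flip_mem_sides hp hn.1 hz),
    D.adjacent_of_mem hp hn.1 hz⟩⟩

theorem wStar_uHat {p : ℂ × ℂ} (hp : p ∈ D.outerSides) (hn : p ∈ D.neat) :
    f.WStar u (D.toGraph p) (D.toGraph (D.uHat p)) := by
  refine ⟨D.toGraph_mem hp.1, Or.inr ⟨hp.2, ?_, ?_⟩⟩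
  · exact (D.extendFrom_u (D.inward_of_mem hp.1.1).mem_closure).symm
  · exact D.adjacent_of_mem_frontier (D.uHat_mem_outerSides hp hn) (D.uHat_mem_neat hn).1

theorem wStar_unique (x y z : ℂ × Set ℂ) (h1 : f.WStar u x y) (h2 : f.WStar u x z) : y = z := by
  obtain ⟨-, h1⟩ := h1
  obtain ⟨-, h2⟩ := h2
  rcases h1 with ⟨a1, a2, a3, a4⟩ | ⟨a1, a2, a3⟩ <;> rcases h2 with ⟨b1, b2, b3, b4⟩ | ⟨b1, b2, b3⟩
  · refine Prod.ext (a2.trans b2.symm) ?_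
    rw [a4] at b4
    have : y.2 ∈ ({x.2, z.2} : Set (Set ℂ)) := by rw [← b4]; simp
    rcases this with h | h
    · exact absurd h a3
    · exact h
  · exact absurd b1 (D.notMem_frontier a1)
  · exact absurd a1 (D.notMem_frontier b1)
  · have h : y.1 = z.1 := a2.trans b2.symm
    refine Prod.ext h ?_
    rw [h, b3] at a3
    exact (singleton_eq_singleton_iff.1 a3).symm

theorem wvReturn_unique (x y z : ℂ × Set ℂ) (h1 : f.WVReturn u v x y)
    (h2 : f.WVReturn u v x z) : y = z :=
  isFirstReturn_unique (fun _ _ _ a b => D.wStar_unique _ _ _ a.2 b.2) h1 h2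

theorem wv_toGraph_flip {p : ℂ × ℂ} (hp : p ∈ D.sides) (hn : D.vHat p ∈ D.neat)
    (hz : (D.vHat p).1 ∈ Δ) :
    f.WV u v (D.toGraph p) (D.toGraph (flipGerm (D.vHat p))) := by
  refine ⟨D.toGraph_mem hp, ?_⟩
  rw [D.vStar_toGraph hp.1]
  exact D.wStar_flip (D.vHat_mem_sides hp) hn hz

theorem wv_toGraph_uHat {p : ℂ × ℂ} (hp : p ∈ D.sides) (hn : D.vHat p ∈ D.neat)
    (hz : D.vHat p ∈ D.outerSides) :
    f.WV u v (D.toGraph p) (D.toGraph (D.uHat (D.vHat p))) := by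
  refine ⟨D.toGraph_mem hp, ?_⟩
  rw [D.vStar_toGraph hp.1]
  exact D.wStar_uHat hz hn

open Classical in
/-- The `wv`-return map on germs. -/
noncomputable def rHat (p : ℂ × ℂ) : ℂ × ℂ :=
  if (D.vHat p).1 ∈ Δ then D.uHat (D.vHat (flipGerm (D.vHat p))) else D.uHat (D.vHat p)

/-- The germs of outer sides at which the `wv`-return map is locally given by `rHat`. -/
def regular : Set (ℂ × ℂ) := {p | p ∈ D.outerSides ∧ D.vHat p ∈ D.neat ∧
  ((D.vHat p).1 ∈ Δ → D.vHat (flipGerm (D.vHat p)) ∈ D.neat)}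

theorem toGraph_mem_boundaryStar {p : ℂ × ℂ} (hp : p ∈ D.outerSides) :
    D.toGraph p ∈ f.boundaryStar := ⟨D.toGraph_mem hp.1, hp.2⟩

theorem vHat_mem_outerSides_of_notMem {p : ℂ × ℂ} (hp : p ∈ D.sides) (h : (D.vHat p).1 ∉ Δ) :
    D.vHat p ∈ D.outerSides :=
  ⟨D.vHat_mem_sides hp, (D.mem_or_mem_frontier (D.vHat_mem hp.1)).resolve_left h⟩

theorem rHat_mem {p : ℂ × ℂ} (hp : p ∈ D.regular) : D.rHat p ∈ D.outerSides := by
  obtain ⟨h1, h2, h3⟩ := hp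
  rw [rHat]
  split_ifs with h
  · exact D.uHat_mem_outerSides (D.vHat_mem_outerSides
      (D.flip_mem_sides (D.vHat_mem_sides h1.1) h2.1 h) h) (h3 h)
  · exact D.uHat_mem_outerSides (D.vHat_mem_outerSides_of_notMem h1.1 h) h2

/-- If `v` leads to `∂Δ`, then `u` finishes in one step. Otherwise `w*` crosses to the neighbouring
component at a point of `Δ`, hence off `∂*Δ`, and by double jump the next `v` leads to `∂Δ`. -/
theorem wvReturn_rHat {p : ℂ × ℂ} (hp : p ∈ D.regular) :
    f.WVReturn u v (D.toGraph p) (D.toGraph (D.rHat p)) := by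
  refine ⟨D.toGraph_mem_boundaryStar hp.1, D.toGraph_mem_boundaryStar (D.rHat_mem hp), ?_⟩
  obtain ⟨h1, h2, h3⟩ := hp
  rw [rHat]
  split_ifs with h
  · have hs := D.flip_mem_sides (D.vHat_mem_sides h1.1) h2.1 h
    refine ⟨2, two_pos, fun k => if k = 0 then D.toGraph p else if k = 1 then
      D.toGraph (flipGerm (D.vHat p)) else D.toGraph (D.uHat (D.vHat (flipGerm (D.vHat p)))),
      rfl, rfl, ?_, ?_⟩
    · intro k hk
      interval_cases k
      · exact D.wv_toGraph_flip h1.1 h2 h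
      · exact D.wv_toGraph_uHat hs (h3 h) (D.vHat_mem_outerSides hs h)
    · intro k hk hk'
      obtain rfl : k = 1 := by omega
      exact fun hm => D.notMem_frontier h hm.2
  · refine ⟨1, one_pos, fun k => if k = 0 then D.toGraph p else D.toGraph (D.uHat (D.vHat p)),
      rfl, rfl, ?_, fun k hk hk' => by omega⟩
    intro k hk
    obtain rfl : k = 0 := by omega
    exact D.wv_toGraph_uHat h1.1 h2 (D.vHat_mem_outerSides_of_notMem h1.1 h)

theorem vHat_injective : Function.Injective D.vHat :=
  Function.LeftInverse.injective D.vHat_vHat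

theorem uHat_injective : Function.Injective D.uHat :=
  Function.LeftInverse.injective D.uHat_uHat

omit D in
theorem _root_.flipGerm_injective : Function.Injective flipGerm :=
  Function.LeftInverse.injective flipGerm_flipGerm

/-- Each branch is a composition of involutions. A coincidence between the two branches would
identify `flipGerm (vHat p)`, based in `Δ`, with a germ based on `∂Δ`. -/
theorem rHat_injOn : InjOn D.rHat D.outerSides := by
  intro p hp q hq h
  have key : ∀ p ∈ D.outerSides, ∀ q ∈ D.outerSides, (D.vHat p).1 ∈ Δ →
      flipGerm (D.vHat p) ≠ q := by
    rintro p - q hq h rfl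
    exact D.notMem_frontier h hq.2
  rw [rHat, rHat] at h
  split_ifs at h with h1 h2 h2
  · exact D.vHat_injective (flipGerm_injective (D.vHat_injective (D.uHat_injective h)))
  · exact absurd (D.vHat_injective (D.uHat_injective h)) (key p hp q hq h1)
  · exact absurd (D.vHat_injective (D.uHat_injective h)).symm (key q hq p hp h2)
  · exact D.vHat_injective (D.uHat_injective h)

theorem finite_outerSides_diff_regular : (D.outerSides \ D.regular).Finite := by
  have h1 := D.finite_sides_diff_neat
  have h2 : (D.vHat ⁻¹' (D.sides \ D.neat)).Finite := h1.preimage D.vHat_injective.injOn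
  have h3 : ((fun p => D.vHat (flipGerm (D.vHat p))) ⁻¹' (D.sides \ D.neat)).Finite :=
    h1.preimage (D.vHat_injective.comp (flipGerm_injective.comp D.vHat_injective)).injOn
  refine (h2.union h3).subset ?_
  rintro p ⟨hp, hn⟩
  by_cases h : D.vHat p ∈ D.neat
  · right
    by_contra hcon
    refine hn ⟨hp, h, fun hz => ?_⟩
    by_contra hcon'
    exact hcon ⟨D.vHat_mem_sides (D.flip_mem_sides (D.vHat_mem_sides hp.1) h.1 hz), hcon'⟩
  · exact Or.inl ⟨D.vHat_mem_sides hp.1, h⟩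

omit D in
theorem _root_.eventually_neg {P : ℝ → Prop} (h : ∀ᶠ t in nhds (0 : ℝ), P t) :
    ∀ᶠ t in nhds (0 : ℝ), P (-t) := by
  have : Filter.Tendsto (fun t : ℝ => -t) (nhds 0) (nhds 0) := by
    simpa using (continuous_neg (G := ℝ)).tendsto 0
  exact this.eventually h

omit D in
theorem _root_.continuous_shift (p : ℂ × ℂ) : Continuous fun t : ℝ => shift t p := by
  unfold shift; fun_prop

/-- Each branch composes an even number of reversals (`u v`, or `u v flip v`), so the return map
moves germs in the positive direction and is locally a translation. -/
theorem eventually_rHat_shift {p : ℂ × ℂ} (hp : p ∈ D.regular) :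
    ∀ᶠ t in nhds (0 : ℝ), D.rHat (shift t p) = shift t (D.rHat p) := by
  obtain ⟨h1, h2, h3⟩ := hp
  have hv := D.eventually_vHat_shift h1.1.1
  by_cases h : (D.vHat p).1 ∈ Δ
  · have h4 : ∀ᶠ t in nhds (0 : ℝ), (shift (-t) (D.vHat p)).1 ∈ Δ := by
      refine eventually_neg (P := fun t => (shift t (D.vHat p)).1 ∈ Δ) ?_
      have hc : Continuous fun t : ℝ => (shift t (D.vHat p)).1 :=
        continuous_fst.comp (continuous_shift _)
      refine hc.continuousAt.eventually (D.isOpen.eventually_mem ?_)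
      simpa [shift_zero] using h
    have hs := D.flip_mem_sides (D.vHat_mem_sides h1.1) h2.1 h
    filter_upwards [hv, h4, D.eventually_vHat_shift hs.1] with t ht ht' ht''
    rw [rHat, ht, if_pos ht', rHat, if_pos h, flip_shift, neg_neg, ht'', uHat_shift, neg_neg]
  · have h4 := eventually_neg (D.eventually_shift_mem_outerSides
      (D.vHat_mem_outerSides_of_notMem h1.1 h) h2.1)
    filter_upwards [hv, h4] with t ht ht'
    rw [rHat, ht, if_neg (D.notMem_of_mem_frontier ht'.2), rHat, if_neg h, uHat_shift, neg_neg]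

end NousData

/-! ### One-dimensional Hausdorff measure on germs. -/

open MeasureTheory Measure

/-- The condition fails exactly when some `w ∉ A` lies in the half-disc, and for fixed `w` this is
open in the germ; hence no regularity of `A` matters. -/
theorem isClosed_halfDisc_subset (ε : ℝ) (A : Set ℂ) :
    IsClosed {p : ℂ × ℂ | halfDisc p ε ⊆ A} := by
  rw [← isOpen_compl_iff]
  have : {p : ℂ × ℂ | halfDisc p ε ⊆ A}ᶜ = ⋃ w ∈ Aᶜ,
      ({p : ℂ × ℂ | ‖w - p.1‖ < ε} ∩ {p : ℂ × ℂ | 0 < inner ℝ p.2 (w - p.1)}) := by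
    ext p
    simp only [mem_compl_iff, mem_ofPred_eq, not_subset, mem_iUnion, mem_inter_iff, halfDisc]
    exact ⟨fun ⟨w, h1, h2⟩ => ⟨w, h2, h1⟩, fun ⟨w, h1, h2⟩ => ⟨w, h2, h1⟩⟩
  rw [this]
  refine isOpen_biUnion fun w _ => IsOpen.inter ?_ ?_
  · exact isOpen_lt (by fun_prop) continuous_const
  · exact isOpen_lt continuous_const (by fun_prop)

theorem measurableSet_inward (A : Set ℂ) : MeasurableSet {p : ℂ × ℂ | Inward A p} := by
  have : {p : ℂ × ℂ | Inward A p} = {p : ℂ × ℂ | ‖p.2‖ = 1} ∩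
      ⋃ m : ℕ, {p : ℂ × ℂ | halfDisc p (1 / ((m : ℝ) + 1)) ⊆ A} := by
    ext p
    simp only [mem_ofPred_eq, mem_inter_iff, mem_iUnion, Inward]
    refine and_congr_right fun _ => ⟨?_, ?_⟩
    · rintro ⟨ε, hε, h⟩
      obtain ⟨m, hm⟩ := exists_nat_one_div_lt hε
      exact ⟨m, (halfDisc_mono _ hm.le).trans h⟩
    · rintro ⟨m, hm⟩
      exact ⟨_, Nat.one_div_pos_of_nat, hm⟩
  rw [this]
  refine MeasurableSet.inter ?_ (MeasurableSet.iUnion fun m =>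
    (isClosed_halfDisc_subset _ _).measurableSet)
  exact (isClosed_eq (by fun_prop) continuous_const).measurableSet

section Involution

variable {X : Type*} [MeasurableSpace X] {μ : Measure X} {T : X → X}

theorem measurableEmbedding_of_involutive (hT : Measurable T) (hinv : ∀ p, T (T p) = p) :
    MeasurableEmbedding T :=
  (MeasurableEquiv.mk ⟨T, T, hinv, hinv⟩ hT hT).measurableEmbedding

omit [MeasurableSpace X] in
theorem preimage_eq_of_involutive (hinv : ∀ p, T (T p) = p) {A : Set X}
    (hA : ∀ p ∈ A, T p ∈ A) : T ⁻¹' A = A :=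
  Subset.antisymm (fun p hp => by rw [← hinv p]; exact hA _ hp) hA

theorem setIntegral_preimage_of_involutive (hT : MeasurePreserving T μ μ)
    (hinv : ∀ p, T (T p) = p) (A : Set X) (g : X → ℝ) :
    ∫ p in T ⁻¹' A, g (T p) ∂μ = ∫ p in A, g p ∂μ :=
  hT.setIntegral_preimage_emb (measurableEmbedding_of_involutive hT.measurable hinv) g A

theorem setIntegral_comp_involutive (hT : MeasurePreserving T μ μ)
    (hinv : ∀ p, T (T p) = p) {A : Set X} (hA : ∀ p ∈ A, T p ∈ A) (g : X → ℝ) :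
    ∫ p in A, g (T p) ∂μ = ∫ p in A, g p ∂μ := by
  conv_rhs => rw [← setIntegral_preimage_of_involutive hT hinv]
  rw [preimage_eq_of_involutive hinv hA]

theorem setIntegral_eq_zero_of_involutive (hT : MeasurePreserving T μ μ)
    (hinv : ∀ p, T (T p) = p) {A : Set X} (hA : ∀ p ∈ A, T p ∈ A) (hAm : MeasurableSet A)
    {g : X → ℝ} (hg : ∀ p ∈ A, g (T p) = -g p) : ∫ p in A, g p ∂μ = 0 := by
  have h1 := setIntegral_comp_involutive hT hinv hA g
  rw [setIntegral_congr_fun hAm hg, integral_neg] at h1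
  linarith

end Involution

theorem measurePreserving_of_isometry {T : ℂ × ℂ → ℂ × ℂ} (hT : Isometry T)
    (hs : Function.Surjective T) : MeasurePreserving T (μH[1] : Measure (ℂ × ℂ)) μH[1] := by
  refine ⟨hT.continuous.measurable, ?_⟩
  rw [hT.map_hausdorffMeasure (Or.inl zero_le_one), hs.range_eq, restrict_univ]

theorem measurePreserving_flip : MeasurePreserving flipGerm (μH[1] : Measure (ℂ × ℂ)) μH[1] :=
  measurePreserving_of_isometry isometry_flip fun p => ⟨flipGerm p, flipGerm_flipGerm p⟩

theorem hausdorffMeasure_shift_image {p : ℂ × ℂ} (hp : ‖p.2‖ = 1) (S : Set ℝ) :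
    μH[1] ((fun t : ℝ => shift t p) '' S) = volume S := by
  rw [(isometry_shift hp).hausdorffMeasure_image (Or.inl zero_le_one), hausdorffMeasure_real]

/-- A function that is constant on the members of a finite measurable cover is integrable. -/
theorem integrableOn_of_finite_cover {X ι : Type*} [MeasurableSpace X] {μ : Measure X} {A : Set X}
    (hA : μ A < ⊤) {s : Set ι} (hs : s.Finite) {P : ι → Set X} (hP : ∀ i ∈ s, MeasurableSet (P i))
    (hcov : A ⊆ ⋃ i ∈ s, P i) {g : X → ℝ} (hg : ∀ i ∈ s, ∃ c, ∀ x ∈ P i ∩ A, g x = c)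
    (hAm : MeasurableSet A) : IntegrableOn g A μ := by
  have : IntegrableOn g (⋃ i ∈ s, P i ∩ A) μ := by
    rw [integrableOn_finite_biUnion hs]
    intro i hi
    obtain ⟨c, hc⟩ := hg i hi
    have h1 : IntegrableOn (fun _ => c) (P i ∩ A) μ :=
      integrableOn_const ((measure_mono inter_subset_right).trans_lt hA).ne
    exact h1.congr_fun (fun x hx => (hc x hx).symm) ((hP i hi).inter hAm)
  refine this.mono_set fun x hx => ?_
  obtain ⟨i, hi, hxi⟩ := mem_iUnion₂.1 (hcov hx)
  exact mem_iUnion₂.2 ⟨i, hi, hxi, hx⟩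

namespace NousData

variable {Δ : Set ℂ} {f : PiecewiseRotation Δ} {u v : ℂ → ℂ} (D : NousData f u v)
include D

theorem measurePreserving_uHat :
    MeasurePreserving D.uHat (μH[1] : Measure (ℂ × ℂ)) μH[1] :=
  measurePreserving_of_isometry (isometry_rev D.norm_ua _) fun p => ⟨D.uHat p, D.uHat_uHat p⟩

theorem germs_eq : D.germs = ⋃ Q ∈ components f.dom, {p | Inward Q p} := by
  ext p; simp [germs]

theorem measurableSet_germs : MeasurableSet D.germs := by
  rw [D.germs_eq]
  exact MeasurableSet.biUnion D.finite.countable fun Q _ => measurableSet_inward Q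

theorem measurable_vHat : Measurable D.vHat := by
  intro S hS
  have : D.vHat ⁻¹' S = (⋃ Q ∈ components f.dom, ({p | Inward Q p} ∩
      rev (D.va Q) (D.vb Q) ⁻¹' S)) ∪ (D.germsᶜ ∩ S) := by
    ext p
    simp only [mem_preimage, mem_union, mem_iUnion, mem_inter_iff, mem_ofPred_eq, mem_compl_iff]
    constructor
    · intro h
      by_cases hp : p ∈ D.germs
      · rw [D.vHat_of_mem hp] at h
        exact Or.inl ⟨_, D.cell_mem hp, D.inward_cell hp, h⟩
      · rw [vHat, if_neg hp] at h
        exact Or.inr ⟨hp, h⟩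
    · rintro (⟨Q, hQ, h1, h2⟩ | ⟨h1, h2⟩)
      · rwa [D.vHat_eq hQ h1]
      · rwa [vHat, if_neg h1]
  rw [this]
  refine (MeasurableSet.biUnion D.finite.countable fun Q hQ => (measurableSet_inward Q).inter ?_).union
    (D.measurableSet_germs.compl.inter hS)
  exact (isometry_rev (D.norm_va Q hQ) _).continuous.measurable hS

/-- Although `vHat` is not a global isometry, it is its own inverse and maps isometrically on each
of finitely many measurable sets covering the space, so the measures can be compared there. -/
theorem measurePreserving_vHat :
    MeasurePreserving D.vHat (μH[1] : Measure (ℂ × ℂ)) μH[1] := by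
  refine ⟨D.measurable_vHat, ?_⟩
  have hpre : ∀ S, D.vHat ⁻¹' S = D.vHat '' S := fun S => by
    ext p
    exact ⟨fun h => ⟨_, h, D.vHat_vHat p⟩, by rintro ⟨q, hq, rfl⟩; rwa [mem_preimage, D.vHat_vHat]⟩
  refine ext_of_sUnion_eq_univ (S := insert D.germsᶜ
    ((fun Q => {p | Inward Q p}) '' components f.dom)) ?_ ?_ ?_
  · exact (D.finite.image _).countable.insert _
  · rw [sUnion_insert, sUnion_image, ← D.germs_eq, compl_union_self]
  · have hm : ∀ A : Set (ℂ × ℂ), MeasurableSet A → (∀ S, S ⊆ A → μH[1] (D.vHat '' S) = μH[1] S) →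
        (map D.vHat μH[1]).restrict A = (μH[1] : Measure (ℂ × ℂ)).restrict A := by
      intro A hA h
      ext S hS
      rw [restrict_apply hS, restrict_apply hS, map_apply D.measurable_vHat (hS.inter hA), hpre,
        h _ inter_subset_right]
    rintro A (rfl | ⟨Q, hQ, rfl⟩)
    · refine hm _ D.measurableSet_germs.compl fun S hS => ?_
      have : EqOn D.vHat id S := fun p hp => if_neg (hS hp)
      rw [this.image_eq, image_id]
    · refine hm _ (measurableSet_inward Q) fun S hS => ?_
      have : EqOn D.vHat (rev (D.va Q) (D.vb Q)) S := fun p hp => D.vHat_eq hQ (hS hp)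
      rw [this.image_eq, (isometry_rev (D.norm_va Q hQ) _).hausdorffMeasure_image
        (Or.inl zero_le_one)]

theorem measurableSet_sides : MeasurableSet D.sides :=
  D.measurableSet_germs.inter (measurable_fst D.isOpen_dom.measurableSet).compl

theorem measurableSet_outerSides : MeasurableSet D.outerSides :=
  D.measurableSet_sides.inter (measurable_fst isClosed_frontier.measurableSet)

theorem exists_norm_le : ∃ R : ℝ, ∀ p ∈ D.germs, ‖p.1‖ ≤ R := by
  obtain ⟨R, hR⟩ := D.bounded.closure.exists_norm_le
  exact ⟨R, fun p hp => hR _ (D.inward_of_mem hp).mem_closure⟩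

theorem measure_sides_lt_top : μH[1] D.sides < ⊤ := by
  obtain ⟨R, hR⟩ := D.exists_norm_le
  have hsub : D.sides ⊆ ⋃ k ∈ D.reps, (fun t : ℝ => shift t k) ''
      {t : ℝ | ‖k.2‖ = 1 ∧ |t| ≤ R + ‖k.1‖} := by
    intro p hp
    obtain ⟨k, hk, hn, t, rfl⟩ := D.sides_subset_leaves hp
    refine mem_iUnion₂.2 ⟨k, hk, t, ⟨hn, ?_⟩, rfl⟩
    rw [← norm_shift_sub hn t]
    exact (norm_sub_le _ _).trans (add_le_add_left (hR _ hp.1) _)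
  refine (measure_mono hsub).trans_lt (measure_biUnion_lt_top D.finite_reps fun k _ => ?_)
  by_cases hk : ‖k.2‖ = 1
  · rw [hausdorffMeasure_shift_image hk]
    refine (measure_mono (t := Icc (-(R + ‖k.1‖)) (R + ‖k.1‖)) fun t ht => abs_le.1 ht.2).trans_lt ?_
    simp
  · simp [hk]

theorem finite_normals : (Prod.snd '' D.sides).Finite := by
  refine (D.finite_reps.image Prod.snd).subset ?_
  rintro _ ⟨p, hp, rfl⟩
  obtain ⟨k, hk, hn, t, rfl⟩ := D.sides_subset_leaves hp
  exact ⟨k, hk, rfl⟩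

end NousData

section Iterate

variable {X : Type*} [MeasurableSpace X] {μ : Measure X} {T : X → X}

theorem integrableOn_comp_iterate (hT : MeasurePreserving T μ μ) (he : MeasurableEmbedding T)
    {A : Set X} (hA : T ⁻¹' A = A) (k : ℕ) {g : X → ℝ} (hg : IntegrableOn g A μ) :
    IntegrableOn (fun p => g (T^[k] p)) A μ ∧ ∫ p in A, g (T^[k] p) ∂μ = ∫ p in A, g p ∂μ := by
  induction k with
  | zero => exact ⟨hg, rfl⟩
  | succ k ih =>
    have h1 := (hT.integrableOn_comp_preimage he).2 ih.1
    have h2 := hT.setIntegral_preimage_emb he (fun p => g (T^[k] p)) A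
    rw [hA] at h1 h2
    exact ⟨h1, h2.trans ih.2⟩

/-- A cocycle whose sums over the orbits of a periodic map vanish has integral zero. -/
theorem setIntegral_eq_zero_of_sum_iterate (hT : MeasurePreserving T μ μ)
    (he : MeasurableEmbedding T) {A : Set X} (hAm : MeasurableSet A) (hA : T ⁻¹' A = A) {n : ℕ}
    (hn : 0 < n) {g : X → ℝ} (hg : IntegrableOn g A μ)
    (hsum : ∀ p ∈ A, ∑ k ∈ Finset.range n, g (T^[k] p) = 0) : ∫ p in A, g p ∂μ = 0 := by
  have h1 : ∫ p in A, ∑ k ∈ Finset.range n, g (T^[k] p) ∂μ = n * ∫ p in A, g p ∂μ := by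
    rw [integral_finsetSum _ fun k _ => (integrableOn_comp_iterate hT he hA k hg).1,
      Finset.sum_congr rfl fun k _ => (integrableOn_comp_iterate hT he hA k hg).2]
    simp
  rw [setIntegral_congr_fun hAm hsum] at h1
  simp only [integral_zero] at h1
  have hn' : (n : ℝ) ≠ 0 := by exact_mod_cast hn.ne'
  exact (mul_eq_zero.1 h1.symm).resolve_left hn'

end Iterate

/-! ### The tower over the sides, and the identity between integrals of defects. -/

namespace NousData

variable {Δ : Set ℂ} {f : PiecewiseRotation Δ} {u v : ℂ → ℂ} (D : NousData f u v)
include D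

/-- The three involutions of the space of germs. -/
noncomputable def gen : Fin 3 → ℂ × ℂ → ℂ × ℂ := ![D.uHat, D.vHat, flipGerm]

theorem gen_gen (i : Fin 3) (p : ℂ × ℂ) : D.gen i (D.gen i p) = p := by
  fin_cases i
  · exact D.uHat_uHat p
  · exact D.vHat_vHat p
  · exact flipGerm_flipGerm p

/-- The union of the images of a set under all words in the three involutions. -/
def saturation (A : Set (ℂ × ℂ)) : Set (ℂ × ℂ) :=
  ⋃ l : List (Fin 3), (fun p => l.foldr D.gen p) '' A

theorem gen_mem_saturation {A : Set (ℂ × ℂ)} (i : Fin 3) {p : ℂ × ℂ} (hp : p ∈ D.saturation A) :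
    D.gen i p ∈ D.saturation A := by
  obtain ⟨l, q, hq, rfl⟩ := mem_iUnion.1 hp
  exact mem_iUnion.2 ⟨i :: l, q, hq, rfl⟩

theorem gen_mem_saturation_iff {A : Set (ℂ × ℂ)} (i : Fin 3) {p : ℂ × ℂ} :
    D.gen i p ∈ D.saturation A ↔ p ∈ D.saturation A :=
  ⟨fun h => by simpa [D.gen_gen] using D.gen_mem_saturation i h, D.gen_mem_saturation i⟩

theorem subset_saturation (A : Set (ℂ × ℂ)) : A ⊆ D.saturation A :=
  fun p hp => mem_iUnion.2 ⟨[], p, hp, rfl⟩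

theorem measurable_gen (i : Fin 3) : Measurable (D.gen i) := by
  fin_cases i
  · exact D.measurePreserving_uHat.measurable
  · exact D.measurePreserving_vHat.measurable
  · exact measurePreserving_flip.measurable

theorem foldr_image_cons (i : Fin 3) (l : List (Fin 3)) (A : Set (ℂ × ℂ)) :
    (fun p => (i :: l).foldr D.gen p) '' A = D.gen i '' ((fun p => l.foldr D.gen p) '' A) := by
  rw [image_image]; rfl

theorem measurableSet_saturation {A : Set (ℂ × ℂ)} (hA : MeasurableSet A) :
    MeasurableSet (D.saturation A) := by
  refine MeasurableSet.iUnion fun l => ?_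
  induction l with
  | nil => simpa using hA
  | cons i l ih =>
    rw [D.foldr_image_cons]
    exact (measurableEmbedding_of_involutive (D.measurable_gen i)
      (D.gen_gen i)).measurableSet_image.2 ih

theorem countable_saturation {A : Set (ℂ × ℂ)} (hA : A.Countable) : (D.saturation A).Countable :=
  countable_iUnion fun _ => hA.image _

theorem vHat_image_subset_leaves {K : Set (ℂ × ℂ)} {A : Set (ℂ × ℂ)} (hA : A ⊆ leaves K) :
    D.vHat '' A ⊆ leaves (K ∪ ⋃ Q ∈ components f.dom, rev (D.va Q) (D.vb Q) '' K) := by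
  rintro _ ⟨p, hp, rfl⟩
  by_cases h : p ∈ D.germs
  · rw [D.vHat_of_mem h]
    refine leaves_mono ?_ (rev_mem_leaves (D.norm_va _ (D.cell_mem h)) _ (hA hp))
    exact fun k hk => Or.inr (mem_iUnion₂.2 ⟨_, D.cell_mem h, hk⟩)
  · rw [vHat, if_neg h]
    exact leaves_mono subset_union_left (hA hp)

theorem exists_countable_leaves_gen (i : Fin 3) {A : Set (ℂ × ℂ)}
    (hA : ∃ K : Set (ℂ × ℂ), K.Countable ∧ A ⊆ leaves K) :
    ∃ K : Set (ℂ × ℂ), K.Countable ∧ D.gen i '' A ⊆ leaves K := by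
  obtain ⟨K, hK, hA⟩ := hA
  fin_cases i
  · exact ⟨_, hK.image D.uHat, by rintro _ ⟨p, hp, rfl⟩; exact D.uHat_mem_leaves (hA hp)⟩
  · exact ⟨_, hK.union (D.finite.countable.biUnion fun Q _ => hK.image _),
      D.vHat_image_subset_leaves hA⟩
  · exact ⟨_, hK.image flipGerm, by rintro _ ⟨p, hp, rfl⟩; exact flip_mem_leaves (hA hp)⟩

theorem exists_countable_leaves_saturation {A : Set (ℂ × ℂ)}
    (hA : ∃ K : Set (ℂ × ℂ), K.Countable ∧ A ⊆ leaves K) :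
    ∃ K : Set (ℂ × ℂ), K.Countable ∧ D.saturation A ⊆ leaves K := by
  have : ∀ l : List (Fin 3), ∃ K : Set (ℂ × ℂ), K.Countable ∧
      (fun p => l.foldr D.gen p) '' A ⊆ leaves K := by
    intro l
    induction l with
    | nil => simpa using hA
    | cons i l ih =>
      rw [D.foldr_image_cons]
      exact D.exists_countable_leaves_gen i ih
  choose K hK hs using this
  refine ⟨⋃ l, K l, countable_iUnion hK, iUnion_subset fun l => (hs l).trans ?_⟩
  exact leaves_mono (subset_iUnion K l)

/-- The germs whose orbit under the three involutions is exceptional. -/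
def exceptional : Set (ℂ × ℂ) := D.saturation (D.saturation D.sides \ D.neat)

/-- There are countably many words in the involutions, so the saturation of the sides lies on
countably many lines, each with finitely many germs that are not neat. A countable set is null for
the measure in use. -/
theorem countable_exceptional : D.exceptional.Countable := by
  obtain ⟨K, hK, hs⟩ := D.exists_countable_leaves_saturation
    ⟨D.reps, D.finite_reps.countable, D.sides_subset_leaves⟩
  exact D.countable_saturation
    ((D.countable_leaves_diff_neat hK).mono fun p hp => (⟨hs hp.1, hp.2⟩ : p ∈ leaves K \ D.neat))

/-- A set of germs, invariant under the three involutions, that are parallel to all sides through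
their base points. -/
def tame : Set (ℂ × ℂ) := D.saturation D.sides \ D.exceptional

theorem gen_mem_tame (i : Fin 3) {p : ℂ × ℂ} (hp : p ∈ D.tame) : D.gen i p ∈ D.tame :=
  ⟨D.gen_mem_saturation i hp.1, fun h => hp.2 ((D.gen_mem_saturation_iff i).1 h)⟩

theorem uHat_mem_tame {p : ℂ × ℂ} (hp : p ∈ D.tame) : D.uHat p ∈ D.tame := D.gen_mem_tame 0 hp

theorem vHat_mem_tame {p : ℂ × ℂ} (hp : p ∈ D.tame) : D.vHat p ∈ D.tame := D.gen_mem_tame 1 hp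

theorem flip_mem_tame {p : ℂ × ℂ} (hp : p ∈ D.tame) : flipGerm p ∈ D.tame := D.gen_mem_tame 2 hp

theorem tame_subset_neat : D.tame ⊆ D.neat := fun p hp => by
  by_contra h
  exact hp.2 (D.subset_saturation _ ⟨hp.1, h⟩)

/-- The tame germs on the inner side of a component. -/
def tameGerms : Set (ℂ × ℂ) := D.tame ∩ D.germs

theorem vHat_mem_tameGerms {p : ℂ × ℂ} (hp : p ∈ D.tameGerms) : D.vHat p ∈ D.tameGerms :=
  ⟨D.vHat_mem_tame hp.1, D.vHat_mem hp.2⟩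

theorem uHat_mem_tameGerms {p : ℂ × ℂ} (hp : p ∈ D.tameGerms) : D.uHat p ∈ D.tameGerms :=
  ⟨D.uHat_mem_tame hp.1, D.mem_germs_of_inward (D.tame_subset_neat (D.uHat_mem_tame hp.1)).1
    (D.inward_uHat (D.inward_of_mem hp.2))⟩

theorem fHat_mem_tameGerms {p : ℂ × ℂ} (hp : p ∈ D.tameGerms) : D.fHat p ∈ D.tameGerms :=
  D.uHat_mem_tameGerms (D.vHat_mem_tameGerms hp)

theorem flip_mem_tameGerms {p : ℂ × ℂ} (hp : p ∈ D.tameGerms) (hz : p.1 ∈ Δ) :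
    flipGerm p ∈ D.tameGerms :=
  ⟨D.flip_mem_tame hp.1,
    D.mem_germs_of_fst_mem (D.tame_subset_neat (D.flip_mem_tame hp.1)).1 hz⟩

theorem fHat_iterate_mem {p : ℂ × ℂ} (hp : p ∈ D.tameGerms) (k : ℕ) :
    D.fHat^[k] p ∈ D.tameGerms := by
  induction k with
  | zero => exact hp
  | succ k ih => rw [Function.iterate_succ_apply']; exact D.fHat_mem_tameGerms ih

theorem isPeriodicPt {p : ℂ × ℂ} (hp : p ∈ D.tameGerms) :
    Function.IsPeriodicPt D.fHat D.period p :=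
  D.fHat_iterate_period fun j _ => (D.fHat_iterate_mem hp j).2

/-- Reversibility: `v` conjugates `f` to its inverse. -/
theorem fHat_vHat_fHat (p : ℂ × ℂ) : D.fHat (D.vHat (D.fHat p)) = D.vHat p := by
  simp only [fHat, D.vHat_vHat, D.uHat_uHat]

theorem fHat_iterate_vHat (j : ℕ) (p : ℂ × ℂ) :
    D.fHat^[j] (D.vHat (D.fHat^[j] p)) = D.vHat p := by
  induction j with
  | zero => rfl
  | succ j ih =>
    rw [Function.iterate_succ_apply, Function.iterate_succ_apply', D.fHat_vHat_fHat, ih]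

/-- The tame germs whose orbit meets the sides of the components. -/
def tower : Set (ℂ × ℂ) := {p | p ∈ D.tameGerms ∧ ∃ k : ℕ, D.fHat^[k] p ∈ D.sides}

theorem fHat_mem_tower {p : ℂ × ℂ} (hp : p ∈ D.tower) : D.fHat p ∈ D.tower := by
  obtain ⟨h, k, hk⟩ := hp
  -- The step already taken is undone by going once around the period.
  refine ⟨D.fHat_mem_tameGerms h, k + (D.period - 1), ?_⟩
  have e : k + (D.period - 1) + 1 = k + D.period := by have := D.period_pos; omega
  rw [← Function.iterate_succ_apply, Nat.succ_eq_add_one, e, Function.iterate_add_apply,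
    (D.isPeriodicPt h).eq]
  exact hk

theorem vHat_mem_tower {p : ℂ × ℂ} (hp : p ∈ D.tower) : D.vHat p ∈ D.tower := by
  obtain ⟨h, j, hj⟩ := hp
  -- The orbit of `v p` reaches the side `v (f^j p)` after `-j` steps; a multiple of the period
  -- makes the exponent nonnegative.
  refine ⟨D.vHat_mem_tameGerms h, D.period * j - j, ?_⟩
  have h1 := D.vHat_mem_tameGerms (D.fHat_iterate_mem h j)
  rw [← D.fHat_iterate_vHat j p, ← Function.iterate_add_apply,
    Nat.sub_add_cancel (Nat.le_mul_of_pos_left _ D.period_pos), mul_comm,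
    ((D.isPeriodicPt h1).const_mul j).eq]
  exact D.vHat_mem_sides hj

theorem uHat_mem_tower {p : ℂ × ℂ} (hp : p ∈ D.tower) : D.uHat p ∈ D.tower := by
  have := D.fHat_mem_tower (D.vHat_mem_tower hp)
  rwa [fHat, D.vHat_vHat] at this

/-- If the orbit of the flipped germ never met a side, it would stay over `dom f`, where `f`
commutes with `flipGerm`; then the orbit of `p` would have the same base points and never meet a
side either. -/
theorem flip_mem_tower {p : ℂ × ℂ} (hp : p ∈ D.tower) (hz : p.1 ∈ Δ) : flipGerm p ∈ D.tower := by
  obtain ⟨h, j, hj⟩ := hp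
  have h1 := D.flip_mem_tameGerms h hz
  refine ⟨h1, ?_⟩
  by_contra hcon
  push Not at hcon
  have hdom : ∀ k, (D.fHat^[k] (flipGerm p)).1 ∈ f.dom := fun k => by
    by_contra hd
    exact hcon k ⟨(D.fHat_iterate_mem h1 k).2, hd⟩
  have key : ∀ k, D.fHat^[k] p = flipGerm (D.fHat^[k] (flipGerm p)) := by
    intro k
    induction k with
    | zero => exact (flipGerm_flipGerm p).symm
    | succ k ih =>
      rw [Function.iterate_succ_apply', Function.iterate_succ_apply', ih, fHat,
        D.vHat_flip (D.norm_of_mem (D.fHat_iterate_mem h1 k).2) (hdom k), D.uHat_flip, fHat]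
  refine hj.2 ?_
  rw [key]
  exact hdom j

theorem measurePreserving_fHat :
    MeasurePreserving D.fHat (μH[1] : Measure (ℂ × ℂ)) μH[1] :=
  D.measurePreserving_uHat.comp D.measurePreserving_vHat

theorem measurableEmbedding_fHat : MeasurableEmbedding D.fHat :=
  (measurableEmbedding_of_involutive D.measurePreserving_uHat.measurable D.uHat_uHat).comp
    (measurableEmbedding_of_involutive D.measurable_vHat D.vHat_vHat)

theorem measurableSet_tower : MeasurableSet D.tower := by
  have : D.tower = D.tame ∩ D.germs ∩ ⋃ k : ℕ, D.fHat^[k] ⁻¹' D.sides := by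
    ext p; simp only [tower, tameGerms, mem_inter_iff, mem_ofPred_eq, mem_iUnion, mem_preimage]
  rw [this]
  refine MeasurableSet.inter (MeasurableSet.inter ?_ D.measurableSet_germs)
    (MeasurableSet.iUnion fun k =>
      D.measurePreserving_fHat.measurable.iterate k D.measurableSet_sides)
  exact (D.measurableSet_saturation D.measurableSet_sides).diff
    D.countable_exceptional.measurableSet

theorem exists_iterate_lt {p : ℂ × ℂ} (hp : p ∈ D.tower) :
    ∃ k < D.period, D.fHat^[k] p ∈ D.sides := by
  obtain ⟨h, k, hk⟩ := hp
  refine ⟨k % D.period, Nat.mod_lt _ D.period_pos, ?_⟩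
  rwa [(D.isPeriodicPt h).iterate_mod_apply]

theorem measure_tower_lt_top : μH[1] D.tower < ⊤ := by
  have : D.tower ⊆ ⋃ k ∈ Finset.range D.period, D.fHat^[k] ⁻¹' D.sides := by
    intro p hp
    obtain ⟨k, hk, h⟩ := D.exists_iterate_lt hp
    exact mem_iUnion₂.2 ⟨k, Finset.mem_range.2 hk, h⟩
  refine (measure_mono this).trans_lt (measure_biUnion_lt_top (Finset.finite_toSet _) fun k _ => ?_)
  rw [(D.measurePreserving_fHat.iterate k).measure_preimage
    D.measurableSet_sides.nullMeasurableSet]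
  exact D.measure_sides_lt_top

theorem finite_normals_vHat {A : Set (ℂ × ℂ)} (hA : (Prod.snd '' A).Finite) :
    (Prod.snd '' (D.vHat '' A)).Finite := by
  refine (hA.union (D.finite.biUnion fun Q _ =>
    hA.image fun n => D.va Q * conj n)).subset ?_
  rintro _ ⟨_, ⟨p, hp, rfl⟩, rfl⟩
  by_cases h : p ∈ D.germs
  · rw [D.vHat_of_mem h]
    exact Or.inr (mem_iUnion₂.2 ⟨_, D.cell_mem h, p.2, mem_image_of_mem _ hp, rfl⟩)
  · rw [vHat, if_neg h]
    exact Or.inl (mem_image_of_mem _ hp)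

theorem finite_normals_fHat {A : Set (ℂ × ℂ)} (hA : (Prod.snd '' A).Finite) :
    (Prod.snd '' (D.fHat '' A)).Finite := by
  have := (D.finite_normals_vHat hA).image fun n => D.ua * conj n
  refine this.subset ?_
  rintro _ ⟨_, ⟨p, hp, rfl⟩, rfl⟩
  exact ⟨_, mem_image_of_mem _ (mem_image_of_mem _ hp), rfl⟩

theorem finite_normals_tower : (Prod.snd '' D.tower).Finite := by
  have h1 : ∀ k : ℕ, (Prod.snd '' (D.fHat^[k] '' D.sides)).Finite := by
    intro k
    induction k with
    | zero => simpa using D.finite_normals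
    | succ k ih =>
      rw [Function.iterate_succ', image_comp]
      exact D.finite_normals_fHat ih
  refine ((Finset.finite_toSet (Finset.range (D.period + 1))).biUnion fun k _ => h1 k).subset ?_
  rintro _ ⟨p, hp, rfl⟩
  obtain ⟨k, hk, h⟩ := D.exists_iterate_lt hp
  refine mem_iUnion₂.2 ⟨D.period - k, ?_, _, ⟨_, h, ?_⟩, rfl⟩
  · simp only [Finset.coe_range, mem_Iio]; omega
  · rw [← Function.iterate_add_apply, Nat.sub_add_cancel hk.le]
    exact D.isPeriodicPt hp.1

/-- The value of `coord (vHat p) + coord p`. -/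
noncomputable def vDefect (p : ℂ × ℂ) : ℝ := defect (D.va (D.cell p)) (D.vb (D.cell p)) p

/-- The value of `coord (uHat p) + coord p`. -/
def uDefect (p : ℂ × ℂ) : ℝ := defect D.ua D.ub p

theorem coord_vHat {p : ℂ × ℂ} (hp : p ∈ D.germs) :
    coord (D.vHat p) = D.vDefect p - coord p := by
  rw [D.vHat_of_mem hp, coord_rev (D.norm_va _ (D.cell_mem hp)), vDefect]

theorem coord_uHat (p : ℂ × ℂ) : coord (D.uHat p) = D.uDefect p - coord p :=
  coord_rev D.norm_ua _ p

/-- A function of the cell and the normal alone has finitely many values here. This gives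
integrability of defects composed with an arbitrary additive `ψ`, measurable or not. -/
theorem integrableOn_of_cell {A : Set (ℂ × ℂ)} (hA : A ⊆ D.germs) (hAm : MeasurableSet A)
    (hμ : μH[1] A < ⊤) (hn : (Prod.snd '' A).Finite) {g : ℂ × ℂ → ℝ}
    (hg : ∀ p ∈ A, ∀ q ∈ A, D.cell p = D.cell q → p.2 = q.2 → g p = g q) :
    IntegrableOn g A μH[1] := by
  refine integrableOn_of_finite_cover hμ (D.finite.prod hn)
    (P := fun i => {p | Inward i.1 p} ∩ Prod.snd ⁻¹' {i.2}) (fun i _ => ?_) (fun p hp => ?_)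
    (fun i hi => ?_) hAm
  · exact (measurableSet_inward i.1).inter (measurable_snd (measurableSet_singleton _))
  · exact mem_iUnion₂.2 ⟨(D.cell p, p.2), ⟨D.cell_mem (hA hp), mem_image_of_mem _ hp⟩,
      D.inward_cell (hA hp), rfl⟩
  · by_cases hne : (({p | Inward i.1 p} ∩ Prod.snd ⁻¹' {i.2}) ∩ A).Nonempty
    · obtain ⟨q, ⟨hq1, hq2⟩, hqA⟩ := hne
      refine ⟨g q, ?_⟩
      rintro p ⟨⟨hp1, hp2⟩, hpA⟩
      refine hg p hpA q hqA ?_ (hp2.trans hq2.symm)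
      rw [(D.cell_eq hi.1 hp1).2, (D.cell_eq hi.1 hq1).2]
    · exact ⟨0, fun p hp => absurd ⟨p, hp⟩ hne⟩

theorem integrableOn_vDefect (ψ : ℝ →+ ℝ) {A : Set (ℂ × ℂ)} (hA : A ⊆ D.germs)
    (hAm : MeasurableSet A) (hμ : μH[1] A < ⊤) (hn : (Prod.snd '' A).Finite) :
    IntegrableOn (fun p => ψ (D.vDefect p)) A μH[1] :=
  D.integrableOn_of_cell hA hAm hμ hn fun p _ q _ h1 h2 => by
    simp only [vDefect, defect, h1, h2]

theorem integrableOn_uDefect (ψ : ℝ →+ ℝ) {A : Set (ℂ × ℂ)} (hA : A ⊆ D.germs)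
    (hAm : MeasurableSet A) (hμ : μH[1] A < ⊤) (hn : (Prod.snd '' A).Finite) :
    IntegrableOn (fun p => ψ (D.uDefect p)) A μH[1] :=
  D.integrableOn_of_cell hA hAm hμ hn fun p _ q _ _ h2 => by
    simp only [uDefect, defect, h2]

theorem tower_subset_germs : D.tower ⊆ D.germs := fun _ hp => hp.1.2

theorem sides_diff_tower_subset : D.sides \ D.tower ⊆ D.exceptional := by
  rintro p ⟨hp, hn⟩
  by_contra h
  exact hn ⟨⟨⟨D.subset_saturation _ hp, h⟩, hp.1⟩, 0, hp⟩

theorem tower_inter_ae {A : Set (ℂ × ℂ)} (hA : A ⊆ D.sides) :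
    (D.tower ∩ A : Set (ℂ × ℂ)) =ᵐ[μH[1]] A := by
  have : (D.tower ∩ A : Set (ℂ × ℂ)) = A \ (A \ D.tower) := by
    rw [sdiff_sdiff_right_self, inter_comm]
  rw [this]
  refine sdiff_null_ae_eq_self ?_
  have : NullSingletonClass (μH[1] : Measure (ℂ × ℂ)) := nullSingletonClass_hausdorff _ zero_lt_one
  exact (D.countable_exceptional.mono
    ((sdiff_subset_sdiff_left hA).trans D.sides_diff_tower_subset)).measure_zero _

/-- Germs of the tower off the sides are based in `dom f`; `flipGerm` permutes them without changing
the cell and negates the integrand. -/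
theorem setIntegral_vDefect_tower (ψ : ℝ →+ ℝ) :
    ∫ p in D.tower, ψ (D.vDefect p) ∂μH[1] = ∫ p in D.sides, ψ (D.vDefect p) ∂μH[1] := by
  have hint := D.integrableOn_vDefect ψ D.tower_subset_germs D.measurableSet_tower
    D.measure_tower_lt_top D.finite_normals_tower
  rw [← integral_inter_add_sdiff D.measurableSet_sides hint,
    setIntegral_congr_set (D.tower_inter_ae subset_rfl)]
  have hd : ∀ p ∈ D.tower \ D.sides, p.1 ∈ f.dom := fun p hp => by
    by_contra h
    exact hp.2 ⟨hp.1.1.2, h⟩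
  rw [setIntegral_eq_zero_of_involutive measurePreserving_flip flipGerm_flipGerm (fun p hp => ?_)
    (D.measurableSet_tower.diff D.measurableSet_sides) (fun p hp => ?_), add_zero]
  · exact ⟨D.flip_mem_tower hp.1 (f.dom_subset (hd p hp)), fun h => h.2 (hd p hp)⟩
  · have hn := D.norm_of_mem hp.1.1.2
    rw [vDefect, vDefect, D.cell_of_mem_dom hn (hd p hp),
      D.cell_of_mem_dom (p := flipGerm p) (by simpa [flipGerm]) (hd p hp), defect_flip, map_neg]
    rfl

/-- As `u` is one isometry on all of `Δ`, the cancellation covers interior sides as well, and only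
the sides on `∂Δ` survive. -/
theorem setIntegral_uDefect_tower (ψ : ℝ →+ ℝ) :
    ∫ p in D.tower, ψ (D.uDefect p) ∂μH[1] = ∫ p in D.outerSides, ψ (D.uDefect p) ∂μH[1] := by
  have hint := D.integrableOn_uDefect ψ D.tower_subset_germs D.measurableSet_tower
    D.measure_tower_lt_top D.finite_normals_tower
  rw [← integral_inter_add_sdiff D.measurableSet_outerSides hint,
    setIntegral_congr_set (D.tower_inter_ae fun p hp => hp.1)]
  have hd : ∀ p ∈ D.tower \ D.outerSides, p.1 ∈ Δ := fun p hp => by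
    by_contra h
    exact hp.2 ⟨⟨hp.1.1.2, fun h' => h (f.dom_subset h')⟩,
      (D.mem_or_mem_frontier hp.1.1.2).resolve_left h⟩
  rw [setIntegral_eq_zero_of_involutive measurePreserving_flip flipGerm_flipGerm (fun p hp => ?_)
    (D.measurableSet_tower.diff D.measurableSet_outerSides) (fun p hp => ?_), add_zero]
  · exact ⟨D.flip_mem_tower hp.1 (hd p hp), fun h => D.notMem_frontier (hd p hp) h.2⟩
  · rw [uDefect, uDefect, defect_flip, map_neg]

/-- Periodicity enters here. The function `ψ (uDefect (vHat p)) - ψ (vDefect p)` is the increment of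
`ψ (coord p)` under `fHat`, so it sums to zero over a period and has integral zero over the tower.
There `vHat` can be removed by a change of variables. -/
theorem setIntegral_uDefect_eq (ψ : ℝ →+ ℝ) :
    ∫ p in D.outerSides, ψ (D.uDefect p) ∂μH[1] = ∫ p in D.sides, ψ (D.vDefect p) ∂μH[1] := by
  rw [← D.setIntegral_vDefect_tower, ← D.setIntegral_uDefect_tower]
  have hint := D.integrableOn_vDefect ψ D.tower_subset_germs D.measurableSet_tower
    D.measure_tower_lt_top D.finite_normals_tower
  have hint' := D.integrableOn_uDefect ψ D.tower_subset_germs D.measurableSet_tower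
    D.measure_tower_lt_top D.finite_normals_tower
  have hv := preimage_eq_of_involutive D.vHat_vHat fun p => D.vHat_mem_tower (p := p)
  have hu := preimage_eq_of_involutive D.uHat_uHat fun p => D.uHat_mem_tower (p := p)
  have hint2 : IntegrableOn (fun p => ψ (D.uDefect (D.vHat p))) D.tower μH[1] := by
    have := (D.measurePreserving_vHat.integrableOn_comp_preimage
      (measurableEmbedding_of_involutive D.measurable_vHat D.vHat_vHat)).2 hint'
    rwa [hv] at this
  have hzero : ∫ p in D.tower, (ψ (D.uDefect (D.vHat p)) - ψ (D.vDefect p)) ∂μH[1] = 0 := by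
    refine setIntegral_eq_zero_of_sum_iterate D.measurePreserving_fHat D.measurableEmbedding_fHat
      D.measurableSet_tower ?_ D.period_pos (hint2.sub hint) fun p hp => ?_
    · change D.vHat ⁻¹' (D.uHat ⁻¹' D.tower) = D.tower
      rw [hu, hv]
    · have h1 : ∀ k, ψ (D.uDefect (D.vHat (D.fHat^[k] p))) - ψ (D.vDefect (D.fHat^[k] p)) =
          ψ (coord (D.fHat^[k + 1] p)) - ψ (coord (D.fHat^[k] p)) := fun k => by
        rw [← map_sub, ← map_sub, Function.iterate_succ_apply']
        congr 1
        conv_rhs => rw [fHat, coord_uHat, D.coord_vHat (D.fHat_iterate_mem hp.1 k).2]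
        ring
      rw [Finset.sum_congr rfl fun k _ => h1 k,
        Finset.sum_range_sub (fun k => ψ (coord (D.fHat^[k] p))), (D.isPeriodicPt hp.1).eq]
      simp
  rw [integral_sub hint2 hint, setIntegral_comp_involutive D.measurePreserving_vHat D.vHat_vHat
    (fun p => D.vHat_mem_tower) (fun p => ψ (D.uDefect p))] at hzero
  linarith

end NousData

/-! ### The mean displacement of the return map. -/

theorem integrableOn_comp_of_involutive {X : Type*} [MeasurableSpace X] {μ : Measure X} {T : X → X}
    (hT : MeasurePreserving T μ μ) (hinv : ∀ p, T (T p) = p) {A B : Set X} (hAB : T ⁻¹' B = A)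
    {g : X → ℝ} (hg : IntegrableOn g B μ) :
    IntegrableOn (fun p => g (T p)) A μ ∧ ∫ p in A, g (T p) ∂μ = ∫ p in B, g p ∂μ := by
  subst hAB
  exact ⟨(hT.integrableOn_comp_preimage
    (measurableEmbedding_of_involutive hT.measurable hinv)).2 hg,
    setIntegral_preimage_of_involutive hT hinv B g⟩

namespace NousData

variable {Δ : Set ℂ} {f : PiecewiseRotation Δ} {u v : ℂ → ℂ} (D : NousData f u v)
include D

theorem measurableSet_tame : MeasurableSet D.tame :=
  (D.measurableSet_saturation D.measurableSet_sides).diff D.countable_exceptional.measurableSet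

theorem countable_sides_diff_tame : (D.sides \ D.tame).Countable :=
  D.countable_exceptional.mono fun p hp => by
    by_contra h
    exact hp.2 ⟨D.subset_saturation _ hp.1, h⟩

theorem inter_tame_ae {A : Set (ℂ × ℂ)} (hA : A ⊆ D.sides) :
    (A ∩ D.tame : Set (ℂ × ℂ)) =ᵐ[μH[1]] A := by
  have : (A ∩ D.tame : Set (ℂ × ℂ)) = A \ (A \ D.tame) := by
    rw [sdiff_sdiff_right_self]
  rw [this]
  refine sdiff_null_ae_eq_self ?_
  have : NullSingletonClass (μH[1] : Measure (ℂ × ℂ)) :=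
    nullSingletonClass_hausdorff _ zero_lt_one
  exact (D.countable_sides_diff_tame.mono (sdiff_subset_sdiff_left hA)).measure_zero _

/-- Outer germs split into `A₁`, preserved by `vHat`, and `A₂`, exchanged by `vHat` with the
interior sides `I`, on which `flipGerm` acts. The displacement is `uDefect - vDefect` on `A₁` and
has a second `vDefect`, taken on `I`, on `A₂`. After changes of variables the total is `∫ uDefect`
over `A₁ ∪ A₂` minus `∫ vDefect` over `A₁ ∪ A₂ ∪ I`, each under `ψ`. -/
theorem setIntegral_coord_rHat (ψ : ℝ →+ ℝ) :
    IntegrableOn (fun p => ψ (coord (D.rHat p) - coord p)) D.outerSides μH[1] ∧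
      ∫ p in D.outerSides, ψ (coord (D.rHat p) - coord p) ∂μH[1] = 0 := by
  set V : Set (ℂ × ℂ) := {p | p.1 ∈ Δ} with hV
  have hVm : MeasurableSet V := measurable_fst D.isOpen.measurableSet
  set A : Set (ℂ × ℂ) := D.outerSides ∩ D.tame with hA
  set I : Set (ℂ × ℂ) := (D.sides ∩ D.tame) ∩ V with hI
  set A₂ : Set (ℂ × ℂ) := A ∩ D.vHat ⁻¹' V with hA₂
  set A₁ : Set (ℂ × ℂ) := A \ D.vHat ⁻¹' V with hA₁
  have hAm : MeasurableSet A := D.measurableSet_outerSides.inter D.measurableSet_tame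
  have hVm' := D.measurable_vHat hVm
  have hIs : I ⊆ D.sides := fun p hp => hp.1.1
  have hAs : A ⊆ D.sides := fun p hp => hp.1.1
  have hIm : MeasurableSet I := (D.measurableSet_sides.inter D.measurableSet_tame).inter hVm
  have hA₁A₁ : D.vHat ⁻¹' A₁ = A₁ := preimage_eq_of_involutive D.vHat_vHat fun p hp => by
    refine ⟨⟨D.vHat_mem_outerSides_of_notMem hp.1.1.1 hp.2, D.vHat_mem_tame hp.1.2⟩, ?_⟩
    rw [mem_preimage, D.vHat_vHat]
    exact D.notMem_of_mem_frontier hp.1.1.2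
  have hIA₂ : ∀ p ∈ I, D.vHat p ∈ A₂ := fun p hp => by
    refine ⟨⟨D.vHat_mem_outerSides hp.1.1 hp.2, D.vHat_mem_tame hp.1.2⟩, ?_⟩
    rw [mem_preimage, D.vHat_vHat]
    exact hp.2
  have hA₂I : ∀ p ∈ A₂, D.vHat p ∈ I := fun p hp =>
    ⟨⟨D.vHat_mem_sides hp.1.1.1, D.vHat_mem_tame hp.1.2⟩, hp.2⟩
  have hpI : D.vHat ⁻¹' I = A₂ := Subset.antisymm
    (fun p hp => by rw [← D.vHat_vHat p]; exact hIA₂ _ hp) hA₂I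
  have hpA₂ : D.vHat ⁻¹' A₂ = I := by rw [← hpI]; ext p; simp [D.vHat_vHat]
  have hσ : flipGerm ⁻¹' I = I := preimage_eq_of_involutive flipGerm_flipGerm fun p hp =>
    ⟨⟨D.flip_mem_sides hp.1.1 (D.tame_subset_neat hp.1.2).1 hp.2, D.flip_mem_tame hp.1.2⟩, hp.2⟩
  have hdv : ∀ B ⊆ D.sides, MeasurableSet B →
      IntegrableOn (fun p => ψ (D.vDefect p)) B μH[1] := fun B hB hBm =>
    D.integrableOn_vDefect ψ (fun p hp => (hB hp).1) hBm
      ((measure_mono hB).trans_lt D.measure_sides_lt_top)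
      (D.finite_normals.subset (image_mono hB))
  have hdu : ∀ B ⊆ D.sides, MeasurableSet B →
      IntegrableOn (fun p => ψ (D.uDefect p)) B μH[1] := fun B hB hBm =>
    D.integrableOn_uDefect ψ (fun p hp => (hB hp).1) hBm
      ((measure_mono hB).trans_lt D.measure_sides_lt_top)
      (D.finite_normals.subset (image_mono hB))
  have hA₁m : MeasurableSet A₁ := hAm.diff hVm'
  have hA₂m : MeasurableSet A₂ := hAm.inter hVm'
  have hA₁s : A₁ ⊆ D.sides := sdiff_subset.trans hAs
  have hA₂s : A₂ ⊆ D.sides := inter_subset_left.trans hAs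
  have hmv := D.measurePreserving_vHat
  -- the integral over `A₁`
  obtain ⟨i1, e1⟩ := integrableOn_comp_of_involutive hmv D.vHat_vHat hA₁A₁ (hdu A₁ hA₁s hA₁m)
  have c1 : ∀ p ∈ A₁, ψ (coord (D.rHat p) - coord p) =
      ψ (D.uDefect (D.vHat p)) - ψ (D.vDefect p) := fun p hp => by
    have h2 : (D.vHat p).1 ∉ Δ := hp.2
    rw [← map_sub, rHat, if_neg h2, coord_uHat, D.coord_vHat hp.1.1.1.1]
    congr 1; ring
  -- the integral over `A₂`
  obtain ⟨i2, e2⟩ := integrableOn_comp_of_involutive hmv D.vHat_vHat hpA₂ (hdu A₂ hA₂s hA₂m)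
  obtain ⟨i3, e3⟩ := integrableOn_comp_of_involutive measurePreserving_flip flipGerm_flipGerm hσ i2
  obtain ⟨i4, e4⟩ := integrableOn_comp_of_involutive hmv D.vHat_vHat hpI i3
  obtain ⟨i5, e5⟩ := integrableOn_comp_of_involutive measurePreserving_flip flipGerm_flipGerm hσ
    (hdv I hIs hIm)
  obtain ⟨i6, e6⟩ := integrableOn_comp_of_involutive hmv D.vHat_vHat hpI i5
  have c2 : ∀ p ∈ A₂, ψ (coord (D.rHat p) - coord p) =
      ψ (D.uDefect (D.vHat (flipGerm (D.vHat p)))) - ψ (D.vDefect (flipGerm (D.vHat p))) -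
        ψ (D.vDefect p) := fun p hp => by
    have hq : flipGerm (D.vHat p) ∈ I := by
      have := hA₂I p hp; rw [← hσ] at this; exact this
    have h2 : (D.vHat p).1 ∈ Δ := hp.2
    rw [← map_sub, ← map_sub, rHat, if_pos h2, coord_uHat, D.coord_vHat hq.1.1.1, coord_flip,
      D.coord_vHat hp.1.1.1.1]
    congr 1; ring
  have i7 : IntegrableOn (fun p => ψ (D.uDefect (D.vHat (flipGerm (D.vHat p)))) -
      ψ (D.vDefect (flipGerm (D.vHat p)))) A₂ μH[1] := i4.sub i6
  have j1 := (i1.sub (hdv A₁ hA₁s hA₁m)).congr_fun (fun p hp => (c1 p hp).symm) hA₁m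
  have j2 := (i7.sub (hdv A₂ hA₂s hA₂m)).congr_fun (fun p hp => (c2 p hp).symm) hA₂m
  have k1 : ∫ p in A₁, ψ (coord (D.rHat p) - coord p) ∂μH[1] =
      ∫ p in A₁, ψ (D.uDefect p) ∂μH[1] - ∫ p in A₁, ψ (D.vDefect p) ∂μH[1] := by
    rw [setIntegral_congr_fun hA₁m c1, integral_sub i1 (hdv A₁ hA₁s hA₁m), e1]
  have k2 : ∫ p in A₂, ψ (coord (D.rHat p) - coord p) ∂μH[1] =
      ∫ p in A₂, ψ (D.uDefect p) ∂μH[1] - ∫ p in I, ψ (D.vDefect p) ∂μH[1] -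
        ∫ p in A₂, ψ (D.vDefect p) ∂μH[1] := by
    rw [setIntegral_congr_fun hA₂m c2, integral_sub i7 (hdv A₂ hA₂s hA₂m),
      integral_sub i4 i6, e6, e5, e4, e3, e2]
  have hAe : A₂ ∪ A₁ = A := inter_union_sdiff _ _
  have j3 : IntegrableOn (fun p => ψ (coord (D.rHat p) - coord p)) A μH[1] := by
    rw [← hAe]; exact j2.union j1
  have hAae : (A : Set (ℂ × ℂ)) =ᵐ[μH[1]] D.outerSides := D.inter_tame_ae fun p hp => hp.1
  have hSae : (D.sides ∩ D.tame : Set (ℂ × ℂ)) =ᵐ[μH[1]] D.sides := D.inter_tame_ae subset_rfl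
  refine ⟨j3.congr_set_ae hAae.symm, ?_⟩
  have hfin := D.setIntegral_uDefect_eq ψ
  rw [← setIntegral_congr_set hAae, ← setIntegral_congr_set hSae] at hfin
  rw [← setIntegral_congr_set hAae, ← integral_inter_add_sdiff hVm' j3, k1, k2]
  rw [← integral_inter_add_sdiff hVm' (hdu A hAs hAm)] at hfin
  -- A side germ not based in `Δ` is outer, so the tame sides are the disjoint union of `I` and `A`.
  have hSA : (D.sides ∩ D.tame) \ V = A := by
    ext p
    constructor
    · rintro ⟨⟨h1, h2⟩, h3⟩
      exact ⟨⟨h1, (D.mem_or_mem_frontier h1.1).resolve_left h3⟩, h2⟩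
    · rintro ⟨h1, h2⟩
      exact ⟨⟨h1.1, h2⟩, D.notMem_of_mem_frontier h1.2⟩
  rw [← integral_inter_add_sdiff hVm (hdv (D.sides ∩ D.tame) inter_subset_left
    (D.measurableSet_sides.inter D.measurableSet_tame)), hSA,
    ← integral_inter_add_sdiff hVm' (hdv A hAs hAm)] at hfin
  change _ + _ = _ + (_ + _) at hfin
  linarith

end NousData

/-! ### Subdivisions of an interval -/

section Subdivision

variable {n : ℕ} {x : Fin (n + 1) → ℝ}

/-- The `k`-th open interval of a subdivision. -/
def piece (x : Fin (n + 1) → ℝ) (k : Fin n) : Set ℝ := Ioo (x k.castSucc) (x k.succ)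

theorem piece_subset (hx : StrictMono x) (k : Fin n) : piece x k ⊆ Ioo (x 0) (x (Fin.last n)) :=
  Ioo_subset_Ioo (hx.monotone (Fin.zero_le _)) (hx.monotone (Fin.le_last _))

theorem piece_nonempty (hx : StrictMono x) (k : Fin n) : (piece x k).Nonempty :=
  nonempty_Ioo.2 (hx k.castSucc_lt_succ)

theorem eq_of_mem_piece (hx : StrictMono x) {k l : Fin n} {y : ℝ} (hk : y ∈ piece x k)
    (hl : y ∈ piece x l) : k = l := by
  by_contra hne
  rcases lt_or_gt_of_ne hne with h | h
  · have : x k.succ ≤ x l.castSucc := hx.monotone (by simpa [Fin.le_def] using h)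
    exact absurd (hl.1.trans hk.2) (not_lt.2 this)
  · have : x l.succ ≤ x k.castSucc := hx.monotone (by simpa [Fin.le_def] using h)
    exact absurd (hk.1.trans hl.2) (not_lt.2 this)

theorem pairwise_disjoint_piece (hx : StrictMono x) :
    Pairwise (Function.onFun Disjoint (piece x)) := fun _ _ hne =>
  disjoint_left.2 fun _ hk hl => hne (eq_of_mem_piece hx hk hl)

theorem exists_mem_piece {y : ℝ} (hy : y ∈ Ioo (x 0) (x (Fin.last n))) (hr : y ∉ range x) :
    ∃ k, y ∈ piece x k := by
  by_contra hcon
  push Not at hcon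
  have : ∀ k, x k < y := by
    intro k
    induction k using Fin.induction with
    | zero => exact hy.1
    | succ k ih =>
      have h1 : ¬ y < x k.succ := fun h => hcon k ⟨ih, h⟩
      exact lt_of_le_of_ne (not_lt.1 h1) fun h => hr ⟨_, h⟩
  exact absurd (this (Fin.last n)) (not_lt.2 hy.2.le)

theorem iUnion_piece_subset (hx : StrictMono x) :
    ⋃ k, piece x k ⊆ Ioo (x 0) (x (Fin.last n)) := iUnion_subset fun k => piece_subset hx k

theorem iUnion_piece_ae (hx : StrictMono x) :
    (⋃ k, piece x k : Set ℝ) =ᵐ[volume] Ioo (x 0) (x (Fin.last n)) := by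
  have h1 : (⋃ k, piece x k : Set ℝ) = Ioo (x 0) (x (Fin.last n)) \
      (Ioo (x 0) (x (Fin.last n)) \ ⋃ k, piece x k) := by
    rw [sdiff_sdiff_right_self]
    exact (inter_eq_right.2 (iUnion_piece_subset hx)).symm
  rw [h1]
  refine sdiff_null_ae_eq_self ?_
  refine (Finite.subset (finite_range x) fun y hy => ?_).measure_zero _
  by_contra hr
  exact hy.2 (mem_iUnion.2 (exists_mem_piece hy.1 hr))

theorem measurableSet_piece (k : Fin n) : MeasurableSet (piece x k) := measurableSet_Ioo

end Subdivision

theorem exists_subdivision {L : ℝ} (hL : 0 < L) {S : Set ℝ} (hS : S.Finite) :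
    ∃ (n : ℕ) (x : Fin (n + 1) → ℝ), StrictMono x ∧ x 0 = 0 ∧ x (Fin.last n) = L ∧
      ∀ k, piece x k ⊆ Ioo 0 L \ S := by
  classical
  -- The division points are `0`, `L` and the points of `S` in between, listed in increasing order.
  have hfin : (insert 0 (insert L (S ∩ Icc 0 L))).Finite := ((hS.inter_of_left _).insert _).insert _
  set F := hfin.toFinset with hF
  have hmem : ∀ y, y ∈ F ↔ y = 0 ∨ y = L ∨ (y ∈ S ∧ y ∈ Icc 0 L) := fun y => by
    simp [hF]
  have h0 : (0 : ℝ) ∈ F := (hmem 0).2 (Or.inl rfl)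
  have hLF : L ∈ F := (hmem L).2 (Or.inr (Or.inl rfl))
  have hne : F.Nonempty := ⟨0, h0⟩
  obtain ⟨n, hn⟩ : ∃ n, F.card = n + 1 := ⟨F.card - 1, by have := hne.card_pos; omega⟩
  have hle : ∀ y ∈ F, 0 ≤ y ∧ y ≤ L := by
    intro y hy
    rcases (hmem y).1 hy with rfl | rfl | h
    · exact ⟨le_rfl, hL.le⟩
    · exact ⟨hL.le, le_rfl⟩
    · exact h.2
  set x := F.orderEmbOfFin hn with hx
  have hmono : StrictMono x := x.strictMono
  have hmemF : ∀ k, x k ∈ F := fun k => F.orderEmbOfFin_mem hn k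
  have hsurj : ∀ y ∈ F, ∃ k, x k = y := fun y hy => by
    have : y ∈ range x := by rw [hx, Finset.range_orderEmbOfFin]; exact hy
    exact this
  have hx0 : x 0 = 0 := by
    obtain ⟨k, hk⟩ := hsurj 0 h0
    exact le_antisymm (by rw [← hk]; exact hmono.monotone (Fin.zero_le k)) (hle _ (hmemF 0)).1
  have hxL : x (Fin.last n) = L := by
    obtain ⟨k, hk⟩ := hsurj L hLF
    exact le_antisymm (hle _ (hmemF _)).2 (by rw [← hk]; exact hmono.monotone (Fin.le_last k))
  refine ⟨n, x, hmono, hx0, hxL, fun k y hy => ?_⟩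
  have h1 := piece_subset hmono k hy
  rw [hx0, hxL] at h1
  refine ⟨h1, fun hyS => ?_⟩
  obtain ⟨j, rfl⟩ := hsurj y ((hmem y).2 (Or.inr (Or.inr ⟨hyS, h1.1.le, h1.2.le⟩)))
  have h2 := hmono.lt_iff_lt.1 hy.1
  have h3 := hmono.lt_iff_lt.1 hy.2
  rw [Fin.lt_def] at h2 h3
  simp at h2 h3
  omega

/-- A function that is locally constant off a finite set is piecewise constant. -/
theorem exists_subdivision_const {Y : Type*} {L : ℝ} (hL : 0 < L) {S : Set ℝ} (hS : S.Finite)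
    {φ : ℝ → Y} (hφ : ∀ y ∈ Ioo 0 L \ S, ∀ᶠ t in nhds y, φ t = φ y) :
    ∃ (n : ℕ) (x : Fin (n + 1) → ℝ) (c : Fin n → Y), StrictMono x ∧ x 0 = 0 ∧ x (Fin.last n) = L ∧
      (∀ k, piece x k ⊆ Ioo 0 L \ S) ∧ ∀ k, ∀ y ∈ piece x k, φ y = c k := by
  obtain ⟨n, x, hx, hx0, hxL, hp⟩ := exists_subdivision hL hS
  choose m hm using fun k => piece_nonempty hx k
  refine ⟨n, x, fun k => φ (m k), hx, hx0, hxL, hp, fun k y hy => ?_⟩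
  refine isPreconnected_Ioo.induction₂' (fun a b => φ a = φ b) (fun a ha => ?_)
    (fun _ _ _ _ _ _ h h' => h.trans h') hy (hm k)
  filter_upwards [mem_nhdsWithin_of_mem_nhds (hφ a (hp k ha))] with t ht
  exact ⟨ht.symm, ht⟩

/-- Change of variables for a map that is injective and piecewise measure preserving. -/
theorem setIntegral_comp_piecewise {X Y ι : Type*} [MeasurableSpace X] [MeasurableSpace Y]
    [Fintype ι] {μ : Measure X} {ν : Measure Y} {P : ι → Set X} (hP : ∀ i, MeasurableSet (P i))
    (hd : Pairwise (Function.onFun Disjoint P)) {h : ι → X → Y}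
    (he : ∀ i, MeasurableEmbedding (h i)) (hm : ∀ i, map (h i) μ = ν.restrict (range (h i)))
    {g : X → Y} (hg : ∀ i, ∀ x ∈ P i, g x = h i x) (hinj : InjOn g (⋃ i, P i)) {φ : Y → ℝ}
    (hφ : IntegrableOn φ (g '' ⋃ i, P i) ν) :
    IntegrableOn (fun x => φ (g x)) (⋃ i, P i) μ ∧
      ∫ x in ⋃ i, P i, φ (g x) ∂μ = ∫ y in g '' ⋃ i, P i, φ y ∂ν := by
  have himg : ∀ i, g '' P i = h i '' P i := fun i => image_congr (hg i)
  have hsub : ∀ i, g '' P i ⊆ g '' ⋃ i, P i := fun i => image_mono (subset_iUnion P i)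
  have hφi : ∀ i, IntegrableOn φ (g '' P i) ν := fun i => hφ.mono_set (hsub i)
  have hres : ∀ i, (map (h i) μ).restrict (h i '' P i) = ν.restrict (h i '' P i) := fun i => by
    rw [hm, restrict_restrict_of_subset (image_subset_range _ _)]
  have h1 : ∀ i, IntegrableOn (fun x => φ (h i x)) (P i) μ := fun i => by
    have := hφi i
    rw [himg, IntegrableOn, ← hres i] at this
    have h2 := (he i).integrableOn_map_iff.1 this
    rwa [(he i).injective.preimage_image] at h2
  have h2 : ∀ i, ∫ x in P i, φ (h i x) ∂μ = ∫ y in g '' P i, φ y ∂ν := fun i => by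
    rw [himg, ← hres i, (he i).setIntegral_map, (he i).injective.preimage_image]
  have h3 : ∀ i, IntegrableOn (fun x => φ (g x)) (P i) μ := fun i =>
    (h1 i).congr_fun (fun x hx => by simp only [hg i x hx]) (hP i)
  refine ⟨integrableOn_finite_iUnion.2 h3, ?_⟩
  rw [integral_iUnion_fintype hP hd h3, image_iUnion, integral_iUnion_fintype
    (fun i => by rw [himg]; exact (he i).measurableSet_image.2 (hP i)) ?_ hφi]
  · refine Finset.sum_congr rfl fun i _ => ?_
    rw [← h2]
    exact setIntegral_congr_fun (hP i) fun x hx => by simp only [hg i x hx]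
  · intro i j hij
    refine disjoint_left.2 ?_
    rintro _ ⟨a, ha, rfl⟩ ⟨b, hb, hab⟩
    have := hinj (mem_iUnion.2 ⟨j, hb⟩) (mem_iUnion.2 ⟨i, ha⟩) hab
    subst this
    exact disjoint_left.1 (hd hij) ha hb

theorem map_shift_volume {p : ℂ × ℂ} (hp : ‖p.2‖ = 1) :
    map (fun t : ℝ => shift t p) volume =
      (μH[1] : Measure (ℂ × ℂ)).restrict (range fun t : ℝ => shift t p) := by
  rw [← hausdorffMeasure_real, (isometry_shift hp).map_hausdorffMeasure (Or.inl zero_le_one)]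

theorem measurableEmbedding_shift {p : ℂ × ℂ} (hp : ‖p.2‖ = 1) :
    MeasurableEmbedding fun t : ℝ => shift t p :=
  (isometry_shift hp).isClosedEmbedding.measurableEmbedding

/-! ### Interval exchanges preserve length; the invariant tested by additive functionals. -/

namespace IntervalExchange

variable {L : ℝ} (E : IntervalExchange L)

open Classical in
/-- The map defined by an interval exchange off its division points. -/
noncomputable def toFun (y : ℝ) : ℝ := if h : ∃ k, y ∈ piece E.x k then y + E.t h.choose else y

theorem toFun_eq {k : Fin E.n} {y : ℝ} (hy : y ∈ piece E.x k) : E.toFun y = y + E.t k := by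
  have h : ∃ k, y ∈ piece E.x k := ⟨k, hy⟩
  rw [toFun, dif_pos h, eq_of_mem_piece E.strictMono h.choose_spec hy]

theorem toFun_injOn : InjOn E.toFun (⋃ k, piece E.x k) := by
  intro y hy z hz h
  obtain ⟨k, hk⟩ := mem_iUnion.1 hy
  obtain ⟨l, hl⟩ := mem_iUnion.1 hz
  rw [E.toFun_eq hk, E.toFun_eq hl] at h
  exact E.inj k l y hk z hl h

theorem toFun_image_subset : E.toFun '' ⋃ k, piece E.x k ⊆ Icc 0 L := by
  rintro _ ⟨y, hy, rfl⟩
  obtain ⟨k, hk⟩ := mem_iUnion.1 hy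
  rw [E.toFun_eq hk]
  exact E.image_subset k y hk

theorem setIntegral_comp_toFun_image {φ : ℝ → ℝ}
    (hφ : IntegrableOn φ (E.toFun '' ⋃ k, piece E.x k)) :
    IntegrableOn (fun y => φ (E.toFun y)) (⋃ k, piece E.x k) ∧
      ∫ y in ⋃ k, piece E.x k, φ (E.toFun y) = ∫ y in E.toFun '' ⋃ k, piece E.x k, φ y := by
  refine setIntegral_comp_piecewise (h := fun k y => y + E.t k) (fun k => measurableSet_piece k)
    (pairwise_disjoint_piece E.strictMono) (fun k => measurableEmbedding_addRight _)
    (fun k => ?_) (fun k y hy => E.toFun_eq hy) E.toFun_injOn hφ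
  rw [map_add_right_eq_self, (add_right_surjective (E.t k)).range_eq, restrict_univ]

theorem iUnion_piece_ae : (⋃ k, piece E.x k : Set ℝ) =ᵐ[volume] Ioo 0 L := by
  have := _root_.iUnion_piece_ae E.strictMono
  rwa [E.x_zero, E.x_last] at this

/-- Surjectivity is not part of the structure. It holds up to a null set, since an injective
piecewise translation has an image of measure `L` inside `[0, L]`. -/
theorem toFun_image_ae : (E.toFun '' ⋃ k, piece E.x k : Set ℝ) =ᵐ[volume] Ioo 0 L := by
  refine Filter.EventuallyEq.trans ?_ Ioo_ae_eq_Icc.symm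
  have hc : volume (Icc 0 L) ≠ ⊤ := by simp
  have hne : volume (E.toFun '' ⋃ k, piece E.x k) ≠ ⊤ := measure_ne_top_of_subset
    E.toFun_image_subset hc
  have h1 := (E.setIntegral_comp_toFun_image (φ := fun _ => 1) (integrableOn_const hne)).2
  simp only [integral_const, smul_eq_mul, mul_one, measureReal_restrict_apply_univ] at h1
  rw [measureReal_congr E.iUnion_piece_ae, measureReal_congr Ioo_ae_eq_Icc] at h1
  refine ae_eq_of_subset_of_measure_ge E.toFun_image_subset ?_ ?_ hc
  · exact ((measureReal_eq_measureReal_iff hc hne).1 h1).le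
  · refine MeasurableSet.nullMeasurableSet ?_
    rw [image_iUnion]
    refine MeasurableSet.iUnion fun k => ?_
    rw [image_congr fun y hy => E.toFun_eq (k := k) hy]
    exact (measurableEmbedding_addRight (E.t k)).measurableSet_image.2 (measurableSet_piece k)

/-- Interval exchanges preserve Lebesgue measure. -/
theorem setIntegral_comp_toFun {φ : ℝ → ℝ} (hφ : IntegrableOn φ (Ioo 0 L)) :
    IntegrableOn (fun y => φ (E.toFun y)) (Ioo 0 L) ∧
      ∫ y in Ioo 0 L, φ (E.toFun y) = ∫ y in Ioo 0 L, φ y := by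
  obtain ⟨h1, h2⟩ := E.setIntegral_comp_toFun_image (hφ.congr_set_ae E.toFun_image_ae)
  refine ⟨h1.congr_set_ae E.iUnion_piece_ae.symm, ?_⟩
  rw [← setIntegral_congr_set E.iUnion_piece_ae, h2, setIntegral_congr_set E.toFun_image_ae]

theorem setIntegral_translation (ψ : ℝ → ℝ) :
    ∫ y in Ioo 0 L, ψ (E.toFun y - y) =
      ∑ k, (E.x k.succ - E.x k.castSucc) * ψ (E.t k) := by
  have hc : ∀ k, ∀ y ∈ piece E.x k, ψ (E.toFun y - y) = ψ (E.t k) := fun k y hy => by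
    rw [E.toFun_eq hy, add_sub_cancel_left]
  have hfin : ∀ k, volume (piece E.x k) ≠ ⊤ := fun k => by simp [piece]
  rw [← setIntegral_congr_set E.iUnion_piece_ae, integral_iUnion_fintype
    (fun k => measurableSet_piece k) (pairwise_disjoint_piece E.strictMono) fun k =>
      (integrableOn_const (C := ψ (E.t k)) (hfin k)).congr_fun (fun y hy => (hc k y hy).symm)
        (measurableSet_piece k)]
  refine Finset.sum_congr rfl fun k _ => ?_
  rw [setIntegral_congr_fun (measurableSet_piece k) (hc k)]
  simp only [integral_const, smul_eq_mul, measureReal_restrict_apply_univ, piece]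
  rw [Real.volume_real_Ioo_of_le (E.strictMono k.castSucc_lt_succ).le]

/-- The invariant vanishes if all its images under additive functionals do. -/
theorem saf_eq_zero (h : ∀ ψ : ℝ →+ ℝ,
    ∑ k, (E.x k.succ - E.x k.castSucc) * ψ (E.t k) = 0) : E.saf = 0 := by
  -- With respect to a `ℚ`-basis of the second factor, the `i`-th coefficient of the tensor is `∑
  -- λ_k * b_i(t_k)`, and the coordinate `b_i`, viewed in `ℝ`, is additive.
  let b := Module.Basis.ofVectorSpace ℚ ℝ
  apply (TensorProduct.equivFinsuppOfBasisRight (M := ℝ) b).injective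
  rw [map_zero, saf, _root_.map_sum]
  ext i
  rw [Finsupp.finsetSum_apply, Finsupp.zero_apply]
  let ψ : ℝ →+ ℝ := (algebraMap ℚ ℝ).toAddMonoidHom.comp (b.coord i).toAddMonoidHom
  rw [← h ψ]
  refine Finset.sum_congr rfl fun k _ => ?_
  rw [TensorProduct.equivFinsuppOfBasisRight_apply_tmul_apply, Rat.smul_def, mul_comm]
  rfl

end IntervalExchange

/-! ### Unit speed parametrizations of sets of germs. -/

/-- `g` parametrizes the set of germs `X`, up to finitely many points, by an interval of length `L`
from which a finite set is removed, moving along the directed lines with unit speed. -/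
structure IsGermParam (X : Set (ℂ × ℂ)) (L : ℝ) (S : Set ℝ) (g : ℝ → ℂ × ℂ) : Prop where
  finite : S.Finite
  norm : ∀ x ∈ Ioo 0 L \ S, ‖(g x).2‖ = 1
  injOn : InjOn g (Ioo 0 L \ S)
  image_subset : g '' (Ioo 0 L \ S) ⊆ X
  finite_diff : (X \ g '' (Ioo 0 L \ S)).Finite
  shift : ∀ x ∈ Ioo 0 L \ S, ∀ᶠ t in nhds (0 : ℝ), g (x + t) = shift t (g x)

theorem eventually_nhds_iff_add {P : ℝ → Prop} {x : ℝ} :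
    (∀ᶠ y in nhds x, P y) ↔ ∀ᶠ t in nhds (0 : ℝ), P (x + t) := by
  have := (Homeomorph.addLeft x).map_nhds_eq 0
  simp only [Homeomorph.coe_addLeft, add_zero] at this
  rw [← this, Filter.eventually_map]

theorem eventually_mem_Ioo_diff {L : ℝ} {S : Set ℝ} (hS : S.Finite) {x : ℝ}
    (hx : x ∈ Ioo 0 L \ S) : ∀ᶠ t in nhds (0 : ℝ), x + t ∈ Ioo 0 L \ S :=
  eventually_nhds_iff_add.1 ((isOpen_Ioo.sdiff hS.isClosed).eventually_mem hx)

theorem exists_abs_lt_of_eventually {P : ℝ → Prop} (h : ∀ᶠ t in nhds (0 : ℝ), P t) :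
    ∃ ε : ℝ, 0 < ε ∧ ∀ t : ℝ, |t| < ε → P t := by
  obtain ⟨ε, hε, h⟩ := Metric.eventually_nhds_iff.1 h
  exact ⟨ε, hε, fun t ht => h (by simpa using ht)⟩

namespace IsGermParam

variable {X : Set (ℂ × ℂ)} {L : ℝ} {S : Set ℝ} {g : ℝ → ℂ × ℂ} (hg : IsGermParam X L S g)
include hg

theorem exists_subdivision (hL : 0 < L) :
    ∃ (n : ℕ) (x : Fin (n + 1) → ℝ) (c : Fin n → ℂ × ℂ), StrictMono x ∧ x 0 = 0 ∧
      x (Fin.last n) = L ∧ (∀ k, piece x k ⊆ Ioo 0 L \ S) ∧ (∀ k, ‖(c k).2‖ = 1) ∧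
      ∀ k, ∀ y ∈ piece x k, g y = _root_.shift y (c k) := by
  -- Sliding `g y` back by `y` gives a locally constant germ, the origin of the parametrization on
  -- the current line.
  obtain ⟨n, x, c, hx, hx0, hxL, hp, hc⟩ := exists_subdivision_const hL hg.finite
    (φ := fun y => _root_.shift (-y) (g y)) fun y hy => by
      rw [eventually_nhds_iff_add]
      filter_upwards [hg.shift y hy] with t ht
      rw [ht, shift_shift]
      congr 1; ring
  have hc' : ∀ k, ∀ y ∈ piece x k, g y = _root_.shift y (c k) := fun k y hy => by
    rw [← hc k y hy, shift_shift, neg_add_cancel, shift_zero]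
  refine ⟨n, x, c, hx, hx0, hxL, hp, fun k => ?_, hc'⟩
  obtain ⟨y, hy⟩ := piece_nonempty hx k
  have := hg.norm y (hp k hy)
  rwa [hc' k y hy] at this

/-- Integrals over the interval are integrals with respect to the one-dimensional Hausdorff
measure. -/
theorem setIntegral_comp (hL : 0 < L) {φ : ℂ × ℂ → ℝ} (hφ : IntegrableOn φ X μH[1]) :
    IntegrableOn (fun y => φ (g y)) (Ioo 0 L) ∧
      ∫ y in Ioo 0 L, φ (g y) = ∫ p in X, φ p ∂μH[1] := by
  obtain ⟨n, x, c, hx, hx0, hxL, hp, hcn, hc⟩ := hg.exists_subdivision hL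
  have hae := iUnion_piece_ae hx
  rw [hx0, hxL] at hae
  have hsub : ⋃ k, piece x k ⊆ Ioo 0 L \ S := iUnion_subset hp
  have himg : (g '' ⋃ k, piece x k : Set (ℂ × ℂ)) =ᵐ[μH[1]] X := by
    have h1 : g '' ⋃ k, piece x k ⊆ X := (image_mono hsub).trans hg.image_subset
    have h2 : (X \ g '' ⋃ k, piece x k).Finite := by
      refine (hg.finite_diff.union ((finite_range x).image g)).subset ?_
      rintro p ⟨hpX, hpn⟩
      by_cases h : p ∈ g '' (Ioo 0 L \ S)
      · obtain ⟨y, hy, rfl⟩ := h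
        right
        by_contra hr
        refine hpn (mem_image_of_mem _ (mem_iUnion.2 (exists_mem_piece ?_ fun h => hr
          (mem_image_of_mem g h))))
        rw [hx0, hxL]
        exact hy.1
      · exact Or.inl ⟨hpX, h⟩
    have h3 : g '' ⋃ k, piece x k = X \ (X \ g '' ⋃ k, piece x k) := by
      rw [sdiff_sdiff_right_self]
      exact (inter_eq_right.2 h1).symm
    rw [h3]
    have : NullSingletonClass (μH[1] : Measure (ℂ × ℂ)) :=
      nullSingletonClass_hausdorff _ zero_lt_one
    exact sdiff_null_ae_eq_self (h2.measure_zero _)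
  obtain ⟨h1, h2⟩ := setIntegral_comp_piecewise (μ := volume) (ν := μH[1]) (g := g) (φ := φ)
    (h := fun k y => _root_.shift y (c k)) (fun k => measurableSet_piece (x := x) k)
    (pairwise_disjoint_piece hx)
    (fun k => measurableEmbedding_shift (hcn k)) (fun k => map_shift_volume (hcn k)) hc
    (hg.injOn.mono hsub) (hφ.congr_set_ae himg)
  refine ⟨h1.congr_set_ae hae.symm, ?_⟩
  rw [← setIntegral_congr_set hae, h2, setIntegral_congr_set himg]

/-- The difference between the coordinate on the line and the parameter is piecewise constant. It is
the transfer function relating displacements in the two coordinates. -/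
theorem integrableOn_coord_sub (hL : 0 < L) (ψ : ℝ → ℝ) :
    IntegrableOn (fun y => ψ (coord (g y) - y)) (Ioo 0 L) := by
  obtain ⟨n, x, c, hx, hx0, hxL, hp, hcn, hc⟩ := hg.exists_subdivision hL
  have hae := iUnion_piece_ae hx
  rw [hx0, hxL] at hae
  refine IntegrableOn.congr_set_ae (integrableOn_of_finite_cover (s := univ) (P := piece x) ?_
    finite_univ (fun k _ => measurableSet_piece k) (by simp) (fun k _ => ⟨ψ (coord (c k)), ?_⟩)
    (MeasurableSet.iUnion fun k => measurableSet_piece k)) hae.symm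
  · rw [measure_congr hae]; simp
  · rintro y ⟨hy, -⟩
    rw [hc k y hy, coord_shift (hcn k), add_sub_cancel_right]

end IsGermParam

/-! ### The return map as an interval exchange, and its invariant. -/

namespace NousData

variable {Δ : Set ℂ} {f : PiecewiseRotation Δ} {u v : ℂ → ℂ} (D : NousData f u v)
include D

/-- A point `z + s e + r i e` is the midpoint of `z + 2s e` in `closure Q` and `z + 2r i e` in the
open convex set `Q`; hence half the radius suffices. -/
theorem inward_of_segment {Q : Set ℂ} (hQ : Q ∈ components f.dom) {z e : ℂ} (he : ‖e‖ = 1) {ε : ℝ}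
    (hε : 0 < ε) (h1 : ∀ t : ℝ, |t| < ε → z + t * e ∈ closure Q)
    (h2 : ∀ r : ℝ, 0 < r → r < ε → z + r * (Complex.I * e) ∈ Q) : Inward Q (z, Complex.I * e) := by
  refine ⟨by simpa using he, ε / 2, half_pos hε, fun w hw => ?_⟩
  have hsq := sq_add_sq_of_norm he
  set r := inner ℝ (Complex.I * e) (w - z) with hr
  set s := inner ℝ e (w - z) with hs
  have hr0 : 0 < r := hw.2
  have hwz : ‖w - z‖ < ε / 2 := hw.1
  have hr1 : r < ε / 2 := by
    have := real_inner_le_norm (Complex.I * e) (w - z)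
    simp only [norm_mul, Complex.norm_I, he, one_mul] at this
    exact lt_of_le_of_lt this hwz
  have hs1 : |s| < ε / 2 := by
    have := abs_real_inner_le_norm e (w - z)
    rw [he, one_mul] at this
    exact lt_of_le_of_lt this hwz
  have e1 := h1 (2 * s) (by rw [abs_mul, abs_two]; linarith)
  have e2 := h2 (2 * r) (by linarith) (by linarith)
  rw [← (D.isOpen_component hQ).interior_eq] at e2
  have e3 := (D.convex_component hQ).combo_closure_interior_mem_interior e1 e2
    (a := 1 / 2) (b := 1 / 2) (by norm_num) (by norm_num) (by norm_num)
  rw [(D.isOpen_component hQ).interior_eq] at e3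
  convert e3 using 1
  simp only [inner_eq, Complex.mul_re, Complex.mul_im, Complex.I_re, Complex.I_im, Complex.sub_re,
    Complex.sub_im] at hr hs
  apply Complex.ext
  · simp
    rw [hr, hs]
    linear_combination (z.re - w.re) * hsq
  · simp
    rw [hr, hs]
    linear_combination (z.im - w.im) * hsq

/-- The component lies to the left of the velocity `e`, so the inner normal is `I * e`. Injectivity
of `toGraph` on sides turns the local straightness of `γ` into motion by `shift`. -/
theorem exists_germParam {L : ℝ} {γ : ℝ → ℂ × Set ℂ} (hγ : IsArcParam f.boundaryStar L γ) :
    ∃ (S : Set ℝ) (g : ℝ → ℂ × ℂ), IsGermParam D.outerSides L S g ∧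
      ∀ x ∈ Ioo 0 L \ S, D.toGraph (g x) = γ x := by
  obtain ⟨hL, S, hS, hinj, hsub, hfin, hloc⟩ := hγ
  choose! e he ε hε h1 h2 using hloc
  have key : ∀ x ∈ Ioo 0 L \ S, ((γ x).1, Complex.I * e x) ∈ D.outerSides ∧
      D.cell ((γ x).1, Complex.I * e x) = (γ x).2 := by
    intro x hx
    have hQ : (γ x).2 ∈ components f.dom := (hsub (mem_image_of_mem γ hx)).1.1
    have hz : (γ x).1 ∈ frontier (γ x).2 := (hsub (mem_image_of_mem γ hx)).1.2
    obtain ⟨δ, hδ, hδ'⟩ := exists_abs_lt_of_eventually (eventually_mem_Ioo_diff hS hx)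
    have hi : Inward (γ x).2 ((γ x).1, Complex.I * e x) := by
      refine D.inward_of_segment hQ (he x hx) (lt_min hδ (hε x hx)) (fun t ht => ?_)
        fun r hr hr' => h2 x hx r hr (hr'.trans_le (min_le_right _ _))
      have h3 := h1 x hx t (ht.trans_le (min_le_right _ _))
      have h4 := (hsub (mem_image_of_mem γ (hδ' t (ht.trans_le (min_le_left _ _))))).1.2
      rw [h3] at h4
      exact frontier_subset_closure h4
    obtain ⟨hg, hc⟩ := D.cell_eq hQ hi
    refine ⟨⟨⟨hg, fun hd => ?_⟩, (hsub (mem_image_of_mem γ hx)).2⟩, hc⟩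
    have h5 := D.mem_cell_of_mem_dom hg hd
    rw [hc] at h5
    rw [(D.isOpen_component hQ).frontier_eq] at hz
    exact hz.2 h5
  have hgr : ∀ x ∈ Ioo 0 L \ S, D.toGraph ((γ x).1, Complex.I * e x) = γ x := fun x hx =>
    Prod.ext rfl (key x hx).2
  refine ⟨S, fun x => ((γ x).1, Complex.I * e x), ⟨hS, fun x hx => by simpa using he x hx, ?_, ?_,
    ?_, ?_⟩, hgr⟩
  · intro x hx y hy hxy
    refine hinj hx hy ?_
    rw [← hgr x hx, ← hgr y hy]
    exact congrArg D.toGraph hxy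
  · rintro _ ⟨x, hx, rfl⟩
    exact (key x hx).1
  · refine Finite.of_finite_image (f := D.toGraph) (hfin.subset ?_)
      (D.toGraph_injOn.mono fun p hp => hp.1.1)
    rintro _ ⟨p, ⟨hp, hn⟩, rfl⟩
    refine ⟨D.toGraph_mem_boundaryStar hp, ?_⟩
    rintro ⟨x, hx, hxp⟩
    refine hn ⟨x, hx, D.toGraph_injOn (key x hx).1.1 hp.1 ?_⟩
    rw [← hxp]
    exact hgr x hx
  · intro x hx
    have hp := (key x hx).1
    filter_upwards [eventually_mem_Ioo_diff hS hx, D.eventually_shift_mem_sides hp.1,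
      D.eventually_cell_shift hp.1.1, Metric.ball_mem_nhds 0 (hε x hx)] with t ht ht1 ht2 ht3
    rw [Metric.mem_ball, dist_zero_right, Real.norm_eq_abs] at ht3
    refine D.toGraph_injOn (key _ ht).1.1 ht1 ?_
    rw [hgr _ ht, h1 x hx t ht3, toGraph, ht2.2, (key x hx).2]
    refine Prod.ext ?_ rfl
    simp only [shift]
    linear_combination ((t : ℂ) * e x) * Complex.I_mul_I

theorem rHat_maps {L : ℝ} {γ : ℝ → ℂ × Set ℂ} {S : Set ℝ} {g : ℝ → ℂ × ℂ}
    (hg : IsGermParam D.outerSides L S g) (hγ : ∀ x ∈ Ioo 0 L \ S, D.toGraph (g x) = γ x)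
    {y z : ℝ} (hy : y ∈ Ioo 0 L \ S) (hz : z ∈ Ioo 0 L \ S) (hr : g y ∈ D.regular)
    (hyz : f.WVReturn u v (γ y) (γ z)) : g z = D.rHat (g y) := by
  have h1 := D.wvReturn_rHat hr
  rw [hγ y hy] at h1
  have h2 := D.wvReturn_unique _ _ _ hyz h1
  rw [← hγ z hz] at h2
  exact D.toGraph_injOn (hg.image_subset (mem_image_of_mem g hz)).1 (D.rHat_mem hr).1 h2

theorem finite_not_regular {L : ℝ} {S : Set ℝ} {g : ℝ → ℂ × ℂ}
    (hg : IsGermParam D.outerSides L S g) : {y ∈ Ioo 0 L \ S | g y ∉ D.regular}.Finite := by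
  refine Finite.of_finite_image (f := g) (D.finite_outerSides_diff_regular.subset ?_)
    (hg.injOn.mono fun y hy => hy.1)
  rintro _ ⟨y, hy, rfl⟩
  exact ⟨hg.image_subset (mem_image_of_mem g hy.1), hy.2⟩

/-- For each `ψ`, the test sum is the integral of `ψ (E y - y)`, to be compared with the mean
displacement of `rHat`. -/
theorem saf_eq_zero {L : ℝ} {γ : ℝ → ℂ × Set ℂ} (hγ : IsArcParam f.boundaryStar L γ)
    (E : IntervalExchange L) (hE : E.Represents γ (f.WVReturn u v)) : E.saf = 0 := by
  have hL := hγ.1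
  obtain ⟨S, g, hg, hgr⟩ := D.exists_germParam hγ
  refine E.saf_eq_zero fun ψ => ?_
  rw [← E.setIntegral_translation ψ]
  obtain ⟨hCint, hC⟩ := D.setIntegral_coord_rHat ψ
  obtain ⟨i1, e1⟩ := hg.setIntegral_comp hL hCint
  have i2 := hg.integrableOn_coord_sub hL ψ
  obtain ⟨i3, e3⟩ := E.setIntegral_comp_toFun i2
  -- Injectivity of `E.toFun` ensures that only finitely many points land in `S` or at the ends of
  -- the interval.
  have hbad : {y ∈ ⋃ k, piece E.x k | ¬ (y ∈ Ioo 0 L \ S ∧ g y ∈ D.regular ∧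
      E.toFun y ∈ Ioo 0 L \ S)}.Finite := by
    have h1 : {y ∈ ⋃ k, piece E.x k | E.toFun y ∉ Ioo 0 L \ S}.Finite := by
      have hf : (insert 0 (insert L S)).Finite := (hg.finite.insert _).insert _
      refine Finite.of_finite_image (f := E.toFun) (hf.subset ?_)
        (E.toFun_injOn.mono fun y hy => hy.1)
      rintro _ ⟨y, ⟨hy, hn⟩, rfl⟩
      have h := E.toFun_image_subset (mem_image_of_mem _ hy)
      by_contra hcon
      simp only [mem_insert_iff, not_or] at hcon
      exact hn ⟨⟨lt_of_le_of_ne h.1 (Ne.symm hcon.1), lt_of_le_of_ne h.2 hcon.2.1⟩, hcon.2.2⟩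
    refine ((hg.finite.union (D.finite_not_regular hg)).union h1).subset ?_
    rintro y ⟨hy, hn⟩
    have hyL : y ∈ Ioo 0 L := by
      have := iUnion_piece_subset E.strictMono hy
      rwa [E.x_zero, E.x_last] at this
    by_cases hyS : y ∈ S
    · exact Or.inl (Or.inl hyS)
    by_cases hr : g y ∈ D.regular
    · exact Or.inr ⟨hy, fun h => hn ⟨⟨hyL, hyS⟩, hr, h⟩⟩
    · exact Or.inl (Or.inr ⟨⟨hyL, hyS⟩, hr⟩)
  -- The first two terms form a coboundary for `E`; it disappears on integration because `E`
  -- preserves Lebesgue measure.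
  have hae : ∀ᵐ y ∂volume.restrict (Ioo 0 L), ψ (E.toFun y - y) =
      ψ (coord (g y) - y) - ψ (coord (g (E.toFun y)) - E.toFun y) +
        ψ (coord (D.rHat (g y)) - coord (g y)) := by
    rw [← restrict_congr_set E.iUnion_piece_ae]
    rw [ae_restrict_iff' (MeasurableSet.iUnion fun k => measurableSet_piece k)]
    refine Filter.mem_of_superset (compl_mem_ae_iff.2 (hbad.measure_zero volume)) fun y hy hyP => ?_
    obtain ⟨h1, h2, h3⟩ : y ∈ Ioo 0 L \ S ∧ g y ∈ D.regular ∧ E.toFun y ∈ Ioo 0 L \ S := by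
      by_contra h; exact hy ⟨hyP, h⟩
    have h4 : g (E.toFun y) = D.rHat (g y) := by
      obtain ⟨k, hk⟩ := mem_iUnion.1 hyP
      refine D.rHat_maps hg hgr h1 h3 h2 ?_
      rw [E.toFun_eq hk]
      exact hE k y hk
    rw [h4, ← map_sub, ← map_add]
    congr 1; ring
  have i4 : IntegrableOn (fun y => ψ (coord (g y) - y) - ψ (coord (g (E.toFun y)) - E.toFun y))
      (Ioo 0 L) := i2.sub i3
  rw [integral_congr_ae hae, integral_add i4 i1, integral_sub i2 i3, e3, e1, hC]
  ring

/-- Off a finite set, `rHat` lifts through the injective `g` to a map `ρ` of the interval, and `ρ t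
- t` is locally constant because both `rHat` and `g` commute with small shifts. -/
theorem exists_intervalExchange {L : ℝ} {γ : ℝ → ℂ × Set ℂ}
    (hγ : IsArcParam f.boundaryStar L γ) :
    ∃ E : IntervalExchange L, E.Represents γ (f.WVReturn u v) := by
  have hL := hγ.1
  obtain ⟨S, g, hg, hgr⟩ := D.exists_germParam hγ
  set U := Ioo 0 L \ S with hU
  -- Besides `S`, this removes parameters of irregular germs and those whose return germ is missed
  -- by `g`; the latter are finitely many since `rHat` is injective.
  set T : Set ℝ := S ∪ ({y ∈ U | g y ∉ D.regular} ∪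
    {y ∈ U | g y ∈ D.regular ∧ D.rHat (g y) ∉ g '' U}) with hT
  have hTf : T.Finite := by
    refine hg.finite.union ((D.finite_not_regular hg).union ?_)
    refine Finite.of_finite_image (f := fun y => D.rHat (g y)) (hg.finite_diff.subset ?_) ?_
    · rintro _ ⟨y, ⟨hy, hr, hn⟩, rfl⟩
      exact ⟨D.rHat_mem hr, hn⟩
    · intro y hy z hz h
      exact hg.injOn hy.1 hz.1 (D.rHat_injOn hy.2.1.1 hz.2.1.1 h)
  have hgood : ∀ y ∈ Ioo 0 L \ T, y ∈ U ∧ g y ∈ D.regular ∧ ∃ z ∈ U, g z = D.rHat (g y) := by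
    rintro y ⟨hy, hn⟩
    have h1 : y ∈ U := ⟨hy, fun h => hn (Or.inl h)⟩
    have h2 : g y ∈ D.regular := by
      by_contra h; exact hn (Or.inr (Or.inl ⟨h1, h⟩))
    refine ⟨h1, h2, ?_⟩
    by_contra h; exact hn (Or.inr (Or.inr ⟨h1, h2, h⟩))
  choose! h1 h2 ρ hρU hρ using hgood
  have hloc : ∀ y ∈ Ioo 0 L \ T, ∀ᶠ t in nhds y, ρ t - t = ρ y - y := by
    intro y hy
    rw [eventually_nhds_iff_add]
    filter_upwards [eventually_mem_Ioo_diff hTf hy, hg.shift y (h1 y hy),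
      D.eventually_rHat_shift (h2 y hy), hg.shift _ (hρU y hy),
      eventually_mem_Ioo_diff hg.finite (hρU y hy)] with t t1 t2 t3 t4 t5
    have : ρ (y + t) = ρ y + t := by
      refine hg.injOn (hρU _ t1) t5 ?_
      rw [hρ _ t1, t2, t3, t4, hρ y hy]
    rw [this]; ring
  obtain ⟨n, x, c, hx, hx0, hxL, hp, hc⟩ := exists_subdivision_const hL hTf hloc
  have hρc : ∀ k, ∀ y ∈ piece x k, y + c k = ρ y := fun k y hy => by
    rw [← hc k y hy]; ring
  refine ⟨⟨n, x, c, hx, hx0, hxL, fun k y hy => ?_, fun k l y hy z hz h => ?_⟩, fun k y hy => ?_⟩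
  · rw [hρc k y hy]
    exact Ioo_subset_Icc_self (hρU y (hp k hy)).1
  · rw [hρc k y hy, hρc l z hz] at h
    have hy' := hp k hy
    have hz' := hp l hz
    have h3 : D.rHat (g y) = D.rHat (g z) := by rw [← hρ y hy', ← hρ z hz', h]
    exact hg.injOn (h1 y hy') (h1 z hz') (D.rHat_injOn (h2 y hy').1 (h2 z hz').1 h3)
  · change f.WVReturn u v (γ y) (γ (y + c k))
    have hy' := hp k hy
    rw [hρc k y hy, ← hgr y (h1 y hy'), ← hgr _ (hρU y hy'), hρ y hy']
    exact D.wvReturn_rHat (h2 y hy')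

end NousData

/-! ### Existence of a parametrization of `∂*Δ`. -/

theorem IsGermParam.empty : IsGermParam ∅ 0 ∅ fun _ => 0 where
  finite := finite_empty
  norm := by simp
  injOn := by simp
  image_subset := by simp
  finite_diff := by simp
  shift := by simp

theorem IsGermParam.segment {k : ℂ × ℂ} (hk : ‖k.2‖ = 1) (a b : ℝ) :
    IsGermParam ((fun t => _root_.shift t k) '' Ioo a b) (b - a) ∅ fun y => _root_.shift (a + y) k where
  finite := finite_empty
  norm _ _ := hk
  injOn y _ z _ h := by
    have := (isometry_shift hk).injective h
    linarith
  image_subset := by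
    rintro _ ⟨y, ⟨hy, -⟩, rfl⟩
    exact ⟨a + y, ⟨by linarith [hy.1], by linarith [hy.2]⟩, rfl⟩
  finite_diff := by
    refine Finite.subset finite_empty ?_
    rintro _ ⟨⟨t, ht, rfl⟩, hn⟩
    exact hn ⟨t - a, ⟨⟨by linarith [ht.1], by linarith [ht.2]⟩, by simp⟩, by simp⟩
  shift y _ := Filter.Eventually.of_forall fun t => by
    rw [shift_shift, add_assoc]

/-- Concatenation of parametrizations. -/
theorem IsGermParam.union {X X' : Set (ℂ × ℂ)} {L L' : ℝ} {S S' : Set ℝ} {g g' : ℝ → ℂ × ℂ}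
    (hL : 0 ≤ L) (hL' : 0 ≤ L') (h : IsGermParam X L S g) (h' : IsGermParam X' L' S' g')
    (hd : Disjoint X X') :
    IsGermParam (X ∪ X') (L + L') (insert L (S ∪ (fun y => L + y) '' S'))
      fun y => if y < L then g y else g' (y - L) := by
  have hcase : ∀ y ∈ Ioo 0 (L + L') \ insert L (S ∪ (fun y => L + y) '' S'),
      (y < L ∧ y ∈ Ioo 0 L \ S) ∨ (L < y ∧ y - L ∈ Ioo 0 L' \ S') := by
    rintro y ⟨hy, hn⟩
    simp only [mem_insert_iff, mem_union, mem_image, not_or, not_exists, not_and] at hn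
    rcases lt_or_gt_of_ne hn.1 with h1 | h1
    · exact Or.inl ⟨h1, ⟨hy.1, h1⟩, hn.2.1⟩
    · exact Or.inr ⟨h1, ⟨by linarith, by linarith [hy.2]⟩, fun h2 => hn.2.2 _ h2 (by ring)⟩
  refine ⟨((h.finite.union (h'.finite.image _)).insert _), fun y hy => ?_, fun y hy z hz hyz => ?_,
    ?_, ?_, fun y hy => ?_⟩
  · rcases hcase y hy with ⟨h1, h2⟩ | ⟨h1, h2⟩
    · simp only [if_pos h1]; exact h.norm y h2
    · simp only [if_neg h1.le.not_gt]; exact h'.norm _ h2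
  · rcases hcase y hy with ⟨h1, h2⟩ | ⟨h1, h2⟩ <;> rcases hcase z hz with ⟨h3, h4⟩ | ⟨h3, h4⟩
    · simp only [if_pos h1, if_pos h3] at hyz
      exact h.injOn h2 h4 hyz
    · simp only [if_pos h1, if_neg h3.le.not_gt] at hyz
      refine absurd (h'.image_subset (mem_image_of_mem _ h4)) (disjoint_left.1 hd ?_)
      rw [← hyz]
      exact h.image_subset (mem_image_of_mem _ h2)
    · simp only [if_neg h1.le.not_gt, if_pos h3] at hyz
      refine absurd (h'.image_subset (mem_image_of_mem _ h2)) (disjoint_left.1 hd ?_)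
      rw [hyz]
      exact h.image_subset (mem_image_of_mem _ h4)
    · simp only [if_neg h1.le.not_gt, if_neg h3.le.not_gt] at hyz
      have := h'.injOn h2 h4 hyz
      linarith
  · rintro _ ⟨y, hy, rfl⟩
    rcases hcase y hy with ⟨h1, h2⟩ | ⟨h1, h2⟩
    · simp only [if_pos h1]; exact Or.inl (h.image_subset (mem_image_of_mem _ h2))
    · simp only [if_neg h1.le.not_gt]; exact Or.inr (h'.image_subset (mem_image_of_mem _ h2))
  · refine (((h.finite_diff.union h'.finite_diff).union ((h.finite.union
      (h'.finite.image fun y => L + y)).image g)).union ((h.finite.image fun y => g' (y - L)).union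
        (h'.finite.image g'))).subset ?_
    rintro p ⟨hp, hn⟩
    rcases hp with hp | hp
    · by_cases hpg : p ∈ g '' (Ioo 0 L \ S)
      · obtain ⟨y, hy, rfl⟩ := hpg
        by_cases hy' : y ∈ (fun y => L + y) '' S'
        · exact Or.inl (Or.inr (mem_image_of_mem g (Or.inr hy')))
        · refine absurd ⟨y, ⟨⟨hy.1.1, by linarith [hy.1.2]⟩, ?_⟩, ?_⟩ hn
          · rintro (h1 | h1 | h1)
            · exact hy.1.2.ne h1
            · exact hy.2 h1
            · exact hy' h1
          · simp only [if_pos hy.1.2]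
      · exact Or.inl (Or.inl (Or.inl ⟨hp, hpg⟩))
    · by_cases hpg : p ∈ g' '' (Ioo 0 L' \ S')
      · obtain ⟨y, hy, rfl⟩ := hpg
        by_cases hy' : L + y ∈ S
        · exact Or.inr (Or.inl ⟨_, hy', by simp⟩)
        · refine absurd ⟨L + y, ⟨⟨by linarith [hy.1.1], by linarith [hy.1.2]⟩, ?_⟩, ?_⟩ hn
          · rintro (h1 | h1 | ⟨z, hz, h1⟩)
            · linarith [hy.1.1]
            · exact hy' h1
            · have : z = y := by simpa using h1
              exact hy.2 (this ▸ hz)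
          · have : ¬ L + y < L := by linarith [hy.1.1]
            simp only [if_neg this, add_sub_cancel_left]
      · exact Or.inl (Or.inl (Or.inr ⟨hp, hpg⟩))
  · rcases hcase y hy with ⟨h1, h2⟩ | ⟨h1, h2⟩
    · filter_upwards [h.shift y h2, eventually_nhds_iff_add.1 (isOpen_Iio.eventually_mem h1)]
        with t ht ht'
      have ht2 : y + t < L := ht'
      simp only [if_pos h1, if_pos ht2, ht]
    · filter_upwards [h'.shift _ h2, eventually_nhds_iff_add.1 (isOpen_Ioi.eventually_mem h1)]
        with t ht ht'
      have ht2 : L < y + t := ht'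
      simp only [if_neg h1.le.not_gt, if_neg ht2.le.not_gt]
      rw [← ht]; congr 1; ring

theorem IsGermParam.mono {X X' : Set (ℂ × ℂ)} {L : ℝ} {S : Set ℝ} {g : ℝ → ℂ × ℂ}
    (h : IsGermParam X L S g) (hX : X ⊆ X') (hfin : (X' \ X).Finite) : IsGermParam X' L S g where
  finite := h.finite
  norm := h.norm
  injOn := h.injOn
  image_subset := h.image_subset.trans hX
  finite_diff := (hfin.union h.finite_diff).subset fun p hp => by
    by_cases hpX : p ∈ X
    · exact Or.inr ⟨hpX, hp.2⟩
    · exact Or.inl ⟨hp.1, hpX⟩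
  shift := h.shift

/-- The set `X` can be parametrized by an interval, up to finitely many points. -/
def HasGermParam (X : Set (ℂ × ℂ)) : Prop :=
  ∃ (L : ℝ) (S : Set ℝ) (g : ℝ → ℂ × ℂ), 0 ≤ L ∧ IsGermParam X L S g

theorem HasGermParam.biUnion {ι : Type*} (s : Finset ι) {X : ι → Set (ℂ × ℂ)}
    (hX : ∀ i ∈ s, HasGermParam (X i)) (hd : (s : Set ι).PairwiseDisjoint X) :
    HasGermParam (⋃ i ∈ s, X i) := by
  classical
  induction s using Finset.induction_on with
  | empty => exact ⟨0, ∅, _, le_rfl, by simpa using IsGermParam.empty⟩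
  | insert i s hi ih =>
    obtain ⟨L, S, g, hL, hg⟩ := hX i (Finset.mem_insert_self i s)
    obtain ⟨L', S', g', hL', hg'⟩ := ih (fun j hj => hX j (Finset.mem_insert_of_mem hj))
      (hd.subset (by simp))
    rw [Finset.set_biUnion_insert]
    refine ⟨_, _, _, add_nonneg hL hL', hg.union hL hL' hg' ?_⟩
    rw [disjoint_iUnion₂_right]
    intro j hj
    exact hd (by simp) (by simp [hj]) fun h => hi (h ▸ hj)

theorem coord_leafRep (h : ℂ × ℝ) : coord (leafRep h) = 0 := by
  simp only [coord, leafRep, ← Complex.ofReal_neg, Complex.re_ofReal_mul, Complex.im_ofReal_mul]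
  ring

namespace NousData

variable {Δ : Set ℂ} {f : PiecewiseRotation Δ} {u v : ℂ → ℂ} (D : NousData f u v)
include D

theorem norm_of_mem_reps {k : ℂ × ℂ} (hk : k ∈ D.reps) : ‖k.2‖ = 1 := by
  simp only [reps, mem_iUnion, mem_singleton_iff] at hk
  obtain ⟨Q, hQ, h, hh, rfl⟩ := hk
  exact norm_leafRep (D.planes_ne Q hQ h hh)

/-- Every representative has `coord` zero, so a common germ has the same offset from both, and
distinct representatives have disjoint leaves. -/
theorem eq_of_shift_eq {k k' : ℂ × ℂ} (hk : k ∈ D.reps) (hk' : k' ∈ D.reps) {s t : ℝ}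
    (h : shift s k = shift t k') : k = k' := by
  have hn := D.norm_of_mem_reps hk
  have hn' := D.norm_of_mem_reps hk'
  have h0 : ∀ k ∈ D.reps, coord k = 0 := fun k hk => by
    simp only [reps, mem_iUnion, mem_singleton_iff] at hk
    obtain ⟨Q, hQ, h, hh, rfl⟩ := hk
    exact coord_leafRep h
  have h1 := congrArg coord h
  rw [coord_shift hn, coord_shift hn', h0 k hk, h0 k' hk', zero_add, zero_add] at h1
  subst h1
  have h2 := congrArg (shift (-s)) h
  rwa [shift_shift, shift_shift, add_neg_cancel, shift_zero, shift_zero] at h2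

/-- The part of a leaf that consists of germs of outer sides has a parametrization. -/
theorem exists_hasGermParam_leaf {k : ℂ × ℂ} (hk : k ∈ D.reps) :
    ∃ X : Set (ℂ × ℂ), HasGermParam X ∧ X ⊆ D.outerSides ∩ range (fun t => shift t k) ∧
      ((D.outerSides ∩ range (fun t => shift t k)) \ X).Finite := by
  classical
  have hn := D.norm_of_mem_reps hk
  obtain ⟨R, hR⟩ := D.exists_norm_le
  -- A bound for the position of outer germs on this leaf; the added `1` makes it strict and
  -- positive.
  set M := |R| + ‖k.1‖ + 1 with hM
  have hM0 : 0 < M := by positivity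
  have hbd : ∀ t : ℝ, shift t k ∈ D.outerSides → |t| < M := by
    intro t ht
    rw [← norm_shift_sub hn t]
    have h1 := norm_sub_le (shift t k).1 k.1
    have h2 := hR _ ht.1.1
    have h3 := le_abs_self R
    linarith
  -- The leaf parameter `(-M, M)` is translated to `(0, 2M)`. The locally constant function is the
  -- proposition of being an outer side, with jumps possible only at germs that are not neat.
  obtain ⟨n, x, c, hx, hx0, hxL, hp, hc⟩ := exists_subdivision_const (L := 2 * M) (by linarith)
    (S := (fun y => y - M) ⁻¹' {t | shift t k ∉ D.neatAux})
    ((D.finite_leaf_diff hn).preimage (sub_left_injective).injOn)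
    (φ := fun y => shift (y - M) k ∈ D.outerSides) fun y hy => by
      rw [eventually_nhds_iff_add]
      have hneat : shift (y - M) k ∈ D.neatAux := by
        by_contra h; exact hy.2 h
      have hs : ∀ t : ℝ, shift (y + t - M) k = shift t (shift (y - M) k) := fun t => by
        rw [shift_shift]; congr 1; ring
      by_cases h : shift (y - M) k ∈ D.outerSides
      · filter_upwards [D.eventually_shift_mem_outerSides h hneat] with t ht
        rw [hs]; exact propext ⟨fun _ => h, fun _ => ht⟩
      · filter_upwards [D.eventually_shift_notMem_outerSides h hneat] with t ht
        rw [hs]; exact propext ⟨fun h' => absurd h' ht, fun h' => absurd h' h⟩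
  set X : Fin n → Set (ℂ × ℂ) := fun j =>
    (fun t => shift t k) '' Ioo (x j.castSucc - M) (x j.succ - M) with hX
  have hmem : ∀ j, ∀ t ∈ Ioo (x j.castSucc - M) (x j.succ - M), t + M ∈ piece x j := fun j t ht =>
    ⟨by linarith [ht.1], by linarith [ht.2]⟩
  refine ⟨⋃ j ∈ Finset.univ.filter fun j => c j, X j, HasGermParam.biUnion _ (fun j _ => ?_) ?_,
    ?_, ?_⟩
  · refine ⟨_, _, _, ?_, IsGermParam.segment hn _ _⟩
    linarith [hx j.castSucc_lt_succ]
  · intro i _ j _ hij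
    refine disjoint_left.2 ?_
    rintro _ ⟨s, hs, rfl⟩ ⟨t, ht, hst⟩
    have : t = s := (isometry_shift hn).injective hst
    subst this
    exact hij (eq_of_mem_piece hx (hmem i _ hs) (hmem j _ ht))
  · refine iUnion₂_subset fun j hj => ?_
    rintro _ ⟨t, ht, rfl⟩
    refine ⟨?_, t, rfl⟩
    have h1 := hc j _ (hmem j t ht)
    have h2 : c j := (Finset.mem_filter.1 hj).2
    rw [← h1, add_sub_cancel_right] at h2
    exact h2
  · refine ((finite_range x).image fun y => shift (y - M) k).subset ?_
    rintro _ ⟨⟨hp', t, rfl⟩, hnX⟩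
    by_contra hr
    have ht := abs_lt.1 (hbd t hp')
    obtain ⟨j, hj⟩ := exists_mem_piece (x := x) (y := t + M)
      (by rw [hx0, hxL]; exact ⟨by linarith [ht.1], by linarith [ht.2]⟩)
      fun h => hr ⟨t + M, h, by simp⟩
    refine hnX (mem_iUnion₂.2 ⟨j, ?_, t, ⟨by linarith [hj.1], by linarith [hj.2]⟩, rfl⟩)
    have h1 := hc j _ hj
    rw [add_sub_cancel_right] at h1
    exact Finset.mem_filter.2 ⟨Finset.mem_univ _, h1 ▸ hp'⟩

theorem hasGermParam_outerSides : HasGermParam D.outerSides := by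
  choose! X hX hsub hfin using fun k (hk : k ∈ D.reps) => D.exists_hasGermParam_leaf hk
  obtain ⟨L, S, g, hL, hg⟩ := HasGermParam.biUnion D.finite_reps.toFinset (X := X)
    (fun k hk => hX k (D.finite_reps.mem_toFinset.1 hk)) fun k hk k' hk' hne => by
      rw [SetLike.mem_coe, D.finite_reps.mem_toFinset] at hk hk'
      refine disjoint_left.2 fun p hp hp' => hne ?_
      obtain ⟨s, hs⟩ := (hsub k hk hp).2
      obtain ⟨t, ht⟩ := (hsub k' hk' hp').2
      exact D.eq_of_shift_eq hk hk' (hs.trans ht.symm)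
  refine ⟨L, S, g, hL, hg.mono (iUnion₂_subset fun k hk =>
    (hsub k (D.finite_reps.mem_toFinset.1 hk)).trans inter_subset_left) ?_⟩
  refine (D.finite_reps.biUnion hfin).subset ?_
  rintro p ⟨hp, hn⟩
  obtain ⟨k, hk, -, t, rfl⟩ := D.sides_subset_leaves hp.1
  refine mem_iUnion₂.2 ⟨k, hk, ⟨hp, t, rfl⟩, fun h => hn ?_⟩
  exact mem_iUnion₂.2 ⟨k, D.finite_reps.mem_toFinset.2 hk, h⟩

/-- The plane minus a finite set is connected, so a finite frontier would leave its whole complement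
inside the bounded set `Δ`. This excludes a parameter interval of length zero. -/
theorem infinite_frontier : (frontier Δ).Infinite := by
  intro hfin
  have hconn : IsPreconnected (frontier Δ)ᶜ :=
    (hfin.countable.isPathConnected_compl_of_one_lt_rank
      (by rw [Complex.rank_real_complex]; norm_num)).isConnected.isPreconnected
  have hsub : (frontier Δ)ᶜ ⊆ Δ := by
    refine hconn.subset_left_of_subset_union D.isOpen isClosed_closure.isOpen_compl
      (disjoint_compl_right_iff_subset.2 subset_closure) (fun z hz => ?_) ?_
    · rw [D.isOpen.frontier_eq] at hz
      by_cases h : z ∈ Δ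
      · exact Or.inl h
      · exact Or.inr fun h' => hz ⟨h', h⟩
    · obtain ⟨z, hz⟩ := D.nonempty
      exact ⟨z, D.notMem_frontier hz, hz⟩
  have h1 : Bornology.IsBounded (univ : Set ℂ) := by
    rw [← compl_union_self (frontier Δ)]
    exact (D.bounded.subset hsub).union hfin.isBounded
  exact NormedSpace.unbounded_univ ℝ ℂ h1

theorem infinite_boundaryStar : f.boundaryStar.Infinite := by
  refine Infinite.of_image Prod.fst (D.infinite_frontier.mono fun z hz => ?_)
  have h1 : z ∈ closure f.dom := closure_subset (frontier_subset_closure hz)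
  have h2 : f.dom ⊆ ⋃ Q ∈ components f.dom, Q := fun z hz =>
    mem_iUnion₂.2 ⟨_, mem_components_of_mem hz, mem_connectedComponentIn hz⟩
  have h3 := closure_mono h2 h1
  rw [D.finite.closure_biUnion] at h3
  obtain ⟨Q, hQ, hzQ⟩ := mem_iUnion₂.1 h3
  refine ⟨(z, Q), ⟨⟨hQ, ?_⟩, hz⟩, rfl⟩
  rw [(D.isOpen_component hQ).frontier_eq]
  exact ⟨hzQ, fun h => D.notMem_of_mem_frontier hz (component_subset hQ h)⟩

theorem exists_arcParam : ∃ (L : ℝ) (γ : ℝ → ℂ × Set ℂ), IsArcParam f.boundaryStar L γ := by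
  obtain ⟨L, S, g, hL, hg⟩ := D.hasGermParam_outerSides
  have hmem : ∀ y ∈ Ioo 0 L \ S, g y ∈ D.outerSides := fun y hy =>
    hg.image_subset (mem_image_of_mem g hy)
  have hfin : (f.boundaryStar \ (fun y => D.toGraph (g y)) '' (Ioo 0 L \ S)).Finite := by
    refine (D.finite_graph_diff.union (hg.finite_diff.image D.toGraph)).subset ?_
    rintro q ⟨⟨hq, hqf⟩, hn⟩
    by_cases h : q ∈ D.toGraph '' D.sides
    · obtain ⟨p, hp, rfl⟩ := h
      refine Or.inr ⟨p, ⟨⟨hp, hqf⟩, ?_⟩, rfl⟩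
      rintro ⟨y, hy, rfl⟩
      exact hn ⟨y, hy, rfl⟩
    · exact Or.inl ⟨hq, h⟩
  refine ⟨L, fun y => D.toGraph (g y), lt_of_le_of_ne hL ?_, S, hg.finite, ?_, ?_, hfin, ?_⟩
  -- With `L = 0` nothing is parametrized and `∂*Δ` would be finite.
  · rintro rfl
    refine D.infinite_boundaryStar (hfin.subset fun q hq => ⟨hq, ?_⟩)
    simp
  · intro y hy z hz h
    exact hg.injOn hy hz (D.toGraph_injOn (hmem y hy).1 (hmem z hz).1 h)
  · rintro _ ⟨y, hy, rfl⟩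
    exact D.toGraph_mem_boundaryStar (hmem y hy)
  · intro y hy
    have hp := (hmem y hy).1.1
    have hn := hg.norm y hy
    obtain ⟨-, δ, hδ, hs⟩ := D.inward_cell hp
    obtain ⟨ε, hε, h⟩ := exists_abs_lt_of_eventually
      ((hg.shift y hy).and (D.eventually_cell_shift hp))
    -- The velocity `e` is determined by `I * e = n`: the inner side lies on the left.
    refine ⟨-(Complex.I * (g y).2), by simpa using hn, min ε δ, lt_min hε hδ, fun t ht => ?_,
      fun r hr hr' => ?_⟩
    · obtain ⟨h1, -, h2⟩ := h t (ht.trans_le (min_le_left _ _))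
      change D.toGraph (g (y + t)) = ((g y).1 + t * -(Complex.I * (g y).2), D.cell (g y))
      rw [h1]
      refine Prod.ext ?_ h2
      simp only [toGraph, shift]
      ring
    · have h3 := hs (mem_halfDisc_add hn hr (hr'.trans_le (min_le_right _ _)))
      change (g y).1 + r * (Complex.I * -(Complex.I * (g y).2)) ∈ D.cell (g y)
      convert h3 using 1
      linear_combination (-(r : ℂ) * (g y).2) * Complex.I_mul_I

end NousData

theorem exists_nousData {Δ : Set ℂ} (hΔ : IsBoundedPolygon Δ) (f : PiecewiseRotation Δ)
    (hfin : (components f.dom).Finite) (u v : ℂ → ℂ) (huv : f.IsSymmetricNousPair u v)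
    (hjump : f.DoubleJump v) (hper : f.IsPeriodic) : Nonempty (NousData f u v) := by
  choose! hne H hH0 hH using f.polygon
  choose! va vb hva hv using huv.v_reversing
  obtain ⟨ua, ub, hua, hu⟩ := huv.u_reversing
  obtain ⟨n, hn, hp⟩ := hper
  exact ⟨⟨hΔ.isOpen, hΔ.bounded, hΔ.connected.nonempty, hΔ.interior_closure, hfin, H, hH0, hH, va,
    vb, hva, hv, ua, ub, hua, hu, huv, hjump, n, hn, hp⟩⟩

theorem mainTheorem4 (Δ : Set ℂ) (hΔ : IsBoundedPolygon Δ) (f : PiecewiseRotation Δ)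
    (hfin : (components f.dom).Finite) (u v : ℂ → ℂ) (huv : f.IsSymmetricNousPair u v)
    (hjump : f.DoubleJump v) (hper : f.IsPeriodic) :
    (∃ (L : ℝ) (γ : ℝ → ℂ × Set ℂ), IsArcParam f.boundaryStar L γ) ∧
      ∀ (L : ℝ) (γ : ℝ → ℂ × Set ℂ), IsArcParam f.boundaryStar L γ →
        (∃ E : IntervalExchange L, E.Represents γ (f.WVReturn u v)) ∧
          ∀ E : IntervalExchange L, E.Represents γ (f.WVReturn u v) → E.saf = 0 := by
  obtain ⟨D⟩ := exists_nousData hΔ f hfin u v huv hjump hper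
  exact ⟨D.exists_arcParam, fun L γ hγ =>
    ⟨D.exists_intervalExchange hγ, fun E hE => D.saf_eq_zero hγ E hE⟩⟩
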